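/- Let $\Omega\subset\mathbb{C}^2$ be a bounded pseudoconvex domain with smooth boundary, with coordinates $(z,w)$ in which $\Omega$ is Hartogs, i.e. $(e^{i\theta}z,w)\in\Omega$ whenever $(z,w)\in\Omega$ and $\theta\in\mathbb{R}$. Let $\tilde\delta$ be the signed distance to $b\Omega$ (negative in $\Omega$, positive outside $\overline\Omega$). Call a set $K\subset\mathbb{C}^2$ disk-like if $(z,w)\in K$ implies $(rz,w)\in K$ for all $0\le r\le1$, and annulus-like if $(z,w)\in K$ implies $(0,w)\notin K$. Let $W\subset b\Omega$ be the set of weakly pseudoconvex points (boundary points at which $\Omega$ is not strictly pseudoconvex), and let $M_1=\{p\in W:\frac{\partial\tilde\delta}{\partial z}(p)=0\}$ and $M_2=\{p\in W:\frac{\partial\tilde\delta}{\partial z}(p)\ne0\}$. Assume that $\Omega$ has regular weakly pseudoconvex points: $M_1\cap\overline{M_2}=\emptyset$, $M_1$ has finitely many connected components, and each of them is disk-like or annulus-like. Suppose that for every annulus-like connected component $K$ of $$\left\{p\in b\Omega:\ \frac{\partial\tilde\delta}{\partial z}(p)=0\ \text{ and }\ \frac{\partial^2\tilde\delta}{\partial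 z\,\partial\bar z}(p)=0\right\}$$ there are constants $B_K\ge A_K>0$ and $C_K>0$ such that $A_K\le|z|^2\le B_K$ and $\left|\frac{\partial^2\tilde\delta}{\partial w\,\partial\bar z}\right|\le\frac{C_K}{|z|}$ on $K$. Then the Diederich–Fornæss index of $\Omega$, that is, the supremum of all $\tau\in(0,1)$ for which there is a smooth defining function $\rho$ of $\Omega$ (a smooth $\rho:\mathbb{C}^2\to\mathbb{R}$ with $\Omega=\{\rho<0\}$ and $d\rho\ne0$ on $b\Omega$) such that $-(-\rho)^\tau$ is plurisubharmonic on $\Omega$, is at least $$\min_K\ \frac{\pi}{2C_K\log\frac{B_K}{A_K}+\pi},$$ the minimum being taken over all annulus-like components $K$ (and read as $1$ if there are none). In particular, if the same constants $A,B,C$ serve for every such $K$, the index is at least $\frac{\pi}{2C\log\frac BA+\pi}$. -/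

import Mathlib

open scoped ContDiff

noncomputable section

/-- Complex Euclidean space of dimension two; a point `p` has coordinates `z = p 0`, `w = p 1`. -/
abbrev C2 : Type := EuclideanSpace ℂ (Fin 2)

/-- The Wirtinger derivative with respect to the `j`-th complex coordinate, that is
`(1/2) (∂/∂x_j - i ∂/∂y_j)`. -/
def wirt (j : Fin 2) (f : C2 → ℂ) (p : C2) : ℂ :=
  (1 / 2 : ℂ) * (fderiv ℝ f p (EuclideanSpace.single j 1)
    - Complex.I * fderiv ℝ f p (EuclideanSpace.single j Complex.I))

/-- The conjugate Wirtinger derivative with respect to the `j`-th complex coordinate, that is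
`(1/2) (∂/∂x_j + i ∂/∂y_j)`. -/
def wirtBar (j : Fin 2) (f : C2 → ℂ) (p : C2) : ℂ :=
  (1 / 2 : ℂ) * (fderiv ℝ f p (EuclideanSpace.single j 1)
    + Complex.I * fderiv ℝ f p (EuclideanSpace.single j Complex.I))

/-- The complex Hessian (Levi form) `∑ j k, ∂²φ/∂z_j∂z̄_k (p) t_j t̄_k` of a real-valued
function; the sum is real for `C²` functions. -/
def complexHessian (φ : C2 → ℝ) (p t : C2) : ℝ :=
  (∑ j : Fin 2, ∑ k : Fin 2,
    wirt j (wirtBar k (fun x => (φ x : ℂ))) p * t j * (starRingEnd ℂ) (t k)).re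

/-- A `C²` function is plurisubharmonic on `Ω` if its complex Hessian is positive semi-definite at
every point of `Ω`. -/
def IsC2Plurisubharmonic (Ω : Set C2) (φ : C2 → ℝ) : Prop :=
  ContDiffOn ℝ 2 φ Ω ∧ ∀ p ∈ Ω, ∀ t : C2, 0 ≤ complexHessian φ p t

/-- `r` is a defining function of class `C^n` for `Ω`. -/
def IsDefiningFunction (n : ℕ∞) (Ω : Set C2) (r : C2 → ℝ) : Prop :=
  ContDiff ℝ n r ∧ Ω = {p | r p < 0} ∧ ∀ p ∈ frontier Ω, fderiv ℝ r p ≠ 0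

/-- `Ω` has smooth boundary. -/
def HasSmoothBoundary (Ω : Set C2) : Prop :=
  ∃ r : C2 → ℝ, IsDefiningFunction (⊤ : ℕ∞) Ω r

/-- `t` is a complex tangent vector at `p` to the level set of `r`. -/
def IsComplexTangent (r : C2 → ℝ) (p t : C2) : Prop :=
  ∑ j : Fin 2, t j * wirt j (fun x => (r x : ℂ)) p = 0

/-- Pseudoconvexity of a domain with `C²` boundary: the Levi form of any `C²` defining
function is nonnegative on complex tangent vectors at every boundary point. -/
def IsLeviPseudoconvex (Ω : Set C2) : Prop :=
  ∀ r : C2 → ℝ, IsDefiningFunction 2 Ω r → ∀ p ∈ frontier Ω, ∀ t : C2,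
    IsComplexTangent r p t → 0 ≤ complexHessian r p t

/-- `Ω` is strictly pseudoconvex at the boundary point `p`. -/
def IsStrictlyPseudoconvexAt (Ω : Set C2) (p : C2) : Prop :=
  ∀ r : C2 → ℝ, IsDefiningFunction 2 Ω r → ∀ t : C2, t ≠ 0 →
    IsComplexTangent r p t → 0 < complexHessian r p t

/-- The set of weakly pseudoconvex boundary points. -/
def weaklyPseudoconvexPoints (Ω : Set C2) : Set C2 :=
  {p | p ∈ frontier Ω ∧ ¬ IsStrictlyPseudoconvexAt Ω p}

open Classical in
/-- The signed distance to the boundary of `Ω`: negative inside, positive outside. -/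
def signedBdryDist (Ω : Set C2) (p : C2) : ℝ :=
  if p ∈ closure Ω then - Metric.infDist p (frontier Ω) else Metric.infDist p (frontier Ω)

/-- The signed distance as a complex-valued function, to which Wirtinger derivatives apply. -/
def signedBdryDistC (Ω : Set C2) (p : C2) : ℂ := (signedBdryDist Ω p : ℂ)

/-- `Ω` is invariant under rotations in the first coordinate. -/
def IsHartogs (Ω : Set C2) : Prop :=
  ∀ p ∈ Ω, ∀ θ : ℝ, (!₂[Complex.exp (θ * Complex.I) * p 0, p 1] : C2) ∈ Ω

/-- Weakly pseudoconvex points at which `∂δ̃/∂z = 0`. -/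
def weakSet₁ (Ω : Set C2) : Set C2 :=
  {p | p ∈ weaklyPseudoconvexPoints Ω ∧ wirt 0 (signedBdryDistC Ω) p = 0}

/-- Weakly pseudoconvex points at which `∂δ̃/∂z ≠ 0`. -/
def weakSet₂ (Ω : Set C2) : Set C2 :=
  {p | p ∈ weaklyPseudoconvexPoints Ω ∧ wirt 0 (signedBdryDistC Ω) p ≠ 0}

/-- The collection of connected components of a subset `S` of `ℂ²`. -/
def componentsOf (S : Set C2) : Set (Set C2) :=
  {K | ∃ p ∈ S, K = connectedComponentIn S p}

/-- If `(z, w) ∈ K`, then `(r z, w) ∈ K` for all `0 ≤ r ≤ 1`. -/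
def IsDiskLike (K : Set C2) : Prop :=
  ∀ p ∈ K, ∀ r : ℝ, 0 ≤ r → r ≤ 1 → (!₂[(r : ℂ) * p 0, p 1] : C2) ∈ K

/-- If `(z, w) ∈ K`, then `(0, w) ∉ K`. -/
def IsAnnulusLike (K : Set C2) : Prop :=
  ∀ p ∈ K, (!₂[0, p 1] : C2) ∉ K

/-- `Ω` has regular weakly pseudoconvex points. -/
def HasRegularWeaklyPseudoconvexPoints (Ω : Set C2) : Prop :=
  weakSet₁ Ω ∩ closure (weakSet₂ Ω) = ∅ ∧
  (componentsOf (weakSet₁ Ω)).Finite ∧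
  ∀ K ∈ componentsOf (weakSet₁ Ω), IsDiskLike K ∨ IsAnnulusLike K

/-- The set of boundary points at which `∂δ̃/∂z = 0` and `∂²δ̃/∂z∂z̄ = 0`. -/
def criticalSet (Ω : Set C2) : Set C2 :=
  {p | p ∈ frontier Ω ∧ wirt 0 (signedBdryDistC Ω) p = 0 ∧
    wirt 0 (wirtBar 0 (signedBdryDistC Ω)) p = 0}

/-- The annulus-like connected components of `criticalSet Ω`. -/
def annulusLikeComponents (Ω : Set C2) : Set (Set C2) :=
  {K | K ∈ componentsOf (criticalSet Ω) ∧ IsAnnulusLike K}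

/-- `τ ∈ (0, 1)` is a Diederich-Fornæss exponent for `Ω`: there is a smooth defining function `ρ`
such that `-(-ρ)^τ` is plurisubharmonic on `Ω`. -/
def IsDFExponent (Ω : Set C2) (τ : ℝ) : Prop :=
  0 < τ ∧ τ < 1 ∧ ∃ ρ : C2 → ℝ, IsDefiningFunction (⊤ : ℕ∞) Ω ρ ∧
    IsC2Plurisubharmonic Ω (fun p => -((-ρ p) ^ τ))

/-- The Diederich-Fornæss index: the supremum of all Diederich-Fornæss exponents. -/
def dfIndex (Ω : Set C2) : ℝ := sSup {τ : ℝ | IsDFExponent Ω τ}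

end

/-! Seek a defining function d·exp ψ, where d is smooth and equals the signed distance near the
boundary. In the frame L = `tangentVec d`, N = `realGrad d`, the complex Hessian of -(-d·exp ψ)^τ
is, up to a positive factor, a quadratic form whose N-coefficient blows up like (1-τ)/(4|d|).
Positivity near a boundary point therefore only needs an L-coefficient of size |d|·A₀, with A₀ large
enough against the cross term (`eventually_complexHessian_nonneg`). At strictly pseudoconvex points
this is automatic. At a weakly pseudoconvex point the Levi function `leviFn d` has a minimum along
the boundary, so its differential is -μ times that of d, and what remains is the pointwise
inequality `IsAdmissibleWeight` on the 2-jet of ψ.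

Two identities for d drive all computations: the eikonal equation |d_z|² + |d_w|² = 1/4 and the
rotation identity z d_z = z̄ d_z̄, both differentiated.

Where d_z ≠ 0, the function φ = z d_z is real and nonvanishing, and ψ = -log|φ| satisfies the
inequality with equality for every τ. Adding -ε‖x‖² makes it strict
(`isAdmissibleWeight_of_transversal`).

At a flat point, d_z = d_zz̄ = 0, one finds 2μ = |d_zz|² + 2|d_zw̄|². If the cross term of ψ
vanishes, it then suffices that τ(4|d_zw̄|² + |ψ_z|²) < -(1-τ)ψ_zz̄ (`isAdmissibleWeight_of_flat`).
On a disk-like component z d_zw d_w̄ is constant along rays down to z = 0, so d_zw̄ = 0 and ψ =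
-ε‖x‖² works. On an annulus-like component take ψ a function of x = log|z|²; rotation invariance
kills the cross term. With |d_zw̄| ≤ C/|z|, k = τ/(1-τ) and v = dψ/dx, the borderline case is the
Riccati equation -v' = k(4C² + v²), solved by v = -2C tan(2kC(x - x₀)). Such a solution lives on an
interval of length log(B/A) exactly when 2kC log(B/A) < π, that is, when τ < π/(2C log(B/A) + π).
This is where the bound comes from.

Regularity splits the weakly pseudoconvex points into finitely many disjoint closed sets, so the
local weights glue by cutoffs (`exists_admissible_weight`). Composition with a convex increasing
function that is constant deep inside Ω turns plurisubharmonicity near the boundary into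
plurisubharmonicity on Ω (`isDFExponent_of_eventually`). -/

open scoped ContDiff
open Complex ComplexConjugate

/-! ### Wirtinger calculus and chain rules for the Levi form. -/

section WirtingerCalculus

theorem C2.eq_sum_real (v : C2) :
    v = ∑ j : Fin 2, ((v j).re • (EuclideanSpace.single j (1 : ℂ) : C2)
      + (v j).im • (EuclideanSpace.single j I : C2)) := by
  ext i
  fin_cases i <;> simp [Fin.sum_univ_two, Complex.re_add_im]

theorem fderiv_eq_wirt (f : C2 → ℂ) (p v : C2) :
    fderiv ℝ f p v = (v 0 * wirt 0 f p + conj (v 0) * wirtBar 0 f p)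
      + (v 1 * wirt 1 f p + conj (v 1) * wirtBar 1 f p) := by
  conv_lhs => rw [C2.eq_sum_real v]
  simp only [Fin.sum_univ_two, map_add, map_smul, Complex.real_smul, wirt, wirtBar]
  rw [← Complex.re_add_im (v 0), ← Complex.re_add_im (v 1)]
  simp only [map_add, map_mul, conj_ofReal, conj_I, add_re, add_im, ofReal_re, ofReal_im, mul_re,
    mul_im, I_re, I_im, mul_zero, mul_one, sub_zero, add_zero, zero_add]
  ring_nf
  simp only [I_sq]
  ring

theorem wirtBar_conj (j : Fin 2) (f : C2 → ℂ) (p : C2) :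
    wirtBar j (fun x => conj (f x)) p = conj (wirt j f p) := by
  have h : fderiv ℝ (fun x => conj (f x)) p = (conjCLE : ℂ →L[ℝ] ℂ) ∘L fderiv ℝ f p :=
    conjCLE.comp_fderiv (f := f) (x := p)
  simp [wirt, wirtBar, h, map_ofNat]

theorem wirt_conj (j : Fin 2) (f : C2 → ℂ) (p : C2) :
    wirt j (fun x => conj (f x)) p = conj (wirtBar j f p) := by
  have h : fderiv ℝ (fun x => conj (f x)) p = (conjCLE : ℂ →L[ℝ] ℂ) ∘L fderiv ℝ f p :=
    conjCLE.comp_fderiv (f := f) (x := p)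
  simp [wirt, wirtBar, h, sub_eq_add_neg, map_ofNat]

theorem conj_wirt_ofReal (j : Fin 2) (φ : C2 → ℝ) (p : C2) :
    conj (wirt j (fun x => (φ x : ℂ)) p) = wirtBar j (fun x => (φ x : ℂ)) p := by
  rw [← wirtBar_conj]; simp

theorem conj_wirtBar_ofReal (j : Fin 2) (φ : C2 → ℝ) (p : C2) :
    conj (wirtBar j (fun x => (φ x : ℂ)) p) = wirt j (fun x => (φ x : ℂ)) p := by
  rw [← wirt_conj]; simp

theorem wirt_add (j : Fin 2) {f g : C2 → ℂ} {p : C2} (hf : DifferentiableAt ℝ f p)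
    (hg : DifferentiableAt ℝ g p) :
    wirt j (fun x => f x + g x) p = wirt j f p + wirt j g p := by
  simp only [wirt, fderiv_fun_add hf hg, add_apply]; ring

theorem wirtBar_add (j : Fin 2) {f g : C2 → ℂ} {p : C2} (hf : DifferentiableAt ℝ f p)
    (hg : DifferentiableAt ℝ g p) :
    wirtBar j (fun x => f x + g x) p = wirtBar j f p + wirtBar j g p := by
  simp only [wirtBar, fderiv_fun_add hf hg, add_apply]; ring

theorem wirt_sub (j : Fin 2) {f g : C2 → ℂ} {p : C2} (hf : DifferentiableAt ℝ f p)
    (hg : DifferentiableAt ℝ g p) :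
    wirt j (fun x => f x - g x) p = wirt j f p - wirt j g p := by
  simp only [wirt, fderiv_fun_sub hf hg, sub_apply]; ring

theorem wirt_mul (j : Fin 2) {f g : C2 → ℂ} {p : C2} (hf : DifferentiableAt ℝ f p)
    (hg : DifferentiableAt ℝ g p) :
    wirt j (fun x => f x * g x) p = f p * wirt j g p + wirt j f p * g p := by
  simp only [wirt, fderiv_fun_mul hf hg, add_apply,
    smul_apply, smul_eq_mul]; ring

theorem wirtBar_mul (j : Fin 2) {f g : C2 → ℂ} {p : C2} (hf : DifferentiableAt ℝ f p)
    (hg : DifferentiableAt ℝ g p) :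
    wirtBar j (fun x => f x * g x) p = f p * wirtBar j g p + wirtBar j f p * g p := by
  simp only [wirtBar, fderiv_fun_mul hf hg, add_apply,
    smul_apply, smul_eq_mul]; ring

@[simp] theorem wirt_const (j : Fin 2) (c : ℂ) (p : C2) : wirt j (fun _ => c) p = 0 := by
  simp [wirt]

@[simp] theorem wirtBar_const (j : Fin 2) (c : ℂ) (p : C2) : wirtBar j (fun _ => c) p = 0 := by
  simp [wirtBar]

theorem fderiv_coord (i : Fin 2) (p v : C2) : fderiv ℝ (fun x : C2 => x i) p v = v i := by
  have : (fun x : C2 => x i) = ((EuclideanSpace.proj i : C2 →L[ℂ] ℂ).restrictScalars ℝ) := by ext; rfl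
  rw [this, ContinuousLinearMap.fderiv]; rfl

theorem contDiff_coord {n : WithTop ℕ∞} (i : Fin 2) : ContDiff ℝ n (fun x : C2 => x i) :=
  ((EuclideanSpace.proj i : C2 →L[ℂ] ℂ).restrictScalars ℝ).contDiff

theorem wirt_coord (j i : Fin 2) (p : C2) :
    wirt j (fun x : C2 => x i) p = if i = j then 1 else 0 := by
  simp only [wirt, fderiv_coord]
  by_cases h : i = j
  · subst h; simp; norm_num
  · simp [h]

theorem wirtBar_coord (j i : Fin 2) (p : C2) : wirtBar j (fun x : C2 => x i) p = 0 := by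
  simp only [wirtBar, fderiv_coord]
  by_cases h : i = j
  · subst h; simp
  · simp [h]

theorem Filter.EventuallyEq.wirt_eq {j : Fin 2} {f g : C2 → ℂ} {p : C2}
    (h : f =ᶠ[nhds p] g) : wirt j f p = wirt j g p := by
  simp only [wirt, h.fderiv_eq]

theorem Filter.EventuallyEq.wirtBar_eq {j : Fin 2} {f g : C2 → ℂ} {p : C2}
    (h : f =ᶠ[nhds p] g) : wirtBar j f p = wirtBar j g p := by
  simp only [wirtBar, h.fderiv_eq]

theorem Filter.EventuallyEq.wirtBar {j : Fin 2} {f g : C2 → ℂ} {p : C2}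
    (h : f =ᶠ[nhds p] g) : wirtBar j f =ᶠ[nhds p] wirtBar j g :=
  h.eventuallyEq_nhds.mono fun _ hx => hx.wirtBar_eq

theorem ContDiffAt.wirt {m n : WithTop ℕ∞} (j : Fin 2) {f : C2 → ℂ} {p : C2}
    (hf : ContDiffAt ℝ n f p) (hmn : m + 1 ≤ n) : ContDiffAt ℝ m (wirt j f) p := by
  have h := hf.fderiv_right hmn
  unfold _root_.wirt
  exact contDiffAt_const.mul ((h.clm_apply contDiffAt_const).sub
    (contDiffAt_const.mul (h.clm_apply contDiffAt_const)))

theorem ContDiffAt.wirtBar {m n : WithTop ℕ∞} (j : Fin 2) {f : C2 → ℂ} {p : C2}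
    (hf : ContDiffAt ℝ n f p) (hmn : m + 1 ≤ n) : ContDiffAt ℝ m (wirtBar j f) p := by
  have h := hf.fderiv_right hmn
  unfold _root_.wirtBar
  exact contDiffAt_const.mul ((h.clm_apply contDiffAt_const).add
    (contDiffAt_const.mul (h.clm_apply contDiffAt_const)))

theorem ContDiff.wirt (j : Fin 2) {f : C2 → ℂ} (hf : ContDiff ℝ ∞ f) :
    ContDiff ℝ ∞ (wirt j f) :=
  contDiff_iff_contDiffAt.2 fun _ => hf.contDiffAt.wirt j le_rfl

theorem ContDiff.wirtBar (j : Fin 2) {f : C2 → ℂ} (hf : ContDiff ℝ ∞ f) :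
    ContDiff ℝ ∞ (wirtBar j f) :=
  contDiff_iff_contDiffAt.2 fun _ => hf.contDiffAt.wirtBar j le_rfl

theorem ContDiffAt.complexOfReal {n : WithTop ℕ∞} {φ : C2 → ℝ} {p : C2}
    (hφ : ContDiffAt ℝ n φ p) : ContDiffAt ℝ n (fun x => (φ x : ℂ)) p :=
  ofRealCLM.contDiff.contDiffAt.comp p hφ

theorem ContDiff.complexOfReal {n : WithTop ℕ∞} {φ : C2 → ℝ}
    (hφ : ContDiff ℝ n φ) : ContDiff ℝ n (fun x => (φ x : ℂ)) :=
  ofRealCLM.contDiff.comp hφ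

theorem fderiv_complexOfReal {φ : C2 → ℝ} {p : C2} (hφ : DifferentiableAt ℝ φ p) (v : C2) :
    fderiv ℝ (fun x => (φ x : ℂ)) p v = ((fderiv ℝ φ p v : ℝ) : ℂ) := by
  have h := (ofRealCLM.hasFDerivAt (x := φ p)).comp p hφ.hasFDerivAt
  have h2 : HasFDerivAt (fun x => (φ x : ℂ)) (ofRealCLM.comp (fderiv ℝ φ p)) p := h
  rw [h2.fderiv]; rfl

theorem fderiv_fderiv_apply {f : C2 → ℂ} {p : C2} (hf : ContDiffAt ℝ 2 f p) (u v : C2) :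
    fderiv ℝ (fun x => fderiv ℝ f x u) p v = fderiv ℝ (fderiv ℝ f) p v u := by
  have h : DifferentiableAt ℝ (fderiv ℝ f) p :=
    (hf.fderiv_right (m := 1) (by norm_num)).differentiableAt (by norm_num)
  rw [fderiv_clm_apply h (differentiableAt_const u)]
  simp

theorem differentiableAt_fderiv_apply {f : C2 → ℂ} {p : C2} (hf : ContDiffAt ℝ 2 f p) (u : C2) :
    DifferentiableAt ℝ (fun x => fderiv ℝ f x u) p := by
  have h : DifferentiableAt ℝ (fderiv ℝ f) p :=
    (hf.fderiv_right (m := 1) (by norm_num)).differentiableAt (by norm_num)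
  exact h.clm_apply (differentiableAt_const u)

theorem fderiv_wirt {f : C2 → ℂ} {p : C2} (hf : ContDiffAt ℝ 2 f p) (j : Fin 2) (v : C2) :
    fderiv ℝ (wirt j f) p v = (1 / 2 : ℂ) *
      (fderiv ℝ (fderiv ℝ f) p v (EuclideanSpace.single j 1)
        - I * fderiv ℝ (fderiv ℝ f) p v (EuclideanSpace.single j I)) := by
  unfold wirt
  have h1 := differentiableAt_fderiv_apply hf (EuclideanSpace.single j 1)
  have h2 := differentiableAt_fderiv_apply hf (EuclideanSpace.single j I)
  have h3 := ((h1.hasFDerivAt.fun_sub (h2.hasFDerivAt.const_mul I)).const_mul (1 / 2 : ℂ)).fderiv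
  rw [h3]
  simp only [smul_apply, sub_apply, smul_eq_mul,
    fderiv_fderiv_apply hf]

theorem fderiv_wirtBar {f : C2 → ℂ} {p : C2} (hf : ContDiffAt ℝ 2 f p) (j : Fin 2) (v : C2) :
    fderiv ℝ (wirtBar j f) p v = (1 / 2 : ℂ) *
      (fderiv ℝ (fderiv ℝ f) p v (EuclideanSpace.single j 1)
        + I * fderiv ℝ (fderiv ℝ f) p v (EuclideanSpace.single j I)) := by
  unfold wirtBar
  have h1 := differentiableAt_fderiv_apply hf (EuclideanSpace.single j 1)
  have h2 := differentiableAt_fderiv_apply hf (EuclideanSpace.single j I)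
  have h3 := ((h1.hasFDerivAt.fun_add (h2.hasFDerivAt.const_mul I)).const_mul (1 / 2 : ℂ)).fderiv
  rw [h3]
  simp only [smul_apply, add_apply, smul_eq_mul,
    fderiv_fderiv_apply hf]

theorem fderiv_fderiv_symm {f : C2 → ℂ} {p : C2} (hf : ContDiffAt ℝ 2 f p) (u v : C2) :
    fderiv ℝ (fderiv ℝ f) p u v = fderiv ℝ (fderiv ℝ f) p v u :=
  (hf.isSymmSndFDerivAt (by simp)).eq u v

theorem wirt_wirtBar_comm {f : C2 → ℂ} {p : C2} (hf : ContDiffAt ℝ 2 f p) (j k : Fin 2) :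
    wirt j (wirtBar k f) p = wirtBar k (wirt j f) p := by
  rw [wirt, wirtBar.eq_1 k (wirt j f) p]
  simp only [fderiv_wirt hf, fderiv_wirtBar hf]
  rw [fderiv_fderiv_symm hf (EuclideanSpace.single k 1) (EuclideanSpace.single j 1),
    fderiv_fderiv_symm hf (EuclideanSpace.single k 1) (EuclideanSpace.single j I),
    fderiv_fderiv_symm hf (EuclideanSpace.single k I) (EuclideanSpace.single j 1),
    fderiv_fderiv_symm hf (EuclideanSpace.single k I) (EuclideanSpace.single j I)]
  ring

theorem wirt_wirt_comm {f : C2 → ℂ} {p : C2} (hf : ContDiffAt ℝ 2 f p) (j k : Fin 2) :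
    wirt j (wirt k f) p = wirt k (wirt j f) p := by
  rw [wirt, wirt.eq_1 k (wirt j f) p]
  simp only [fderiv_wirt hf]
  rw [fderiv_fderiv_symm hf (EuclideanSpace.single k 1) (EuclideanSpace.single j 1),
    fderiv_fderiv_symm hf (EuclideanSpace.single k 1) (EuclideanSpace.single j I),
    fderiv_fderiv_symm hf (EuclideanSpace.single k I) (EuclideanSpace.single j 1),
    fderiv_fderiv_symm hf (EuclideanSpace.single k I) (EuclideanSpace.single j I)]
  ring

/-- The polarised complex Hessian `∑ j k, ∂²φ/∂z_j∂z̄_k (p) s_j t̄_k`. -/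
noncomputable def leviForm (φ : C2 → ℝ) (p s t : C2) : ℂ :=
  ∑ j : Fin 2, ∑ k : Fin 2, wirt j (wirtBar k (fun x => (φ x : ℂ))) p * s j * conj (t k)

/-- The `(1,0)`-derivative `∑ j, t_j ∂φ/∂z_j (p)`. -/
noncomputable def holDeriv (φ : C2 → ℝ) (p t : C2) : ℂ :=
  ∑ j : Fin 2, t j * wirt j (fun x => (φ x : ℂ)) p

theorem complexHessian_eq_re_leviForm (φ : C2 → ℝ) (p t : C2) :
    complexHessian φ p t = (leviForm φ p t t).re := rfl

theorem wirt_comp {χ : ℝ → ℝ} {φ : C2 → ℝ} {p : C2} (hχ : DifferentiableAt ℝ χ (φ p))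
    (hφ : DifferentiableAt ℝ φ p) (j : Fin 2) :
    wirt j (fun x => ((χ (φ x) : ℝ) : ℂ)) p
      = ((deriv χ (φ p) : ℝ) : ℂ) * wirt j (fun x => (φ x : ℂ)) p := by
  have h : fderiv ℝ (fun x => χ (φ x)) p = deriv χ (φ p) • fderiv ℝ φ p :=
    (hχ.hasDerivAt.comp_hasFDerivAt p hφ.hasFDerivAt).fderiv
  have hc : DifferentiableAt ℝ (fun x => χ (φ x)) p := hχ.comp p hφ
  simp only [wirt, fderiv_complexOfReal hφ, fderiv_complexOfReal hc, h,
    smul_apply, smul_eq_mul, ofReal_mul]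
  ring

theorem wirtBar_comp {χ : ℝ → ℝ} {φ : C2 → ℝ} {p : C2} (hχ : DifferentiableAt ℝ χ (φ p))
    (hφ : DifferentiableAt ℝ φ p) (j : Fin 2) :
    wirtBar j (fun x => ((χ (φ x) : ℝ) : ℂ)) p
      = ((deriv χ (φ p) : ℝ) : ℂ) * wirtBar j (fun x => (φ x : ℂ)) p := by
  rw [← conj_wirt_ofReal, wirt_comp hχ hφ, map_mul, conj_ofReal, conj_wirt_ofReal]

theorem wirt_wirtBar_comp {χ : ℝ → ℝ} {φ : C2 → ℝ} {p : C2} (hχ : ContDiffAt ℝ 2 χ (φ p))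
    (hφ : ContDiffAt ℝ 2 φ p) (j k : Fin 2) :
    wirt j (wirtBar k (fun x => ((χ (φ x) : ℝ) : ℂ))) p
      = ((deriv χ (φ p) : ℝ) : ℂ) * wirt j (wirtBar k (fun x => (φ x : ℂ))) p
        + ((deriv (deriv χ) (φ p) : ℝ) : ℂ) * wirt j (fun x => (φ x : ℂ)) p
          * wirtBar k (fun x => (φ x : ℂ)) p := by
  have h1 : ∀ᶠ x in nhds p, ContDiffAt ℝ 2 φ x := hφ.eventually (by simp)
  have h2 : ∀ᶠ x in nhds p, ContDiffAt ℝ 2 χ (φ x) :=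
    hφ.continuousAt.eventually (hχ.eventually (by simp))
  have h3 : wirtBar k (fun x => ((χ (φ x) : ℝ) : ℂ)) =ᶠ[nhds p]
      fun x => ((deriv χ (φ x) : ℝ) : ℂ) * wirtBar k (fun x => (φ x : ℂ)) x := by
    filter_upwards [h1, h2] with x hx1 hx2
    exact wirtBar_comp (hx2.differentiableAt (by norm_num)) (hx1.differentiableAt (by norm_num)) k
  have hd : DifferentiableAt ℝ (deriv χ) (φ p) := by
    have := hχ.fderiv_right (m := 1) (by norm_num)
    have h4 := (this.clm_apply (contDiffAt_const (c := (1 : ℝ)))).differentiableAt (by norm_num)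
    exact h4
  have hφ1 : DifferentiableAt ℝ φ p := hφ.differentiableAt (by norm_num)
  have hA : DifferentiableAt ℝ (fun x => ((deriv χ (φ x) : ℝ) : ℂ)) p :=
    ofRealCLM.differentiableAt.comp p (hd.comp p hφ1)
  have hB : DifferentiableAt ℝ (wirtBar k (fun x => (φ x : ℂ))) p :=
    (hφ.complexOfReal.wirtBar k (m := 1) (by norm_num)).differentiableAt (by norm_num)
  rw [h3.wirt_eq, wirt_mul j hA hB, wirt_comp hd hφ1]

theorem leviForm_comp {χ : ℝ → ℝ} {φ : C2 → ℝ} {p : C2} (hχ : ContDiffAt ℝ 2 χ (φ p))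
    (hφ : ContDiffAt ℝ 2 φ p) (s t : C2) :
    leviForm (fun x => χ (φ x)) p s t = ((deriv χ (φ p) : ℝ) : ℂ) * leviForm φ p s t
      + ((deriv (deriv χ) (φ p) : ℝ) : ℂ) * (holDeriv φ p s * conj (holDeriv φ p t)) := by
  simp only [leviForm, holDeriv, wirt_wirtBar_comp hχ hφ, Fin.sum_univ_two, map_add, map_mul,
    conj_wirt_ofReal]
  ring

theorem holDeriv_comp {χ : ℝ → ℝ} {φ : C2 → ℝ} {p : C2} (hχ : DifferentiableAt ℝ χ (φ p))
    (hφ : DifferentiableAt ℝ φ p) (t : C2) :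
    holDeriv (fun x => χ (φ x)) p t = ((deriv χ (φ p) : ℝ) : ℂ) * holDeriv φ p t := by
  simp only [holDeriv, wirt_comp hχ hφ, Fin.sum_univ_two]
  ring

theorem complexHessian_comp {χ : ℝ → ℝ} {φ : C2 → ℝ} {p : C2} (hχ : ContDiffAt ℝ 2 χ (φ p))
    (hφ : ContDiffAt ℝ 2 φ p) (t : C2) :
    complexHessian (fun x => χ (φ x)) p t = deriv χ (φ p) * complexHessian φ p t
      + deriv (deriv χ) (φ p) * ‖holDeriv φ p t‖ ^ 2 := by
  rw [complexHessian_eq_re_leviForm, leviForm_comp hχ hφ, mul_conj, normSq_eq_norm_sq, add_re,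
    re_ofReal_mul, re_ofReal_mul, ofReal_re, complexHessian_eq_re_leviForm]

theorem leviForm_add {φ ψ : C2 → ℝ} {p : C2} (hφ : ContDiffAt ℝ 2 φ p) (hψ : ContDiffAt ℝ 2 ψ p)
    (s t : C2) :
    leviForm (fun x => φ x + ψ x) p s t = leviForm φ p s t + leviForm ψ p s t := by
  have key : ∀ j k, wirt j (wirtBar k (fun x => ((φ x + ψ x : ℝ) : ℂ))) p
      = wirt j (wirtBar k (fun x => (φ x : ℂ))) p + wirt j (wirtBar k (fun x => (ψ x : ℂ))) p := by
    intro j k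
    have h1 : ∀ᶠ x in nhds p, ContDiffAt ℝ 2 φ x := hφ.eventually (by simp)
    have h2 : ∀ᶠ x in nhds p, ContDiffAt ℝ 2 ψ x := hψ.eventually (by simp)
    have h3 : wirtBar k (fun x => ((φ x + ψ x : ℝ) : ℂ)) =ᶠ[nhds p]
        fun x => wirtBar k (fun x => (φ x : ℂ)) x + wirtBar k (fun x => (ψ x : ℂ)) x := by
      filter_upwards [h1, h2] with x hx1 hx2
      simp only [ofReal_add]
      exact wirtBar_add k (hx1.complexOfReal.differentiableAt (by norm_num))
        (hx2.complexOfReal.differentiableAt (by norm_num))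
    rw [h3.wirt_eq]
    exact wirt_add j
      ((hφ.complexOfReal.wirtBar k (m := 1) (by norm_num)).differentiableAt (by norm_num))
      ((hψ.complexOfReal.wirtBar k (m := 1) (by norm_num)).differentiableAt (by norm_num))
  simp only [leviForm, key, Fin.sum_univ_two]
  ring

theorem holDeriv_add {φ ψ : C2 → ℝ} {p : C2} (hφ : DifferentiableAt ℝ φ p)
    (hψ : DifferentiableAt ℝ ψ p) (t : C2) :
    holDeriv (fun x => φ x + ψ x) p t = holDeriv φ p t + holDeriv ψ p t := by
  have hφ' : DifferentiableAt ℝ (fun x => (φ x : ℂ)) p := ofRealCLM.differentiableAt.comp p hφ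
  have hψ' : DifferentiableAt ℝ (fun x => (ψ x : ℂ)) p := ofRealCLM.differentiableAt.comp p hψ
  simp only [holDeriv, ofReal_add, wirt_add _ hφ' hψ', Fin.sum_univ_two]
  ring

theorem Filter.EventuallyEq.leviForm_eq {φ ψ : C2 → ℝ} {p : C2} (h : φ =ᶠ[nhds p] ψ) (s t : C2) :
    leviForm φ p s t = leviForm ψ p s t := by
  have h' : (fun x => (φ x : ℂ)) =ᶠ[nhds p] fun x => (ψ x : ℂ) := h.mono fun x hx => by simp [hx]
  simp only [leviForm, fun j k => (h'.wirtBar (j := k)).wirt_eq (j := j)]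

theorem Filter.EventuallyEq.complexHessian_eq {φ ψ : C2 → ℝ} {p : C2} (h : φ =ᶠ[nhds p] ψ)
    (t : C2) : complexHessian φ p t = complexHessian ψ p t := by
  rw [complexHessian_eq_re_leviForm, h.leviForm_eq, complexHessian_eq_re_leviForm]

theorem Filter.EventuallyEq.holDeriv_eq {φ ψ : C2 → ℝ} {p : C2} (h : φ =ᶠ[nhds p] ψ) (t : C2) :
    holDeriv φ p t = holDeriv ψ p t := by
  have h' : (fun x => (φ x : ℂ)) =ᶠ[nhds p] fun x => (ψ x : ℂ) := h.mono fun x hx => by simp [hx]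
  simp only [holDeriv, fun j => h'.wirt_eq (j := j)]

theorem leviForm_conj {φ : C2 → ℝ} {p : C2} (hφ : ContDiffAt ℝ 2 φ p) (s t : C2) :
    conj (leviForm φ p s t) = leviForm φ p t s := by
  have key : ∀ j k, conj (wirt j (wirtBar k (fun x => (φ x : ℂ))) p)
      = wirt k (wirtBar j (fun x => (φ x : ℂ))) p := by
    intro j k
    rw [← wirtBar_conj, wirt_wirtBar_comm hφ.complexOfReal]
    simp only [conj_wirtBar_ofReal]
  simp only [leviForm, Fin.sum_univ_two, map_add, map_mul, key, conj_conj]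
  ring

theorem leviForm_lincomb (φ : C2 → ℝ) (p u v : C2) (a b : ℂ) (h : ContDiffAt ℝ 2 φ p) :
    complexHessian φ p (a • u + b • v) = ‖a‖ ^ 2 * complexHessian φ p u
      + ‖b‖ ^ 2 * complexHessian φ p v + 2 * (a * conj b * leviForm φ p u v).re := by
  have e : leviForm φ p (a • u + b • v) (a • u + b • v) = (‖a‖ ^ 2 : ℝ) * leviForm φ p u u
      + (‖b‖ ^ 2 : ℝ) * leviForm φ p v v + (a * conj b * leviForm φ p u v
      + conj (a * conj b * leviForm φ p u v)) := by
    rw [map_mul, leviForm_conj h, ← normSq_eq_norm_sq, ← normSq_eq_norm_sq, ← mul_conj, ← mul_conj]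
    simp only [leviForm, Fin.sum_univ_two, map_add, map_mul, conj_conj, PiLp.add_apply,
      PiLp.smul_apply, smul_eq_mul]
    ring
  rw [complexHessian_eq_re_leviForm, e, add_conj, add_re, add_re, re_ofReal_mul, re_ofReal_mul,
    ofReal_re]
  rfl

theorem holDeriv_lincomb (φ : C2 → ℝ) (p u v : C2) (a b : ℂ) :
    holDeriv φ p (a • u + b • v) = a * holDeriv φ p u + b * holDeriv φ p v := by
  simp only [holDeriv, Fin.sum_univ_two, PiLp.add_apply, PiLp.smul_apply, smul_eq_mul]
  ring

end WirtingerCalculus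

/-! ### Nearest boundary points and normal coordinates. -/

section SignedDistance

open Metric Set Filter Topology

theorem IsDefiningFunction.le_of_mem_closure {n : ℕ∞} {Ω : Set C2} {r : C2 → ℝ}
    (hr : IsDefiningFunction n Ω r) {p : C2} (hp : p ∈ closure Ω) : r p ≤ 0 := by
  have hcl : IsClosed {p | r p ≤ 0} := isClosed_le hr.1.continuous continuous_const
  refine closure_minimal ?_ hcl hp
  intro x hx
  rw [hr.2.1] at hx
  exact le_of_lt (show r x < 0 from hx)

theorem IsDefiningFunction.eq_zero {n : ℕ∞} {Ω : Set C2} {r : C2 → ℝ}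
    (hr : IsDefiningFunction n Ω r) {p : C2} (hp : p ∈ frontier Ω) : r p = 0 := by
  have hΩ : IsOpen Ω := hr.2.1 ▸ isOpen_lt hr.1.continuous continuous_const
  have h2 : p ∉ Ω := fun h => hp.2 (by rwa [hΩ.interior_eq])
  rw [hr.2.1] at h2
  exact le_antisymm (hr.le_of_mem_closure hp.1) (not_lt.1 h2)

theorem mem_frontier_of_fderiv_ne_zero {Ω : Set C2} {r : C2 → ℝ} (hΩ : Ω = {p | r p < 0})
    {p : C2} (h0 : r p = 0) (hd : fderiv ℝ r p ≠ 0) : p ∈ frontier Ω := by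
  refine ⟨?_, fun h => ?_⟩
  · by_contra hcl
    apply hd
    apply IsLocalMin.fderiv_eq_zero
    filter_upwards [isClosed_closure.isOpen_compl.mem_nhds hcl] with x hx
    have : x ∉ Ω := fun h => hx (subset_closure h)
    rw [hΩ] at this
    rw [h0]; exact not_lt.1 this
  · have := interior_subset h
    rw [hΩ, mem_ofPred_eq, h0] at this
    exact lt_irrefl _ this

/-- The real gradient of a function on `ℂ²`, as a complex vector. -/
noncomputable def realGrad (r : C2 → ℝ) (q : C2) : C2 :=
  !₂[2 * wirtBar 0 (fun x => (r x : ℂ)) q, 2 * wirtBar 1 (fun x => (r x : ℂ)) q]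

theorem C2.real_inner_eq (u v : C2) :
    inner ℝ u v = (conj (u 0) * v 0 + conj (u 1) * v 1).re := by
  have : inner ℝ u v = (inner ℂ u v).re := rfl
  rw [this, PiLp.inner_apply]
  simp [Fin.sum_univ_two, mul_comm]

theorem inner_realGrad {r : C2 → ℝ} {q : C2} (hr : DifferentiableAt ℝ r q) (v : C2) :
    inner ℝ (realGrad r q) v = fderiv ℝ r q v := by
  have h := fderiv_complexOfReal hr v
  rw [fderiv_eq_wirt] at h
  have h2 := congrArg re h
  rw [ofReal_re, ← conj_wirt_ofReal, ← conj_wirt_ofReal] at h2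
  rw [← h2, C2.real_inner_eq]
  simp only [realGrad, ← conj_wirt_ofReal]
  simp
  ring

theorem norm_realGrad_sq (r : C2 → ℝ) (q : C2) :
    ((‖realGrad r q‖ ^ 2 : ℝ) : ℂ) =
      4 * (wirt 0 (fun x => (r x : ℂ)) q * wirtBar 0 (fun x => (r x : ℂ)) q
        + wirt 1 (fun x => (r x : ℂ)) q * wirtBar 1 (fun x => (r x : ℂ)) q) := by
  rw [EuclideanSpace.norm_sq_eq]
  simp only [Fin.sum_univ_two, realGrad, ← conj_wirt_ofReal, mul_conj, normSq_eq_norm_sq]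
  simp [mul_pow]
  ring

theorem contDiff_realGrad {r : C2 → ℝ} (hr : ContDiff ℝ ∞ r) : ContDiff ℝ ∞ (realGrad r) := by
  rw [contDiff_piLp 2]
  intro i
  fin_cases i
  · exact contDiff_const.mul (hr.complexOfReal.wirtBar 0)
  · exact contDiff_const.mul (hr.complexOfReal.wirtBar 1)

/-- The unit normal field of the level sets of `r`. -/
noncomputable def unitNormal (r : C2 → ℝ) (q : C2) : C2 := ‖realGrad r q‖⁻¹ • realGrad r q

theorem realGrad_ne_zero {r : C2 → ℝ} {q : C2} (h : fderiv ℝ r q ≠ 0) : realGrad r q ≠ 0 := by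
  intro h0
  apply h
  have hr : DifferentiableAt ℝ r q := by
    by_contra hn
    exact h (fderiv_zero_of_not_differentiableAt hn)
  ext v
  rw [← inner_realGrad hr, h0]; simp

theorem norm_unitNormal {r : C2 → ℝ} {q : C2} (h : realGrad r q ≠ 0) : ‖unitNormal r q‖ = 1 := by
  rw [unitNormal, norm_smul, norm_inv, norm_norm, inv_mul_cancel₀ (norm_ne_zero_iff.2 h)]

theorem contDiffAt_unitNormal {r : C2 → ℝ} (hr : ContDiff ℝ ∞ r) {q : C2}
    (h : realGrad r q ≠ 0) : ContDiffAt ℝ ∞ (unitNormal r) q := by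
  have h1 := (contDiff_realGrad hr).contDiffAt (x := q)
  exact ((h1.norm ℝ h).inv (norm_ne_zero_iff.2 h)).smul h1

theorem fderiv_unitNormal {r : C2 → ℝ} (hr : ContDiff ℝ ∞ r) {q : C2}
    (h : realGrad r q ≠ 0) : fderiv ℝ r q (unitNormal r q) = ‖realGrad r q‖ := by
  rw [← inner_realGrad (hr.differentiable (by simp) q), unitNormal, inner_smul_right,
    real_inner_self_eq_norm_sq]
  field_simp

/-- Normal coordinates: the boundary is the slice where the second component vanishes. -/
noncomputable def normalCoord (r : C2 → ℝ) (y : C2 × ℝ) : C2 × ℝ :=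
  (y.1 + y.2 • unitNormal r y.1, r y.1)

theorem contDiffAt_normalCoord {r : C2 → ℝ} (hr : ContDiff ℝ ∞ r) {y : C2 × ℝ}
    (h : realGrad r y.1 ≠ 0) : ContDiffAt ℝ ∞ (normalCoord r) y :=
  (contDiffAt_fst.add (contDiffAt_snd.smul
    ((contDiffAt_unitNormal hr h).comp y contDiffAt_fst))).prodMk
    (hr.contDiffAt.comp y contDiffAt_fst)

/-- At parameter 0 the derivative is (v, σ) ↦ (v + σ n, dr(v)). A kernel vector has v = -σ n, and
dr(n) = ‖∇r‖ ≠ 0 forces σ = 0. Carrying r as an extra coordinate avoids charts on the boundary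
hypersurface. -/
theorem exists_equiv_fderiv_normalCoord {r : C2 → ℝ} (hr : ContDiff ℝ ∞ r) {q : C2}
    (h : realGrad r q ≠ 0) :
    ∃ e : (C2 × ℝ) ≃L[ℝ] (C2 × ℝ), HasFDerivAt (normalCoord r) (e : (C2 × ℝ) →L[ℝ] C2 × ℝ) (q, 0)
    := by
  have hn := ((contDiffAt_unitNormal hr h).differentiableAt (by simp)).hasFDerivAt
  have hf : HasFDerivAt (Prod.fst : C2 × ℝ → C2) (ContinuousLinearMap.fst ℝ C2 ℝ) (q, 0) :=
    hasFDerivAt_fst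
  have hs : HasFDerivAt (Prod.snd : C2 × ℝ → ℝ) (ContinuousLinearMap.snd ℝ C2 ℝ) (q, 0) :=
    hasFDerivAt_snd
  have hn' : HasFDerivAt (fun y : C2 × ℝ => unitNormal r y.1) _ (q, (0 : ℝ)) :=
    HasFDerivAt.comp (g := unitNormal r) (f := Prod.fst) (q, (0 : ℝ)) hn hf
  have hr' : HasFDerivAt (fun y : C2 × ℝ => r y.1) _ (q, (0 : ℝ)) :=
    HasFDerivAt.comp (g := r) (f := Prod.fst) (q, (0 : ℝ))
      (hr.differentiable (by simp) q).hasFDerivAt hf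
  have hG := (hf.add (hs.smul hn')).prodMk hr'
  obtain ⟨A, hA⟩ : ∃ A : C2 × ℝ →L[ℝ] C2 × ℝ, A = fderiv ℝ (normalCoord r) (q, 0) := ⟨_, rfl⟩
  rw [HasFDerivAt.fderiv (f := normalCoord r) hG] at hA
  have happ : ∀ v σ, A (v, σ) = (v + σ • unitNormal r q, fderiv ℝ r q v) := by
    intro v σ
    simp [hA]
  have hinj : Function.Injective A := by
    rw [injective_iff_map_eq_zero]
    rintro ⟨v, σ⟩ h0
    rw [happ, Prod.mk_eq_zero] at h0
    have hv : v = -(σ • unitNormal r q) := eq_neg_of_add_eq_zero_left h0.1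
    have h2 := h0.2
    rw [hv, map_neg, map_smul, fderiv_unitNormal hr h, neg_eq_zero, smul_eq_mul, mul_eq_zero] at h2
    have hσ : σ = 0 := h2.resolve_right (norm_ne_zero_iff.2 h)
    rw [hv, hσ]; simp
  refine ⟨(LinearEquiv.ofInjectiveEndo (A : (C2 × ℝ) →ₗ[ℝ] C2 × ℝ) hinj).toContinuousLinearEquiv,
    ?_⟩
  have hAe : HasFDerivAt (normalCoord r) A (q, 0) := by rw [hA]; exact hG
  exact hAe

/-- Lagrange multipliers for the squared distance to x on the level set of r: the gradient 2(q - x)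
is parallel to the gradient of r. The sign of c is not decided here. -/
theorem eq_add_smul_unitNormal_of_isMinOn {Ω : Set C2} {r : C2 → ℝ}
    (hr : IsDefiningFunction (⊤ : ℕ∞) Ω r) {x q : C2} (hq : q ∈ frontier Ω)
    (hmin : ∀ y ∈ frontier Ω, dist x q ≤ dist x y) :
    ∃ c : ℝ, x = q + c • unitNormal r q ∧ |c| = dist x q := by
  have hrc : ContDiff ℝ ∞ r := hr.1
  have hg := realGrad_ne_zero (hr.2.2 q hq)
  have hc1 : ContDiff ℝ ∞ (fderiv ℝ r) := hrc.fderiv_right le_rfl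
  have hlocal : IsLocalExtrOn (fun y : C2 => ‖y - x‖ ^ 2) {y | r y = r q} q := by
    left
    have hne : ∀ᶠ y in 𝓝 q, fderiv ℝ r y ≠ 0 :=
      hc1.continuous.continuousAt.eventually_ne (hr.2.2 q hq)
    filter_upwards [nhdsWithin_le_nhds hne, self_mem_nhdsWithin] with y hy1 hy2
    have := hmin y (mem_frontier_of_fderiv_ne_zero hr.2.1 (hy2.trans (hr.eq_zero hq)) hy1)
    rw [dist_comm x q, dist_comm x y, dist_eq_norm, dist_eq_norm] at this
    exact pow_le_pow_left₀ (norm_nonneg _) this 2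
  have hφ : HasStrictFDerivAt (fun y : C2 => ‖y - x‖ ^ 2) _ q :=
    (contDiff_id.sub contDiff_const).norm_sq ℝ |>.contDiffAt.hasStrictFDerivAt'
      ((hasFDerivAt_id q).sub_const x).norm_sq (n := 1) (by norm_num)
  obtain ⟨a, b, hab, hsum⟩ := hlocal.exists_multipliers_of_hasStrictFDerivAt_1d
    (hrc.contDiffAt.hasStrictFDerivAt (by simp)) hφ
  have hrd := hrc.differentiable (by simp) q
  have hvec : a • realGrad r q + (2 * b) • (q - x) = 0 := by
    refine ext_inner_right ℝ fun v => ?_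
    have := congrArg (fun T : C2 →L[ℝ] ℝ => T v) hsum
    simp at this
    rw [inner_add_left, inner_smul_left, inner_smul_left, inner_realGrad hrd]
    simp only [conj_trivial, inner_zero_left, inner_sub_left]
    linarith
  have hb : b ≠ 0 := by
    rintro rfl
    simp only [mul_zero, zero_smul, add_zero, smul_eq_zero, hg, or_false] at hvec
    exact hab (by rw [hvec]; rfl)
  have hx : x = q + (a / (2 * b) * ‖realGrad r q‖) • unitNormal r q := by
    have h1 : (2 * b) • (x - q) = a • realGrad r q := by
      have h2 := eq_neg_of_add_eq_zero_left hvec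
      rw [h2, ← smul_neg, neg_sub]
    have h2 : x - q = (a / (2 * b)) • realGrad r q := by
      rw [div_eq_inv_mul, mul_smul, ← h1, smul_smul, inv_mul_cancel₀ (by simpa using hb), one_smul]
    rw [unitNormal, smul_smul, mul_assoc, mul_inv_cancel₀ (norm_ne_zero_iff.2 hg), mul_one, ← h2]
    abel
  refine ⟨_, hx, ?_⟩
  have h3 : dist x q = ‖x - q‖ := dist_eq_norm _ _
  rw [h3]
  conv_rhs => rw [hx, add_sub_cancel_left, norm_smul, norm_unitNormal hg, mul_one, Real.norm_eq_abs]

theorem abs_signedBdryDist (Ω : Set C2) (x : C2) :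
    |signedBdryDist Ω x| = infDist x (frontier Ω) := by
  unfold signedBdryDist
  split_ifs
  · rw [abs_neg, abs_of_nonneg infDist_nonneg]
  · rw [abs_of_nonneg infDist_nonneg]

theorem signedBdryDist_eq_zero {Ω : Set C2} {x : C2} (hx : x ∈ frontier Ω) :
    signedBdryDist Ω x = 0 := by
  rw [← abs_eq_zero, abs_signedBdryDist, infDist_zero_of_mem hx]

/-- Off the boundary the sign is locally constant, and on it the value is 0, so the Lipschitz bound
for the unsigned distance carries over. The local form is enough to bound the norm of the derivative
by 1. -/
theorem eventually_abs_signedBdryDist_sub_le {Ω : Set C2} (hΩ : IsOpen Ω) (x : C2) :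
    ∀ᶠ y in 𝓝 x, |signedBdryDist Ω y - signedBdryDist Ω x| ≤ ‖y - x‖ := by
  have hlip : ∀ y, |infDist y (frontier Ω) - infDist x (frontier Ω)| ≤ ‖y - x‖ := by
    intro y
    have := (lipschitz_infDist_pt (frontier Ω)).dist_le_mul y x
    rw [Real.dist_eq, dist_eq_norm] at this
    simpa using this
  by_cases hx : x ∈ frontier Ω
  · refine Eventually.of_forall fun y => ?_
    have := hlip y
    rw [infDist_zero_of_mem hx, sub_zero, abs_of_nonneg infDist_nonneg] at this
    rwa [signedBdryDist_eq_zero hx, sub_zero, abs_signedBdryDist]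
  by_cases hx2 : x ∈ closure Ω
  · have hxΩ : x ∈ Ω := by
      by_contra h
      exact hx ⟨hx2, by rwa [hΩ.interior_eq]⟩
    filter_upwards [hΩ.mem_nhds hxΩ] with y hy
    have := hlip y
    rw [signedBdryDist, signedBdryDist, if_pos (subset_closure hy), if_pos hx2, abs_sub_comm]
    rw [show -infDist x (frontier Ω) - -infDist y (frontier Ω)
      = infDist y (frontier Ω) - infDist x (frontier Ω) by ring]
    exact this
  · filter_upwards [isClosed_closure.isOpen_compl.mem_nhds hx2] with y hy
    have := hlip y
    rwa [signedBdryDist, signedBdryDist, if_neg hy, if_neg hx2]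

theorem exists_nearest_frontier {Ω : Set C2} (hb : Bornology.IsBounded Ω) {p : C2}
    (hp : p ∈ frontier Ω) (x : C2) : ∃ q ∈ frontier Ω, dist x q = |signedBdryDist Ω x| ∧
      (∀ y ∈ frontier Ω, dist x q ≤ dist x y) := by
  have hc : IsCompact (frontier Ω) :=
    Metric.isCompact_of_isClosed_isBounded isClosed_frontier
      (hb.closure.subset frontier_subset_closure)
  obtain ⟨q, hq, h⟩ := hc.exists_infDist_eq_dist ⟨p, hp⟩ x
  refine ⟨q, hq, ?_, fun y hy => ?_⟩
  · rw [abs_signedBdryDist, h]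
  · rw [← h]; exact infDist_le_dist_of_mem hy

end SignedDistance

/-! ### Smoothness of the signed distance near the boundary. -/

section Tube

open Metric Set Filter Topology

theorem eventually_equiv_fderiv {F G : Type*} [NormedAddCommGroup F] [NormedSpace ℝ F]
    [NormedAddCommGroup G] [NormedSpace ℝ G] [CompleteSpace F] {f : F → G} {a : F}
    (hf : ∀ᶠ x in 𝓝 a, ContDiffAt ℝ ∞ f x) {e : F ≃L[ℝ] G}
    (he : HasFDerivAt f (e : F →L[ℝ] G) a) :
    ∀ᶠ x in 𝓝 a, ∃ e' : F ≃L[ℝ] G, HasFDerivAt f (e' : F →L[ℝ] G) x := by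
  have hc : ContinuousAt (fderiv ℝ f) a :=
    (hf.self_of_nhds.fderiv_right (m := 0) (by simp)).continuousAt
  have hmem : range ((↑) : (F ≃L[ℝ] G) → F →L[ℝ] G) ∈ 𝓝 (fderiv ℝ f a) := by
    rw [he.fderiv]; exact e.nhds
  filter_upwards [hc hmem, hf] with x hx hfx
  obtain ⟨e', he'⟩ := hx
  exact ⟨e', he' ▸ (hfx.differentiableAt (by simp)).hasFDerivAt⟩

/-- Near a boundary point the signed distance is a smooth inverse of the normal coordinates. -/
theorem signedBdryDist_local {Ω : Set C2} (hΩ : IsOpen Ω) (hb : Bornology.IsBounded Ω)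
    {r : C2 → ℝ} (hr : IsDefiningFunction (⊤ : ℕ∞) Ω r) {p : C2} (hp : p ∈ frontier Ω) :
    ∀ᶠ x in 𝓝 p, ContDiffAt ℝ ∞ (signedBdryDist Ω) x ∧
      ‖fderiv ℝ (signedBdryDist Ω) x‖ ≤ 1 ∧
      (∃ n : C2, ‖n‖ = 1 ∧ fderiv ℝ (signedBdryDist Ω) x n = 1) ∧
      (signedBdryDist Ω x < 0 ↔ r x < 0) := by
  have hrc : ContDiff ℝ ∞ r := hr.1
  have hg := realGrad_ne_zero (hr.2.2 p hp)
  obtain ⟨e, he⟩ := exists_equiv_fderiv_normalCoord hrc hg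
  have hG := contDiffAt_normalCoord hrc (y := (p, 0)) hg
  have hne : ∀ᶠ q in 𝓝 p, realGrad r q ≠ 0 :=
    (contDiff_realGrad hrc).continuous.continuousAt.eventually_ne hg
  have hne2 : ∀ᶠ y : C2 × ℝ in 𝓝 (p, 0), realGrad r y.1 ≠ 0 :=
    (continuous_fst.tendsto' (p, (0 : ℝ)) p rfl).eventually hne
  -- On the slice with second component 0 the foot point lies on the boundary, so there the local
  -- inverse of `normalCoord r` returns the pair (foot point, signed distance).
  set H := hG.toOpenPartialHomeomorph (normalCoord r) he (by simp) with hH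
  have hHc : ∀ y, H y = normalCoord r y := fun _ => rfl
  have hsrc : (p, (0 : ℝ)) ∈ H.source := hG.mem_toOpenPartialHomeomorph_source he (by simp)
  have hHp : H (p, 0) = (p, 0) := by
    rw [hHc, normalCoord]; simp [hr.eq_zero hp]
  have htgt : (p, (0 : ℝ)) ∈ H.target := by
    have := H.map_source hsrc
    rwa [hHp] at this
  have hsymm : H.symm (p, 0) = (p, 0) := by
    have := H.left_inv hsrc
    rwa [hHp] at this
  have hinv := eventually_equiv_fderiv
    (hne2.mono fun y hy => contDiffAt_normalCoord hrc hy) he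
  have hslice : Tendsto (fun x : C2 => (x, (0 : ℝ))) (𝓝 p) (𝓝 (p, 0)) :=
    (continuous_id.prodMk continuous_const).tendsto' p (p, 0) rfl
  have hsm : ∀ᶠ x in 𝓝 p, ContDiffAt ℝ ∞ (fun x => (H.symm (x, (0 : ℝ))).2) x := by
    have h1 : ∀ᶠ y in 𝓝 (p, (0 : ℝ)), y ∈ H.target := H.open_target.mem_nhds htgt
    have h2 : Tendsto H.symm (𝓝 (p, 0)) (𝓝 (p, 0)) := by
      have := (H.continuousAt_symm htgt).tendsto
      rwa [hsymm] at this
    filter_upwards [hslice.eventually h1, hslice.eventually (h2.eventually hinv),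
      hslice.eventually (h2.eventually hne2)] with x hx1 ⟨e', he'⟩ hx3
    have := H.contDiffAt_symm hx1 he' (contDiffAt_normalCoord hrc hx3)
    exact ContDiffAt.comp (g := fun y => (H.symm y).2) (f := fun x : C2 => (x, (0 : ℝ))) x
      (contDiffAt_snd.comp _ this) (contDiffAt_id.prodMk contDiffAt_const)
  -- a uniform neighbourhood on which the normal coordinates are injective and `r` increases
  have hpos : ∀ᶠ y : C2 × C2 in 𝓝 (p, p), 0 < fderiv ℝ r y.1 (unitNormal r y.2) := by
    have hc : ContinuousAt (fun y : C2 × C2 => fderiv ℝ r y.1 (unitNormal r y.2)) (p, p) := by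
      have h1 : ContinuousAt (fun y : C2 × C2 => fderiv ℝ r y.1) (p, p) :=
        ((hrc.continuous_fderiv (by simp)).comp continuous_fst).continuousAt
      have h2 : ContinuousAt (fun y : C2 × C2 => unitNormal r y.2) (p, p) :=
        ContinuousAt.comp (g := unitNormal r) (contDiffAt_unitNormal hrc hg).continuousAt
          continuousAt_snd
      exact h1.clm_apply h2
    refine hc.eventually_const_lt ?_
    simp only [fderiv_unitNormal hrc hg, norm_pos_iff]
    exact hg
  obtain ⟨η₁, hη₁, hball₁⟩ := Metric.eventually_nhds_iff_ball.1 hpos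
  obtain ⟨η₂, hη₂, hball₂⟩ := Metric.mem_nhds_iff.1 (H.open_source.mem_nhds hsrc)
  obtain ⟨η₃, hη₃, hball₃⟩ := Metric.eventually_nhds_iff_ball.1 hne
  set η := min η₁ (min η₂ η₃) with hη
  have hη0 : 0 < η := lt_min hη₁ (lt_min hη₂ hη₃)
  have hmono : ∀ q ∈ ball p (η / 2), StrictMonoOn (fun t : ℝ => r (q + t • unitNormal r q))
      (Icc (-(η / 2)) (η / 2)) := by
    intro q hq
    have hqg : realGrad r q ≠ 0 := hball₃ q (ball_subset_ball (by
      have : η ≤ η₃ := (min_le_right _ _).trans (min_le_right _ _)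
      linarith) hq)
    apply strictMonoOn_of_deriv_pos (convex_Icc _ _)
    · exact (hrc.continuous.comp (continuous_const.add
        (continuous_id.smul continuous_const))).continuousOn
    · intro t ht
      rw [interior_Icc] at ht
      have hd : HasDerivAt (fun t : ℝ => q + t • unitNormal r q) (unitNormal r q) t := by
        simpa using ((hasDerivAt_id t).smul_const (unitNormal r q)).const_add q
      have := (hrc.differentiable (by simp) (q + t • unitNormal r q)).hasFDerivAt.comp_hasDerivAt
        t hd
      rw [HasDerivAt.deriv (f := fun t : ℝ => r (q + t • unitNormal r q)) this]
      refine hball₁ (q + t • unitNormal r q, q) ?_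
      rw [← ball_prod_same]
      have hle : η ≤ η₁ := min_le_left _ _
      refine ⟨?_, ball_subset_ball (by linarith) hq⟩
      rw [mem_ball, dist_eq_norm]
      rw [mem_ball, dist_eq_norm] at hq
      calc ‖q + t • unitNormal r q - p‖ = ‖(q - p) + t • unitNormal r q‖ := by congr 1; abel
        _ ≤ ‖q - p‖ + ‖t • unitNormal r q‖ := norm_add_le _ _
        _ < η / 2 + η / 2 := by
          apply add_lt_add hq
          rw [norm_smul, norm_unitNormal hqg, mul_one, Real.norm_eq_abs]
          exact abs_lt.2 ht
        _ ≤ η₁ := by linarith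
  have hloc : ∀ x ∈ ball p (η / 4), ∃ q ∈ ball p (η / 2), q ∈ frontier Ω ∧
      |signedBdryDist Ω x| < η / 4 ∧ x = q + signedBdryDist Ω x • unitNormal r q ∧
      realGrad r q ≠ 0 ∧ (signedBdryDist Ω x < 0 ↔ r x < 0) := by
    intro x hx
    obtain ⟨q, hq, hdist, hmin⟩ := exists_nearest_frontier hb hp x
    obtain ⟨c, hxc, hc⟩ := eq_add_smul_unitNormal_of_isMinOn hr hq hmin
    have hxq : dist x q < η / 4 := (hmin p hp).trans_lt hx
    have hqp : q ∈ ball p (η / 2) := by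
      rw [mem_ball] at hx ⊢
      calc dist q p ≤ dist q x + dist x p := dist_triangle _ _ _
        _ < η / 4 + η / 4 := by rw [dist_comm q x]; exact add_lt_add hxq hx
        _ = η / 2 := by ring
    have hqg := realGrad_ne_zero (hr.2.2 q hq)
    have hr0 : r (q + (0 : ℝ) • unitNormal r q) = 0 := by simp [hr.eq_zero hq]
    have hcη : |c| < η / 4 := hc ▸ hxq
    have hcI : c ∈ Icc (-(η / 2)) (η / 2) := by
      rw [abs_lt] at hcη; constructor <;> linarith [hcη.1, hcη.2]
    have h0I : (0 : ℝ) ∈ Icc (-(η / 2)) (η / 2) := by constructor <;> linarith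
    -- Since r increases along the normal line through q and vanishes at q, the sign of c is the
    -- sign of r, which tells inside from outside.
    have hiff : c < 0 ↔ r x < 0 := by
      have := (hmono q hqp).lt_iff_lt hcI h0I
      rw [hr0, ← hxc] at this
      exact this.symm
    have hiff2 : 0 < c ↔ 0 < r x := by
      have := (hmono q hqp).lt_iff_lt h0I hcI
      rw [hr0, ← hxc] at this
      exact this.symm
    have hcs : c = signedBdryDist Ω x := by
      have habs : |c| = infDist x (frontier Ω) := by rw [hc, hdist, abs_signedBdryDist]
      rcases lt_trichotomy c 0 with h | h | h
      · have hxΩ : x ∈ Ω := by rw [hr.2.1]; exact hiff.1 h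
        rw [signedBdryDist, if_pos (subset_closure hxΩ), ← habs, abs_of_neg h, neg_neg]
      · have : x = q := by rw [hxc, h]; simp
        rw [h, this, signedBdryDist_eq_zero hq]
      · have hxΩ : x ∉ closure Ω := fun hcl =>
          absurd (hiff2.1 h) (not_lt.2 (hr.le_of_mem_closure hcl))
        rw [signedBdryDist, if_neg hxΩ, ← habs, abs_of_pos h]
    rw [hcs] at hxc hiff hcη
    exact ⟨q, hqp, hq, hcη, hxc, hqg, hiff⟩
  have hmemsrc : ∀ q ∈ ball p (η / 2), ∀ c : ℝ, |c| < η / 2 → (q, c) ∈ H.source := by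
    intro q hq c hc
    have hle : η ≤ η₂ := (min_le_right _ _).trans (min_le_left _ _)
    apply hball₂
    rw [← ball_prod_same]
    refine ⟨ball_subset_ball (by linarith) hq, ?_⟩
    rw [mem_ball, Real.dist_eq, sub_zero]; linarith
  have heq : ∀ x ∈ ball p (η / 4), signedBdryDist Ω x = (H.symm (x, (0 : ℝ))).2 := by
    intro x hx
    obtain ⟨q, hq, hqf, hc, hxq, hqg, -⟩ := hloc x hx
    have h1 := H.left_inv (hmemsrc q hq _ (hc.trans (by linarith)))
    rw [hHc, normalCoord] at h1
    simp only [hr.eq_zero hqf] at h1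
    rw [← hxq] at h1
    rw [h1]
  have hη4 : ball p (η / 4) ∈ 𝓝 p := ball_mem_nhds p (by linarith)
  filter_upwards [hsm, hη4] with x hx1 hx2
  have hev : signedBdryDist Ω =ᶠ[𝓝 x] fun x => (H.symm (x, (0 : ℝ))).2 := by
    filter_upwards [isOpen_ball.mem_nhds hx2] with y hy using heq y hy
  have hsmx : ContDiffAt ℝ ∞ (signedBdryDist Ω) x := hx1.congr_of_eventuallyEq hev
  have hd := (hsmx.differentiableAt (by simp)).hasFDerivAt
  obtain ⟨q, hq, hqf, hc, hxq, hqg, hiff⟩ := hloc x hx2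
  refine ⟨hsmx, ?_, ⟨unitNormal r q, norm_unitNormal hqg, ?_⟩, hiff⟩
  · refine hd.le_of_lip' zero_le_one ?_
    filter_upwards [eventually_abs_signedBdryDist_sub_le hΩ x] with y hy
    rwa [one_mul, Real.norm_eq_abs]
  -- Along the normal line through the foot point the signed distance is the parameter itself, so
  -- its derivative in the normal direction is 1.
  · set c := signedBdryDist Ω x with hcdef
    have hline : HasDerivAt (fun t : ℝ => q + t • unitNormal r q) (unitNormal r q) c := by
      simpa using ((hasDerivAt_id c).smul_const (unitNormal r q)).const_add q
    rw [hxq] at hd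
    have h1 := hd.comp_hasDerivAt c hline
    have h2 : (signedBdryDist Ω ∘ fun t : ℝ => q + t • unitNormal r q) =ᶠ[𝓝 c] id := by
      have h3 : ∀ᶠ t : ℝ in 𝓝 c, q + t • unitNormal r q ∈ ball p (η / 4) := by
        have : ContinuousAt (fun t : ℝ => q + t • unitNormal r q) c := hline.continuousAt
        apply this
        apply isOpen_ball.mem_nhds
        change q + c • unitNormal r q ∈ _
        rw [← hxq]; exact hx2
      have h4 : ∀ᶠ t : ℝ in 𝓝 c, |t| < η / 2 :=
        continuousAt_id.abs.eventually_lt continuousAt_const (hc.trans (by linarith))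
      filter_upwards [h3, h4] with t ht1 ht2
      have h5 := H.left_inv (hmemsrc q hq t ht2)
      rw [hHc, normalCoord] at h5
      simp only [hr.eq_zero hqf] at h5
      simp only [Function.comp, heq _ ht1, h5, id]
    have h6 := h1.unique ((hasDerivAt_id c).congr_of_eventuallyEq h2)
    rw [← hxq] at h6
    exact h6

theorem exists_contDiff_one_near {S U : Set C2} (hS : IsClosed S) (hU : IsOpen U) (hSU : S ⊆ U) :
    ∃ χ : C2 → ℝ, ContDiff ℝ ∞ χ ∧ (∀ p ∈ S, ∀ᶠ x in 𝓝 p, χ x = 1) ∧ tsupport χ ⊆ U ∧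
      ∀ x, χ x ∈ Icc (0 : ℝ) 1 := by
  obtain ⟨V, hV, hSV, hVU⟩ := normal_exists_closure_subset hS hU hSU
  obtain ⟨f, hf1, hf2, hf3⟩ := exists_contMDiffMap_one_nhds_of_subset_interior
    (n := (⊤ : ℕ∞)) (modelWithCornersSelf ℝ C2) hS (t := V) (by rwa [hV.interior_eq])
  refine ⟨f, f.contMDiff.contDiff, fun p hp => ?_, ?_, hf3⟩
  · exact hf1.filter_mono (nhds_le_nhdsSet hp)
  · refine (closure_mono ?_).trans hVU
    intro x hx
    by_contra h
    exact hx (hf2 x h)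

theorem contDiff_mul_of_tsupport_subset {χ f : C2 → ℝ} {U : Set C2}
    (hχ : ContDiff ℝ ∞ χ) (hf : ∀ x ∈ U, ContDiffAt ℝ ∞ f x) (hs : tsupport χ ⊆ U) :
    ContDiff ℝ ∞ (fun x => χ x * f x) := by
  rw [contDiff_iff_contDiffAt]
  intro x
  by_cases hx : x ∈ tsupport χ
  · exact hχ.contDiffAt.mul (hf x (hs hx))
  · have h0 : χ =ᶠ[𝓝 x] 0 := notMem_tsupport_iff_eventuallyEq.1 hx
    refine (contDiffAt_const (c := (0 : ℝ))).congr_of_eventuallyEq ?_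
    filter_upwards [h0] with y hy
    simp [hy]

/-- A function defined near the boundary with the right sign extends to a defining function. -/
theorem exists_definingFunction_extension {Ω : Set C2} {r : C2 → ℝ}
    (hr : IsDefiningFunction (⊤ : ℕ∞) Ω r) (g : C2 → ℝ)
    (hg : ∀ p ∈ frontier Ω, ∀ᶠ x in 𝓝 p, ContDiffAt ℝ ∞ g x ∧ (g x < 0 ↔ r x < 0))
    (hd : ∀ p ∈ frontier Ω, fderiv ℝ g p ≠ 0) :
    ∃ d : C2 → ℝ, IsDefiningFunction (⊤ : ℕ∞) Ω d ∧ ∀ p ∈ frontier Ω, d =ᶠ[𝓝 p] g := by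
  set U := {x | ∀ᶠ y in 𝓝 x, ContDiffAt ℝ ∞ g y ∧ (g y < 0 ↔ r y < 0)} with hUdef
  have hU : IsOpen U := isOpen_setOfPred_eventually_nhds
  obtain ⟨χ, hχ, hχ1, hχs, hχI⟩ := exists_contDiff_one_near isClosed_frontier hU hg
  have hχ0 : ∀ x ∉ U, χ x = 0 := fun x hx => image_eq_zero_of_notMem_tsupport fun h => hx (hχs h)
  have heq : ∀ p ∈ frontier Ω, (fun x => χ x * g x + (1 - χ x) * r x) =ᶠ[𝓝 p] g := by
    intro p hp
    filter_upwards [hχ1 p hp] with x hx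
    rw [hx]; ring
  refine ⟨fun x => χ x * g x + (1 - χ x) * r x, ⟨?_, ?_, ?_⟩, heq⟩
  · exact (contDiff_mul_of_tsupport_subset hχ (fun x hx => (Eventually.self_of_nhds hx).1)
      hχs).add ((contDiff_const.sub hχ).mul hr.1)
  · rw [hr.2.1]
    ext x
    obtain ⟨h0, h1⟩ := hχI x
    simp only [mem_ofPred_eq]
    by_cases hx : x ∈ U
    · have h2 : g x < 0 ↔ r x < 0 := (Eventually.self_of_nhds hx).2
      constructor
      · intro h
        have h3 := h2.2 h
        rcases eq_or_lt_of_le h0 with h4 | h4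
        · rw [← h4]; linarith
        · nlinarith [mul_nonneg (sub_nonneg.2 h1) (neg_nonneg.2 h.le), mul_pos h4 (neg_pos.2 h3)]
      · intro h
        by_contra h3
        have h4 : ¬ g x < 0 := fun h => h3 (h2.1 h)
        push Not at h3 h4
        nlinarith [mul_nonneg (sub_nonneg.2 h1) h3, mul_nonneg h0 h4]
    · rw [hχ0 x hx]; simp
  · intro p hp
    rw [(heq p hp).fderiv_eq]
    exact hd p hp

end Tube

/-! ### A global defining function with the eikonal and rotation identities. -/

section BoundaryDistance

open Metric Set Filter Topology

/-- `d` is a globally smooth defining function which agrees with the signed distance near the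
boundary. -/
structure IsBoundaryDistance (Ω : Set C2) (d : C2 → ℝ) : Prop where
  defining : IsDefiningFunction (⊤ : ℕ∞) Ω d
  eq_dist : ∀ p ∈ frontier Ω, d =ᶠ[𝓝 p] signedBdryDist Ω
  eikonal : ∀ p ∈ frontier Ω, ∀ᶠ x in 𝓝 p,
    wirt 0 (fun x => (d x : ℂ)) x * wirtBar 0 (fun x => (d x : ℂ)) x
      + wirt 1 (fun x => (d x : ℂ)) x * wirtBar 1 (fun x => (d x : ℂ)) x = 1 / 4

/-- The operator norm of the derivative is the length of the gradient; a unit direction with slope 1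
gives the other inequality by Cauchy-Schwarz. -/
theorem norm_realGrad_eq_one {φ : C2 → ℝ} {x : C2} (hφ : DifferentiableAt ℝ φ x)
    (h1 : ‖fderiv ℝ φ x‖ ≤ 1) {n : C2} (hn : ‖n‖ = 1) (h2 : fderiv ℝ φ x n = 1) :
    ‖realGrad φ x‖ = 1 := by
  apply le_antisymm
  · by_contra h
    push Not at h
    have h3 := (fderiv ℝ φ x).le_opNorm (realGrad φ x)
    rw [← inner_realGrad hφ, real_inner_self_eq_norm_sq, Real.norm_eq_abs,
      abs_of_nonneg (sq_nonneg _)] at h3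
    nlinarith
  · have h3 := real_inner_le_norm (realGrad φ x) n
    rwa [inner_realGrad hφ, h2, hn, mul_one] at h3

theorem exists_isBoundaryDistance {Ω : Set C2} (hΩ : IsOpen Ω) (hb : Bornology.IsBounded Ω)
    (hs : HasSmoothBoundary Ω) : ∃ d, IsBoundaryDistance Ω d := by
  obtain ⟨r, hr⟩ := hs
  have hloc := fun p hp => signedBdryDist_local hΩ hb hr (p := p) hp
  obtain ⟨d, hd, hd2⟩ := exists_definingFunction_extension hr (signedBdryDist Ω)
    (fun p hp => (hloc p hp).mono fun x hx => ⟨hx.1, hx.2.2.2⟩) (fun p hp h0 => by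
      obtain ⟨n, hn, hn2⟩ := (hloc p hp).self_of_nhds.2.2.1
      rw [h0] at hn2
      simp at hn2)
  refine ⟨d, hd, hd2, fun p hp => ?_⟩
  filter_upwards [(hd2 p hp).eventuallyEq_nhds, hloc p hp] with x hx hx2
  obtain ⟨hsm, hnorm, ⟨n, hn, hn2⟩, -⟩ := hx2
  rw [← hx.fderiv_eq] at hnorm hn2
  have h1 := norm_realGrad_eq_one (hd.1.differentiable (by simp) x) hnorm hn hn2
  have h2 := norm_realGrad_sq d x
  rw [h1] at h2
  simp only [one_pow, ofReal_one] at h2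
  linear_combination -(1 / 4 : ℂ) * h2

/-- Rotation in the first coordinate. -/
noncomputable def rotFirst (θ : ℝ) : C2 ≃ₗᵢ[ℝ] C2 :=
  LinearIsometryEquiv.piLpCongrRight 2
    (fun i : Fin 2 => if i = 0 then rotation (Circle.exp θ) else LinearIsometryEquiv.refl ℝ ℂ)

theorem rotFirst_apply (θ : ℝ) (p : C2) :
    rotFirst θ p = !₂[Complex.exp (θ * I) * p 0, p 1] := by
  ext i
  fin_cases i <;> simp [rotFirst, rotation_apply]

theorem rotFirst_image {Ω : Set C2} (h : IsHartogs Ω) (θ : ℝ) : rotFirst θ '' Ω = Ω := by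
  apply Subset.antisymm
  · rintro _ ⟨p, hp, rfl⟩
    rw [rotFirst_apply]; exact h p hp θ
  · intro p hp
    refine ⟨rotFirst (-θ) p, ?_, ?_⟩
    · rw [rotFirst_apply]; exact h p hp (-θ)
    · ext i
      fin_cases i <;> simp [rotFirst_apply, ← mul_assoc, ← Complex.exp_add]

theorem signedBdryDist_rotFirst {Ω : Set C2} (h : IsHartogs Ω) (θ : ℝ) (p : C2) :
    signedBdryDist Ω (rotFirst θ p) = signedBdryDist Ω p := by
  have hf : rotFirst θ '' frontier Ω = frontier Ω := by
    conv_rhs => rw [← rotFirst_image h θ]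
    exact (rotFirst θ).toHomeomorph.image_frontier Ω
  have hc : rotFirst θ '' closure Ω = closure Ω := by
    conv_rhs => rw [← rotFirst_image h θ]
    exact (rotFirst θ).toHomeomorph.image_closure Ω
  have h1 : infDist (rotFirst θ p) (frontier Ω) = infDist p (frontier Ω) := by
    conv_lhs => rw [← hf]
    exact infDist_image (rotFirst θ).isometry
  have h2 : rotFirst θ p ∈ closure Ω ↔ p ∈ closure Ω := by
    conv_lhs => rw [← hc]
    exact (rotFirst θ).injective.mem_set_image
  unfold signedBdryDist
  by_cases hp : p ∈ closure Ω
  · rw [if_pos (h2.2 hp), if_pos hp, h1]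
  · rw [if_neg fun h3 => hp (h2.1 h3), if_neg hp, h1]

/-- Rotations are isometries preserving Ω, so d is constant along z ↦ e^{iθ}z near the boundary; the
identity is the vanishing of its derivative at θ = 0, divided by i. -/
theorem IsBoundaryDistance.rotation {Ω : Set C2} {d : C2 → ℝ} (hd : IsBoundaryDistance Ω d)
    (h : IsHartogs Ω) {p : C2} (hp : p ∈ frontier Ω) :
    ∀ᶠ x in 𝓝 p, x 0 * wirt 0 (fun x => (d x : ℂ)) x
      = conj (x 0) * wirtBar 0 (fun x => (d x : ℂ)) x := by
  filter_upwards [(hd.eq_dist p hp).eventuallyEq_nhds] with x hx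
  have hdx := hd.defining.1.differentiable (by simp) x
  have hcurve : HasDerivAt (fun θ : ℝ => x + (Complex.exp (θ * I) * x 0 - x 0) •
      (EuclideanSpace.single 0 1 : C2)) ((I * x 0) • (EuclideanSpace.single 0 1 : C2)) 0 := by
    have h1 : HasDerivAt (fun θ : ℝ => Complex.exp (θ * I)) (I) 0 := by
      have := ((hasDerivAt_id (0 : ℝ)).ofReal_comp.mul_const I).cexp
      simpa using this
    exact (((h1.mul_const (x 0)).sub_const (x 0)).smul_const _).const_add x
  have h0 : x + (Complex.exp (((0 : ℝ) : ℂ) * I) * x 0 - x 0) •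
      (EuclideanSpace.single 0 1 : C2) = x := by simp
  have hF := hdx.hasFDerivAt
  rw [← h0] at hF
  have h2 := hF.comp_hasDerivAt (0 : ℝ) hcurve
  have hconst : (d ∘ fun θ : ℝ => x + (Complex.exp (θ * I) * x 0 - x 0) •
      (EuclideanSpace.single 0 1 : C2)) =ᶠ[𝓝 0] fun _ => d x := by
    have h3 : Tendsto (fun θ : ℝ => x + (Complex.exp (θ * I) * x 0 - x 0) •
      (EuclideanSpace.single 0 1 : C2)) (𝓝 0) (𝓝 x) := by
      have := hcurve.continuousAt.tendsto
      rwa [h0] at this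
    filter_upwards [h3.eventually hx] with θ hθ
    have h4 : x + (Complex.exp (θ * I) * x 0 - x 0) • (EuclideanSpace.single 0 1 : C2)
        = rotFirst θ x := by
      rw [rotFirst_apply]
      ext i
      fin_cases i <;> simp
    rw [Function.comp, hθ, h4, signedBdryDist_rotFirst h, hx.self_of_nhds]
  have h5 := h2.unique ((hasDerivAt_const (0 : ℝ) (d x)).congr_of_eventuallyEq hconst)
  rw [h0] at h5
  have h6 := fderiv_complexOfReal hdx ((I * x 0) • (EuclideanSpace.single 0 1 : C2))
  rw [h5, fderiv_eq_wirt] at h6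
  simp at h6
  have h7 : I * (x 0 * wirt 0 (fun x => (d x : ℂ)) x
      - conj (x 0) * wirtBar 0 (fun x => (d x : ℂ)) x) = 0 := by
    rw [← h6]; ring
  exact sub_eq_zero.1 ((mul_eq_zero.1 h7).resolve_left I_ne_zero)

end BoundaryDistance

/-! ### Independence of the Levi form's sign from the defining function. -/

section Comparison

open Set Filter Topology

theorem C2.linear_apply (ℓ : C2 →L[ℝ] ℂ) (v : C2) :
    ℓ v = ∑ j : Fin 2, ((v j).re * ℓ (EuclideanSpace.single j 1)
      + (v j).im * ℓ (EuclideanSpace.single j I)) := by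
  conv_lhs => rw [C2.eq_sum_real v]
  simp only [Fin.sum_univ_two, map_add, map_smul, Complex.real_smul]

theorem C2.linear_wirt (ℓ : C2 →L[ℝ] ℂ) (t : C2) :
    ∑ j : Fin 2, t j * (ℓ (EuclideanSpace.single j 1) - I * ℓ (EuclideanSpace.single j I))
      = ℓ t - I * ℓ (I • t) := by
  rw [C2.linear_apply ℓ t, C2.linear_apply ℓ (I • t)]
  simp only [Fin.sum_univ_two, PiLp.smul_apply, smul_eq_mul]
  simp
  linear_combination -(ℓ (EuclideanSpace.single 0 1) - I * ℓ (EuclideanSpace.single 0 I))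
    * re_add_im (t 0) - (ℓ (EuclideanSpace.single 1 1) - I * ℓ (EuclideanSpace.single 1 I))
    * re_add_im (t 1)
    - ((t 0).im * ℓ (EuclideanSpace.single 0 I) + (t 1).im * ℓ (EuclideanSpace.single 1 I)) * I_sq

theorem C2.linear_wirtBar (ℓ : C2 →L[ℝ] ℂ) (t : C2) :
    ∑ j : Fin 2, conj (t j) *
      (ℓ (EuclideanSpace.single j 1) + I * ℓ (EuclideanSpace.single j I))
      = ℓ t + I * ℓ (I • t) := by
  rw [C2.linear_apply ℓ t, C2.linear_apply ℓ (I • t)]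
  simp only [Fin.sum_univ_two, PiLp.smul_apply, smul_eq_mul]
  have hc : ∀ a : ℂ, (a.re : ℂ) - a.im * I = conj a := fun a => by
    apply Complex.ext <;> simp
  simp
  linear_combination -(ℓ (EuclideanSpace.single 0 1) + I * ℓ (EuclideanSpace.single 0 I))
    * hc (t 0) - (ℓ (EuclideanSpace.single 1 1) + I * ℓ (EuclideanSpace.single 1 I)) * hc (t 1)
    - ((t 0).im * ℓ (EuclideanSpace.single 0 I) + (t 1).im * ℓ (EuclideanSpace.single 1 I)) * I_sq

theorem holDeriv_eq_fderiv {φ : C2 → ℝ} {p : C2} (hφ : DifferentiableAt ℝ φ p) (t : C2) :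
    holDeriv φ p t = (1 / 2 : ℂ) * (fderiv ℝ φ p t - I * fderiv ℝ φ p (I • t)) := by
  rw [← fderiv_complexOfReal hφ, ← fderiv_complexOfReal hφ, ← C2.linear_wirt]
  simp only [holDeriv, wirt, Fin.sum_univ_two]
  ring

theorem fderiv_fderiv_complexOfReal {φ : C2 → ℝ} {p : C2} (hφ : ContDiffAt ℝ 2 φ p) (u v : C2) :
    fderiv ℝ (fderiv ℝ (fun x => (φ x : ℂ))) p u v = ((fderiv ℝ (fderiv ℝ φ) p u v : ℝ) : ℂ) := by
  rw [← fderiv_fderiv_apply hφ.complexOfReal]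
  have h1 : ∀ᶠ x in 𝓝 p, ContDiffAt ℝ 2 φ x := hφ.eventually (by simp)
  have h2 : (fun x => fderiv ℝ (fun x => (φ x : ℂ)) x v) =ᶠ[𝓝 p]
      fun x => ((fderiv ℝ φ x v : ℝ) : ℂ) := by
    filter_upwards [h1] with x hx
    exact fderiv_complexOfReal (hx.differentiableAt (by norm_num)) v
  have h3 : DifferentiableAt ℝ (fderiv ℝ φ) p :=
    (hφ.fderiv_right (m := 1) (by norm_num)).differentiableAt (by norm_num)
  rw [h2.fderiv_eq, fderiv_complexOfReal (h3.clm_apply (differentiableAt_const v)),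
    fderiv_clm_apply h3 (differentiableAt_const v)]
  simp

theorem complexHessian_eq_fderiv {φ : C2 → ℝ} {p : C2} (hφ : ContDiffAt ℝ 2 φ p) (t : C2) :
    complexHessian φ p t = (1 / 4 : ℝ) *
      (fderiv ℝ (fderiv ℝ φ) p t t + fderiv ℝ (fderiv ℝ φ) p (I • t) (I • t)) := by
  set B := fderiv ℝ (fderiv ℝ (fun x => (φ x : ℂ))) p with hB
  have h1 : ∀ v : C2, ∑ k : Fin 2, conj (t k) * fderiv ℝ (wirtBar k (fun x => (φ x : ℂ))) p v
      = (1 / 2 : ℂ) * (B v t + I * B v (I • t)) := by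
    intro v
    rw [← C2.linear_wirtBar]
    simp only [fderiv_wirtBar hφ.complexOfReal, Fin.sum_univ_two, ← hB]
    ring
  have h2 : leviForm φ p t t = (1 / 4 : ℂ) * ((B t t + I * B t (I • t))
      - I * (B (I • t) t + I * B (I • t) (I • t))) := by
    have e : leviForm φ p t t = ∑ k : Fin 2, conj (t k) * ((1 / 2 : ℂ) *
        (fderiv ℝ (wirtBar k (fun x => (φ x : ℂ))) p t
          - I * fderiv ℝ (wirtBar k (fun x => (φ x : ℂ))) p (I • t))) := by
      simp only [← C2.linear_wirt, leviForm, Fin.sum_univ_two, wirt]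
      ring
    have h3 := h1 t
    have h4 := h1 (I • t)
    rw [e]
    simp only [Fin.sum_univ_two] at h3 h4 ⊢
    linear_combination (1 / 2 : ℂ) * h3 - (1 / 2 : ℂ) * I * h4
  rw [complexHessian_eq_re_leviForm, h2, hB, fderiv_fderiv_symm hφ.complexOfReal (I • t) t]
  simp only [fderiv_fderiv_complexOfReal hφ]
  have e2 : ∀ a b c : ℝ, (1 / 4 : ℂ) * (((a : ℂ) + I * b) - I * (b + I * c))
      = (((1 / 4 : ℝ) * (a + c) : ℝ) : ℂ) := by
    intro a b c
    push_cast
    linear_combination -(c / 4 : ℂ) * I_sq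
  rw [e2, ofReal_re]

/-- The quadratic term v shifts the second derivative by an adjustable multiple of the first
derivative, so curves can be bent to either side of the level set. -/
theorem deriv_deriv_along_parabola {φ : C2 → ℝ} {p : C2} (hφ : ContDiffAt ℝ 2 φ p) (t v : C2) :
    deriv (fun s : ℝ => φ (p + s • t + s ^ 2 • v)) 0 = fderiv ℝ φ p t ∧
    deriv (deriv (fun s : ℝ => φ (p + s • t + s ^ 2 • v))) 0
      = fderiv ℝ (fderiv ℝ φ) p t t + 2 * fderiv ℝ φ p v := by
  have hγ : ∀ s : ℝ, HasDerivAt (fun s : ℝ => p + s • t + s ^ 2 • v) (t + (2 * s) • v) s := by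
    intro s
    have h1 := ((hasDerivAt_id s).smul_const t).const_add p
    have h2 := ((hasDerivAt_id s).pow 2).smul_const v
    refine (h1.fun_add h2).congr_deriv ?_
    simp
  have hγ0 : p + (0 : ℝ) • t + (0 : ℝ) ^ 2 • v = p := by simp
  have hc : Tendsto (fun s : ℝ => p + s • t + s ^ 2 • v) (𝓝 0) (𝓝 p) := by
    have := (hγ 0).continuousAt.tendsto
    rwa [hγ0] at this
  have hev : ∀ᶠ s : ℝ in 𝓝 0, HasDerivAt (fun s : ℝ => φ (p + s • t + s ^ 2 • v))
      (fderiv ℝ φ (p + s • t + s ^ 2 • v) (t + (2 * s) • v)) s := by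
    filter_upwards [hc.eventually (hφ.eventually (by simp))] with s hs
    exact HasFDerivAt.comp_hasDerivAt (l := φ) s
      (hs.differentiableAt (by norm_num)).hasFDerivAt (hγ s)
  constructor
  · rw [hev.self_of_nhds.deriv]; simp
  · have h1 : deriv (fun s : ℝ => φ (p + s • t + s ^ 2 • v)) =ᶠ[𝓝 0]
        fun s => fderiv ℝ φ (p + s • t + s ^ 2 • v) (t + (2 * s) • v) :=
      hev.mono fun s hs => hs.deriv
    rw [h1.deriv_eq]
    have h3 : HasFDerivAt (fderiv ℝ φ) (fderiv ℝ (fderiv ℝ φ) p) p :=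
      ((hφ.fderiv_right (m := 1) (by norm_num)).differentiableAt (by norm_num)).hasFDerivAt
    rw [← hγ0] at h3
    have h4 := HasFDerivAt.comp_hasDerivAt (l := fderiv ℝ φ) (0 : ℝ) h3 (hγ 0)
    have h5 : HasDerivAt (fun s : ℝ => t + (2 * s) • v) ((2 : ℝ) • v) 0 := by
      simpa using (((hasDerivAt_id (0 : ℝ)).const_mul 2).smul_const v).const_add t
    have h6 := h4.clm_apply h5
    have := h6.deriv
    simp only [Function.comp_def] at this
    rw [this]
    simp

/-- Otherwise, along the parabola, φ ≤ 0 ≤ ψ near p. Equal negativity sets then force φ = 0 along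
it, against its negative second derivative. Only signs are compared, so no quotient ψ/φ has to be
shown regular. -/
theorem second_order_sign_comparison {φ ψ : C2 → ℝ} {p : C2} (hφ : ContDiffAt ℝ 2 φ p)
    (hψ : ContDiffAt ℝ 2 ψ p) (hφ0 : φ p = 0) (hψ0 : ψ p = 0)
    (hs : ∀ᶠ x in 𝓝 p, φ x < 0 ↔ ψ x < 0) {t v : C2} (ht1 : fderiv ℝ φ p t = 0)
    (ht2 : fderiv ℝ ψ p t = 0) (h : fderiv ℝ (fderiv ℝ φ) p t t + 2 * fderiv ℝ φ p v < 0) :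
    fderiv ℝ (fderiv ℝ ψ) p t t + 2 * fderiv ℝ ψ p v ≤ 0 := by
  by_contra hcon
  push Not at hcon
  obtain ⟨h1, h2⟩ := deriv_deriv_along_parabola hφ t v
  obtain ⟨h3, h4⟩ := deriv_deriv_along_parabola hψ t v
  have hc : Tendsto (fun s : ℝ => p + s • t + s ^ 2 • v) (𝓝 0) (𝓝 p) :=
    (by fun_prop : Continuous fun s : ℝ => p + s • t + s ^ 2 • v).tendsto' 0 p (by simp)
  have hp0 : p + (0 : ℝ) • t + (0 : ℝ) ^ 2 • v = p := by simp
  have hcφ : ContinuousAt (fun s : ℝ => φ (p + s • t + s ^ 2 • v)) 0 := by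
    unfold ContinuousAt
    simp only [hp0]
    exact hφ.continuousAt.tendsto.comp hc
  have hcψ : ContinuousAt (fun s : ℝ => ψ (p + s • t + s ^ 2 • v)) 0 := by
    unfold ContinuousAt
    simp only [hp0]
    exact hψ.continuousAt.tendsto.comp hc
  have hmax := isLocalMax_of_deriv_deriv_neg (by rw [h2]; exact h) (by rw [h1, ht1]) hcφ
  have hmin := isLocalMin_of_deriv_deriv_pos (by rw [h4]; exact hcon) (by rw [h3, ht2]) hcψ
  have hz : (fun s : ℝ => φ (p + s • t + s ^ 2 • v)) =ᶠ[𝓝 0] fun _ => 0 := by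
    filter_upwards [hmax, hmin, hc.eventually hs] with s hs1 hs2 hs3
    rw [hp0, hφ0] at hs1
    rw [hp0, hψ0] at hs2
    exact le_antisymm hs1 (not_lt.1 fun h5 => absurd (hs3.1 h5) (not_lt.2 hs2))
  have := hz.deriv.deriv_eq
  rw [h2] at this
  simp at this
  linarith

theorem first_order_sign_comparison {φ ψ : C2 → ℝ} {p : C2} (hφ : DifferentiableAt ℝ φ p)
    (hψ : DifferentiableAt ℝ ψ p) (hφ0 : φ p = 0) (hψ0 : ψ p = 0)
    (hs : ∀ᶠ x in 𝓝 p, φ x < 0 ↔ ψ x < 0) {v : C2} (h : fderiv ℝ φ p v < 0) :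
    fderiv ℝ ψ p v ≤ 0 := by
  have hγ : HasDerivAt (fun s : ℝ => p + s • v) v 0 := by
    simpa using ((hasDerivAt_id (0 : ℝ)).smul_const v).const_add p
  have hp0 : p + (0 : ℝ) • v = p := by simp
  have h1 : HasDerivAt (fun s : ℝ => φ (p + s • v)) (fderiv ℝ φ p v) 0 := by
    have := hφ.hasFDerivAt
    rw [← hp0] at this
    have := HasFDerivAt.comp_hasDerivAt (l := φ) (0 : ℝ) this hγ
    rwa [hp0] at this
  have h2 : HasDerivAt (fun s : ℝ => ψ (p + s • v)) (fderiv ℝ ψ p v) 0 := by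
    have := hψ.hasFDerivAt
    rw [← hp0] at this
    have := HasFDerivAt.comp_hasDerivAt (l := ψ) (0 : ℝ) this hγ
    rwa [hp0] at this
  have hc : Tendsto (fun s : ℝ => p + s • v) (𝓝 0) (𝓝 p) := by
    have := hγ.continuousAt.tendsto
    rwa [hp0] at this
  have h3 := h1.tendsto_slope.eventually (gt_mem_nhds h)
  have h4 : ∀ᶠ s : ℝ in 𝓝[>] 0, slope (fun s : ℝ => ψ (p + s • v)) 0 s ≤ 0 := by
    filter_upwards [h3.filter_mono (nhdsWithin_mono _ fun x hx => ne_of_gt hx),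
      (hc.mono_left nhdsWithin_le_nhds).eventually hs, self_mem_nhdsWithin] with s hs1 hs2 hs3
    have hs3 : 0 < s := hs3
    rw [slope_def_field, hp0, hφ0, sub_zero, sub_zero, div_lt_iff₀ hs3, zero_mul] at hs1
    rw [slope_def_field, hp0, hψ0, sub_zero, sub_zero]
    exact div_nonpos_of_nonpos_of_nonneg (hs2.1 hs1).le hs3.le
  exact le_of_tendsto (h2.tendsto_slope.mono_left
    (nhdsWithin_mono (0 : ℝ) fun x (hx : x ∈ Ioi 0) => ne_of_gt hx)) h4

/-- Two functions with the same negativity set near a common zero have proportional Levi forms on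
complex tangent vectors. -/
theorem exists_complexHessian_comparison {φ ψ : C2 → ℝ} {p : C2} (hφ : ContDiffAt ℝ 2 φ p)
    (hψ : ContDiffAt ℝ 2 ψ p) (hφ0 : φ p = 0) (hψ0 : ψ p = 0)
    (hs : ∀ᶠ x in 𝓝 p, φ x < 0 ↔ ψ x < 0) (hdφ : fderiv ℝ φ p ≠ 0) (hdψ : fderiv ℝ ψ p ≠ 0) :
    ∃ c : ℝ, 0 < c ∧ ∀ t : C2, holDeriv φ p t = 0 →
      holDeriv ψ p t = 0 ∧ complexHessian ψ p t = c * complexHessian φ p t := by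
  have hφ1 : DifferentiableAt ℝ φ p := hφ.differentiableAt (by norm_num)
  have hψ1 : DifferentiableAt ℝ ψ p := hψ.differentiableAt (by norm_num)
  have hfirst : ∀ v, fderiv ℝ φ p v < 0 → fderiv ℝ ψ p v ≤ 0 := fun v hv =>
    first_order_sign_comparison hφ1 hψ1 hφ0 hψ0 hs hv
  obtain ⟨u, hu⟩ : ∃ u, fderiv ℝ φ p u = -1 := by
    obtain ⟨w, hw⟩ : ∃ w, fderiv ℝ φ p w ≠ 0 := by
      by_contra hcon
      push Not at hcon
      exact hdφ (by ext w; simp [hcon w])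
    exact ⟨(-(fderiv ℝ φ p w)⁻¹) • w, by rw [map_smul, smul_eq_mul, neg_mul, inv_mul_cancel₀ hw]⟩
  have hker : ∀ v, fderiv ℝ φ p v = 0 → fderiv ℝ ψ p v = 0 := by
    intro v hv
    by_contra hne
    have h1 := hfirst (u + ((1 - fderiv ℝ ψ p u) / fderiv ℝ ψ p v) • v) (by
      rw [map_add, map_smul, hv, hu]; simp)
    rw [map_add, map_smul, smul_eq_mul, div_mul_cancel₀ _ hne] at h1
    linarith
  set c := -fderiv ℝ ψ p u with hc
  have hprop : ∀ v, fderiv ℝ ψ p v = c * fderiv ℝ φ p v := by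
    intro v
    have h1 := hker (v + (fderiv ℝ φ p v) • u) (by
      rw [map_add, map_smul, smul_eq_mul, hu]; ring)
    rw [map_add, map_smul, smul_eq_mul] at h1
    rw [hc]; linarith
  have hc0 : 0 < c := by
    have h1 : 0 ≤ c := by have := hfirst u (by rw [hu]; norm_num); rw [hc]; linarith
    refine lt_of_le_of_ne h1 fun h2 => hdψ ?_
    ext v; rw [hprop, ← h2]; simp
  have hsecond : ∀ t, fderiv ℝ φ p t = 0 →
      fderiv ℝ (fderiv ℝ ψ) p t t = c * fderiv ℝ (fderiv ℝ φ) p t t := by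
    intro t ht
    have ht2 := hker t ht
    set a := fderiv ℝ (fderiv ℝ φ) p t t with ha
    set b := fderiv ℝ (fderiv ℝ ψ) p t t with hb
    apply le_antisymm
    · by_contra hcon
      push Not at hcon
      -- Twice the coefficient of u is the midpoint of a and b/c. The bent curve then has second
      -- derivatives of opposite strict signs for φ and ψ.
      have h1 := second_order_sign_comparison hφ hψ hφ0 hψ0 hs ht ht2
        (v := ((a + (b - c * a) / (2 * c)) / 2) • u) (by
          rw [← ha, map_smul, smul_eq_mul, hu]
          have : 0 < (b - c * a) / (2 * c) := by
            apply div_pos <;> linarith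
          linarith)
      rw [← hb, hprop, map_smul, smul_eq_mul, hu] at h1
      have h2 : c * ((b - c * a) / (2 * c)) = (b - c * a) / 2 := by field_simp
      nlinarith
    · by_contra hcon
      push Not at hcon
      have h1 := second_order_sign_comparison hψ hφ hψ0 hφ0 (hs.mono fun x hx => hx.symm) ht2 ht
        (v := ((a - (c * a - b) / (2 * c)) / 2) • u) (by
          rw [← hb, hprop, map_smul, smul_eq_mul, hu]
          have h2 : c * ((c * a - b) / (2 * c)) = (c * a - b) / 2 := by field_simp
          nlinarith)
      rw [← ha, map_smul, smul_eq_mul, hu] at h1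
      have : 0 < (c * a - b) / (2 * c) := by
        apply div_pos <;> linarith
      linarith
  refine ⟨c, hc0, fun t ht => ?_⟩
  rw [holDeriv_eq_fderiv hφ1] at ht
  have h1 : ((fderiv ℝ φ p t : ℝ) : ℂ) - I * (fderiv ℝ φ p (I • t) : ℝ) = 0 := by
    simpa using ht
  have hre : fderiv ℝ φ p t = 0 := by simpa using congrArg re h1
  have him : fderiv ℝ φ p (I • t) = 0 := by simpa using congrArg im h1
  constructor
  · rw [holDeriv_eq_fderiv hψ1, hker _ hre, hker _ him]; simp
  · rw [complexHessian_eq_fderiv hψ, complexHessian_eq_fderiv hφ, hsecond _ hre, hsecond _ him]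
    ring

end Comparison

/-! ### The frame (L, N) and the Levi function along the boundary. -/

section Frame

open Metric Set Filter Topology

/-- The complex tangential vector field `(∂d/∂w, -∂d/∂z)` of the level sets of `d`. -/
noncomputable def tangentVec (d : C2 → ℝ) (x : C2) : C2 :=
  !₂[wirt 1 (fun x => (d x : ℂ)) x, -wirt 0 (fun x => (d x : ℂ)) x]

/-- The Levi form of `d` on the field `tangentVec d`. -/
noncomputable def leviFn (d : C2 → ℝ) (x : C2) : ℝ := complexHessian d x (tangentVec d x)

theorem holDeriv_tangentVec (d : C2 → ℝ) (x : C2) : holDeriv d x (tangentVec d x) = 0 := by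
  simp [holDeriv, tangentVec, Fin.sum_univ_two]
  ring

theorem holDeriv_realGrad {d : C2 → ℝ} {x : C2}
    (hE : wirt 0 (fun x => (d x : ℂ)) x * wirtBar 0 (fun x => (d x : ℂ)) x
      + wirt 1 (fun x => (d x : ℂ)) x * wirtBar 1 (fun x => (d x : ℂ)) x = 1 / 4) :
    holDeriv d x (realGrad d x) = 1 / 2 := by
  simp only [holDeriv, realGrad, Fin.sum_univ_two]
  simp
  linear_combination 2 * hE

theorem exists_frame_decomposition {d : C2 → ℝ} {x : C2}
    (hE : wirt 0 (fun x => (d x : ℂ)) x * wirtBar 0 (fun x => (d x : ℂ)) x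
      + wirt 1 (fun x => (d x : ℂ)) x * wirtBar 1 (fun x => (d x : ℂ)) x = 1 / 4) (t : C2) :
    ∃ a b : ℂ, t = a • tangentVec d x + b • realGrad d x := by
  -- L and N are Hermitian-orthogonal with ‖L‖² = 1/4 and ‖N‖² = 1, so the coefficients are the
  -- normalised inner products of t with them.
  refine ⟨4 * (t 0 * wirtBar 1 (fun x => (d x : ℂ)) x - t 1 * wirtBar 0 (fun x => (d x : ℂ)) x),
    2 * (t 0 * wirt 0 (fun x => (d x : ℂ)) x + t 1 * wirt 1 (fun x => (d x : ℂ)) x), ?_⟩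
  ext i
  fin_cases i
  · simp [tangentVec, realGrad]
    linear_combination -4 * t 0 * hE
  · simp [tangentVec, realGrad]
    linear_combination -4 * t 1 * hE

theorem contDiff_tangentVec {d : C2 → ℝ} (hd : ContDiff ℝ ∞ d) :
    ContDiff ℝ ∞ (tangentVec d) := by
  rw [contDiff_piLp 2]
  intro i
  fin_cases i
  · exact hd.complexOfReal.wirt 1
  · exact (hd.complexOfReal.wirt 0).neg

theorem contDiff_leviForm {φ : C2 → ℝ} {u v : C2 → C2} (hφ : ContDiff ℝ ∞ φ)
    (hu : ContDiff ℝ ∞ u) (hv : ContDiff ℝ ∞ v) :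
    ContDiff ℝ ∞ (fun x => leviForm φ x (u x) (v x)) := by
  have hu' := (contDiff_piLp 2).1 hu
  have hv' := (contDiff_piLp 2).1 hv
  unfold leviForm
  refine ContDiff.sum fun j _ => ContDiff.sum fun k _ => ?_
  exact (((hφ.complexOfReal.wirtBar k).wirt j).mul (hu' j)).mul
    (conjCLE.contDiff.comp (hv' k))

theorem contDiff_complexHessian {φ : C2 → ℝ} {u : C2 → C2} (hφ : ContDiff ℝ ∞ φ)
    (hu : ContDiff ℝ ∞ u) : ContDiff ℝ ∞ (fun x => complexHessian φ x (u x)) :=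
  reCLM.contDiff.comp (contDiff_leviForm hφ hu hu)

theorem contDiff_holDeriv {φ : C2 → ℝ} {u : C2 → C2} (hφ : ContDiff ℝ ∞ φ)
    (hu : ContDiff ℝ ∞ u) : ContDiff ℝ ∞ (fun x => holDeriv φ x (u x)) := by
  have hu' := (contDiff_piLp 2).1 hu
  unfold holDeriv
  exact ContDiff.sum fun j _ => (hu' j).mul (hφ.complexOfReal.wirt j)

theorem contDiff_leviFn {d : C2 → ℝ} (hd : ContDiff ℝ ∞ d) : ContDiff ℝ ∞ (leviFn d) :=
  contDiff_complexHessian hd (contDiff_tangentVec hd)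

theorem IsDefiningFunction.mono {m n : ℕ∞} (hmn : m ≤ n) {Ω : Set C2} {r : C2 → ℝ}
    (hr : IsDefiningFunction n Ω r) : IsDefiningFunction m Ω r :=
  ⟨hr.1.of_le (by exact_mod_cast hmn), hr.2⟩

theorem leviFn_nonneg {Ω : Set C2} {d : C2 → ℝ} (hd : IsBoundaryDistance Ω d)
    (hpsc : IsLeviPseudoconvex Ω) {p : C2} (hp : p ∈ frontier Ω) : 0 ≤ leviFn d p :=
  hpsc d (hd.defining.mono le_top) p hp _ (holDeriv_tangentVec d p)

/-- The complex tangent space is the line spanned by `tangentVec d p`, so a degenerate tangent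
vector for any C² defining function is a multiple of it, and `exists_complexHessian_comparison`
transfers the degeneracy to d. -/
theorem mem_weaklyPseudoconvexPoints_iff {Ω : Set C2} {d : C2 → ℝ} (hd : IsBoundaryDistance Ω d)
    (hpsc : IsLeviPseudoconvex Ω) {p : C2} (hp : p ∈ frontier Ω) :
    p ∈ weaklyPseudoconvexPoints Ω ↔ leviFn d p = 0 := by
  have hE := (hd.eikonal p hp).self_of_nhds
  have hdd : ContDiffAt ℝ 2 d p := hd.defining.1.contDiffAt.of_le ENat.LEInfty.out
  constructor
  · rintro ⟨-, hw⟩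
    unfold IsStrictlyPseudoconvexAt at hw
    push Not at hw
    obtain ⟨r, hr, t, ht0, ht, hle⟩ := hw
    have hs : ∀ x, r x < 0 ↔ d x < 0 := fun x => by
      have h1 := hr.2.1
      rw [hd.defining.2.1] at h1
      exact (Set.ext_iff.1 h1 x).symm
    obtain ⟨c, hc, hcmp⟩ := exists_complexHessian_comparison hr.1.contDiffAt hdd
      (hr.eq_zero hp) (hd.defining.eq_zero hp) (Eventually.of_forall hs) (hr.2.2 p hp)
      (hd.defining.2.2 p hp)
    obtain ⟨h1, h2⟩ := hcmp t ht
    obtain ⟨a, b, hab⟩ := exists_frame_decomposition hE t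
    have hb : b = 0 := by
      rw [hab, holDeriv_lincomb, holDeriv_tangentVec, holDeriv_realGrad hE] at h1
      simpa using h1
    have hab' : t = a • tangentVec d p + (0 : ℂ) • realGrad d p := by rw [hab, hb]
    have ha : a ≠ 0 := by
      rintro rfl
      exact ht0 (by rw [hab']; simp)
    have hlin := leviForm_lincomb d p (tangentVec d p) (realGrad d p) a 0 hdd
    rw [← hab', h2] at hlin
    simp at hlin
    have h3 : ‖a‖ ^ 2 * leviFn d p ≤ 0 := by
      unfold leviFn
      rw [← hlin]
      exact mul_nonpos_of_nonneg_of_nonpos hc.le hle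
    have ha2 : 0 < ‖a‖ ^ 2 := by positivity
    refine le_antisymm ?_ (leviFn_nonneg hd hpsc hp)
    by_contra h
    push Not at h
    nlinarith
  · intro h
    refine ⟨hp, fun hstrict => ?_⟩
    have h1 := hstrict d (hd.defining.mono le_top) (tangentVec d p) (fun h0 => by
      have e0 : wirt 1 (fun x => (d x : ℂ)) p = 0 := by
        simpa [tangentVec] using congrArg (fun v : C2 => v 0) h0
      have e1 : wirt 0 (fun x => (d x : ℂ)) p = 0 := by
        simpa [tangentVec] using congrArg (fun v : C2 => v 1) h0
      rw [e0, e1] at hE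
      norm_num at hE) (holDeriv_tangentVec d p)
    exact absurd h (ne_of_gt h1)

/-- By pseudoconvexity a zero of the Levi function is a minimum along the boundary, so Lagrange
multipliers apply. The number μ measures how fast the Levi form grows towards the inside. -/
theorem exists_fderiv_leviFn_eq {Ω : Set C2} {d : C2 → ℝ} (hd : IsBoundaryDistance Ω d)
    (hpsc : IsLeviPseudoconvex Ω) {p : C2} (hp : p ∈ frontier Ω) (h0 : leviFn d p = 0) :
    ∃ μ : ℝ, fderiv ℝ (leviFn d) p = -μ • fderiv ℝ d p := by
  have hdc : ContDiff ℝ ∞ d := hd.defining.1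
  have hmin : IsLocalExtrOn (leviFn d) {x | d x = d p} p := by
    left
    have hne : ∀ᶠ y in 𝓝 p, fderiv ℝ d y ≠ 0 :=
      (hdc.continuous_fderiv (by simp)).continuousAt.eventually_ne (hd.defining.2.2 p hp)
    filter_upwards [nhdsWithin_le_nhds hne, self_mem_nhdsWithin] with y hy1 hy2
    rw [h0]
    exact leviFn_nonneg hd hpsc (mem_frontier_of_fderiv_ne_zero hd.defining.2.1
      (hy2.trans (hd.defining.eq_zero hp)) hy1)
  obtain ⟨a, b, hab, hsum⟩ := hmin.exists_multipliers_of_hasStrictFDerivAt_1d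
    (hdc.contDiffAt.hasStrictFDerivAt (by simp))
    ((contDiff_leviFn hdc).contDiffAt.hasStrictFDerivAt (by simp))
  have hb : b ≠ 0 := by
    rintro rfl
    simp only [zero_smul, add_zero, smul_eq_zero, hd.defining.2.2 p hp, or_false] at hsum
    exact hab (by rw [hsum]; rfl)
  refine ⟨a / b, ?_⟩
  have h1 : b • fderiv ℝ (leviFn d) p = -(a • fderiv ℝ d p) := eq_neg_of_add_eq_zero_right hsum
  rw [← inv_smul_smul₀ hb (fderiv ℝ (leviFn d) p), h1, smul_neg, smul_smul, neg_smul,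
    div_eq_inv_mul]

/-- First order lower bound for a function which is nonnegative on the boundary. -/
theorem eventually_ge_of_fderiv_eq {Ω : Set C2} (hb : Bornology.IsBounded Ω) {d : C2 → ℝ}
    (hd : IsBoundaryDistance Ω d) {p : C2} (hp : p ∈ frontier Ω) {f : C2 → ℝ}
    (hf : ContDiff ℝ ∞ f) (hf0 : ∀ q ∈ frontier Ω, 0 ≤ f q) {μ : ℝ}
    (hμ : fderiv ℝ f p = -μ • fderiv ℝ d p) {ε : ℝ} (hε : 0 < ε) :
    ∀ᶠ x in 𝓝 p, x ∈ Ω → -d x * (μ - ε) ≤ f x := by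
  have hdc : ContDiff ℝ ∞ d := hd.defining.1
  set g : C2 → ℝ := fun x => f x + μ * d x with hg
  have hgc : ContDiff ℝ ∞ g := hf.add (contDiff_const.mul hdc)
  have hg0 : fderiv ℝ g p = 0 := by
    rw [hg, fderiv_fun_add (hf.differentiable (by simp) p)
      ((hdc.differentiable (by simp) p).const_mul μ),
      fderiv_const_mul (hdc.differentiable (by simp) p), hμ]
    simp
  -- Strict differentiability bounds g x - g q by ε‖x - q‖ for q the foot point of x, hence by ε|d
  -- x|; differentiability at p alone would only give ε‖x - p‖.
  have hstrict := hgc.contDiffAt.hasStrictFDerivAt (x := p) (by simp)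
  rw [hg0] at hstrict
  have hlip := hstrict.isLittleO.bound hε
  obtain ⟨η, hη, hball⟩ := Metric.eventually_nhds_iff_ball.1 hlip
  filter_upwards [ball_mem_nhds p (half_pos hη), hd.eq_dist p hp] with x hx hdist hxΩ
  obtain ⟨q, hq, hxq, hmin⟩ := exists_nearest_frontier hb hp x
  have hqp : dist q p < η := by
    have h1 := hmin p hp
    rw [mem_ball] at hx
    calc dist q p ≤ dist q x + dist x p := dist_triangle _ _ _
      _ < η / 2 + η / 2 := by rw [dist_comm q x]; linarith
      _ = η := by ring
  have h1 := hball (x, q) (by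
    rw [← ball_prod_same]
    exact ⟨ball_subset_ball (by linarith) hx, hqp⟩)
  simp only [zero_apply, sub_zero] at h1
  rw [← dist_eq_norm x q, hxq, ← hdist] at h1
  have hdneg : d x < 0 := by have := hd.defining.2.1 ▸ hxΩ; exact this
  rw [abs_of_neg hdneg, Real.norm_eq_abs] at h1
  have hgq : 0 ≤ g q := by
    have h2 := hf0 q hq
    simp only [hg, hd.defining.eq_zero hq]
    linarith
  have h3 := (abs_le.1 h1).1
  have h4 : g x = f x + μ * d x := rfl
  nlinarith

end Frame

/-! ### Plurisubharmonicity near the boundary from a pointwise inequality. -/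

section Criterion

open Metric Set Filter Topology

/-- Inside the domain the function is -exp(τ(log(-d) + ψ)), so two applications of the chain rule
for the complex Hessian give the formula. -/
theorem complexHessian_neg_rpow {d ψ : C2 → ℝ} {x : C2} (hd : ContDiffAt ℝ 2 d x)
    (hψ : ContDiffAt ℝ 2 ψ x) (hx : d x < 0) (τ : ℝ) (t : C2) :
    complexHessian (fun y => -((-(d y * Real.exp (ψ y))) ^ τ)) x t
      = τ * Real.exp (τ * (Real.log (-d x) + ψ x)) / (-d x) *
        (complexHessian d x t + d x * complexHessian ψ x t + d x * τ * ‖holDeriv ψ x t‖ ^ 2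
          + 2 * τ * (conj (holDeriv d x t) * holDeriv ψ x t).re
          - (1 - τ) / d x * ‖holDeriv d x t‖ ^ 2) := by
  have hev : (fun y => -((-(d y * Real.exp (ψ y))) ^ τ)) =ᶠ[𝓝 x]
      fun y => (fun s => -Real.exp (τ * s)) (Real.log (-d y) + ψ y) := by
    filter_upwards [hd.continuousAt.eventually (gt_mem_nhds hx)] with y hy
    have h1 : 0 < -(d y * Real.exp (ψ y)) := by
      rw [← neg_mul]; exact mul_pos (neg_pos.2 hy) (Real.exp_pos _)
    rw [Real.rpow_def_of_pos h1, ← neg_mul, Real.log_mul (neg_pos.2 hy).ne' (Real.exp_pos _).ne',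
      Real.log_exp, mul_comm τ]
  have hlog : ContDiffAt ℝ 2 (fun s : ℝ => Real.log (-s)) (d x) :=
    contDiffAt_id.neg.log (neg_pos.2 hx).ne'
  have hlog1 : ∀ s : ℝ, s < 0 → deriv (fun s : ℝ => Real.log (-s)) s = s⁻¹ := by
    intro s hs
    have h1 := ((hasDerivAt_id s).neg.log (neg_pos.2 hs).ne').deriv
    rw [show deriv (fun s : ℝ => Real.log (-s)) s = _ from h1]
    simp [neg_div_neg_eq]
  have hlog2 : deriv (deriv fun s : ℝ => Real.log (-s)) (d x) = -((d x) ^ 2)⁻¹ := by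
    have h1 : deriv (fun s : ℝ => Real.log (-s)) =ᶠ[𝓝 (d x)] fun s => s⁻¹ := by
      filter_upwards [gt_mem_nhds hx] with s hs using hlog1 s hs
    rw [h1.deriv_eq, deriv_inv]
  have hexp1 : ∀ s : ℝ, HasDerivAt (fun s => -Real.exp (τ * s)) (-(Real.exp (τ * s) * τ)) s := by
    intro s
    simpa using (((hasDerivAt_id s).const_mul τ).exp).fun_neg
  have hexp1' : deriv (fun s => -Real.exp (τ * s)) = fun s => -(Real.exp (τ * s) * τ) :=
    funext fun s => (hexp1 s).deriv
  have hexp2 : ∀ s : ℝ, deriv (fun s => -(Real.exp (τ * s) * τ)) s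
      = -(Real.exp (τ * s) * τ * τ) := by
    intro s
    have := ((((hasDerivAt_id s).const_mul τ).exp).mul_const τ).neg
    simpa using this.deriv
  have hcomp : ContDiffAt ℝ 2 (fun y => Real.log (-d y)) x := hd.neg.log (neg_pos.2 hx).ne'
  have hu : ContDiffAt ℝ 2 (fun y => Real.log (-d y) + ψ y) x := hcomp.add hψ
  have hexpc : ContDiffAt ℝ 2 (fun s : ℝ => -Real.exp (τ * s)) (Real.log (-d x) + ψ x) :=
    ((contDiff_const.mul contDiff_id).exp.neg).contDiffAt
  have hHu : complexHessian (fun y => Real.log (-d y) + ψ y) x t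
      = (d x)⁻¹ * complexHessian d x t + -((d x) ^ 2)⁻¹ * ‖holDeriv d x t‖ ^ 2
        + complexHessian ψ x t := by
    rw [complexHessian_eq_re_leviForm, leviForm_add hcomp hψ, add_re,
      ← complexHessian_eq_re_leviForm, ← complexHessian_eq_re_leviForm,
      complexHessian_comp (χ := fun s => Real.log (-s)) hlog hd, hlog1 _ hx, hlog2]
  have hDu : holDeriv (fun y => Real.log (-d y) + ψ y) x t
      = ((d x)⁻¹ : ℝ) * holDeriv d x t + holDeriv ψ x t := by
    rw [holDeriv_add (hcomp.differentiableAt (by norm_num)) (hψ.differentiableAt (by norm_num)),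
      holDeriv_comp (χ := fun s => Real.log (-s)) (hlog.differentiableAt (by norm_num))
        (hd.differentiableAt (by norm_num)), hlog1 _ hx]
  have hnorm : ‖((d x)⁻¹ : ℝ) * holDeriv d x t + holDeriv ψ x t‖ ^ 2
      = ((d x) ^ 2)⁻¹ * ‖holDeriv d x t‖ ^ 2 + ‖holDeriv ψ x t‖ ^ 2
        + 2 * (d x)⁻¹ * (conj (holDeriv d x t) * holDeriv ψ x t).re := by
    simp only [← normSq_eq_norm_sq, normSq_apply, add_re, add_im, mul_re, mul_im, ofReal_re,
      ofReal_im, conj_re, conj_im]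
    ring
  rw [hev.complexHessian_eq, complexHessian_comp (χ := fun s => -Real.exp (τ * s)) hexpc hu,
    hexp1', hexp2, hHu, hDu, hnorm]
  have hx' : d x ≠ 0 := hx.ne
  field_simp
  ring

theorem quadratic_form_nonneg {A E β X Y : ℝ} (hA : 0 ≤ A) (hE : 0 ≤ E)
    (h : β ^ 2 ≤ A * E) : 0 ≤ A * X ^ 2 - 2 * β * (X * Y) + E * Y ^ 2 := by
  rcases eq_or_lt_of_le hA with h0 | h0
  · have : β = 0 := by
      rw [← h0, zero_mul] at h
      exact pow_eq_zero_iff (two_ne_zero) |>.1 (le_antisymm h (sq_nonneg _))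
    rw [this, ← h0]
    nlinarith [mul_nonneg hE (sq_nonneg Y)]
  · have h1 : 0 ≤ A * (A * X ^ 2 - 2 * β * (X * Y) + E * Y ^ 2) := by
      nlinarith [sq_nonneg (A * X - β * Y), mul_nonneg (sub_nonneg.2 h) (sq_nonneg Y)]
    exact nonneg_of_mul_nonneg_right h1 h0

/-- Plurisubharmonicity near a boundary point from a lower bound for the tangential part. -/
theorem eventually_complexHessian_nonneg {Ω : Set C2} {d ψ : C2 → ℝ}
    (hd : IsBoundaryDistance Ω d) (hψ : ContDiff ℝ ∞ ψ) {τ : ℝ} (hτ0 : 0 < τ) (hτ1 : τ < 1)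
    {p : C2} (hp : p ∈ frontier Ω) {A₀ : ℝ} (hA₀ : 0 ≤ A₀)
    (hA : ∀ᶠ x in 𝓝 p, x ∈ Ω → -d x * A₀ ≤ leviFn d x
      + d x * (complexHessian ψ x (tangentVec d x) + τ * ‖holDeriv ψ x (tangentVec d x)‖ ^ 2))
    (hβ : ‖leviForm d p (tangentVec d p) (realGrad d p)
      + τ / 2 * holDeriv ψ p (tangentVec d p)‖ ^ 2 < A₀ * ((1 - τ) / 4)) :
    ∀ᶠ x in 𝓝 p, x ∈ Ω → ∀ t,
      0 ≤ complexHessian (fun y => -((-(d y * Real.exp (ψ y))) ^ τ)) x t := by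
  have hdc : ContDiff ℝ ∞ d := hd.defining.1
  have hL := contDiff_tangentVec hdc
  have hN := contDiff_realGrad hdc
  -- For t = uL + vN, b collects the mixed coefficient and c the part of the |v|² coefficient that
  -- stays bounded as d tends to 0.
  set b : C2 → ℂ := fun x => leviForm d x (tangentVec d x) (realGrad d x)
    + d x * (leviForm ψ x (tangentVec d x) (realGrad d x)
      + τ * (holDeriv ψ x (tangentVec d x) * conj (holDeriv ψ x (realGrad d x))))
    + τ / 2 * holDeriv ψ x (tangentVec d x) with hb
  set c : C2 → ℝ := fun x => complexHessian d x (realGrad d x)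
    + d x * (complexHessian ψ x (realGrad d x) + τ * ‖holDeriv ψ x (realGrad d x)‖ ^ 2)
    + τ * (holDeriv ψ x (realGrad d x)).re with hc
  have hbc : Continuous b := by
    refine ((contDiff_leviForm hdc hL hN).continuous.add ((continuous_ofReal.comp
      hdc.continuous).mul ((contDiff_leviForm hψ hL hN).continuous.add (continuous_const.mul
      ((contDiff_holDeriv hψ hL).continuous.mul (continuous_conj.comp
      (contDiff_holDeriv hψ hN).continuous)))))).add
      (continuous_const.mul (contDiff_holDeriv hψ hL).continuous)
  have hcc : Continuous c := by
    refine ((contDiff_complexHessian hdc hN).continuous.add (hdc.continuous.mul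
      ((contDiff_complexHessian hψ hN).continuous.add (continuous_const.mul
      ((contDiff_holDeriv hψ hN).continuous.norm.pow 2))))).add
      (continuous_const.mul (continuous_re.comp (contDiff_holDeriv hψ hN).continuous))
  have hd0 : d p = 0 := hd.defining.eq_zero hp
  have hbp : b p = leviForm d p (tangentVec d p) (realGrad d p)
      + τ / 2 * holDeriv ψ p (tangentVec d p) := by
    simp [hb, hd0]
  have h1 : ∀ᶠ x in 𝓝 p, ‖b x‖ ^ 2 < A₀ * ((1 - τ) / 4 - d x * c x) := by
    refine (hbc.norm.pow 2).continuousAt.eventually_lt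
      (continuous_const.mul (continuous_const.sub (hdc.continuous.mul hcc))).continuousAt ?_
    change ‖b p‖ ^ 2 < A₀ * ((1 - τ) / 4 - d p * c p)
    rw [hbp, hd0]; simpa using hβ
  have h2 : ∀ᶠ x in 𝓝 p, 0 < (1 - τ) / 4 - d x * c x := by
    refine (continuous_const.sub (hdc.continuous.mul hcc)).continuousAt.eventually_const_lt ?_
    change 0 < (1 - τ) / 4 - d p * c p
    rw [hd0]; linarith
  filter_upwards [hA, h1, h2, hd.eikonal p hp] with x hAx h1x h2x hE hxΩ t
  have hdx : d x < 0 := by have := hd.defining.2.1 ▸ hxΩ; exact this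
  have hd2 : ContDiffAt ℝ 2 d x := hdc.contDiffAt.of_le ENat.LEInfty.out
  have hψ2 : ContDiffAt ℝ 2 ψ x := hψ.contDiffAt.of_le ENat.LEInfty.out
  rw [complexHessian_neg_rpow hd2 hψ2 hdx]
  refine mul_nonneg (div_nonneg (mul_nonneg hτ0.le (Real.exp_pos _).le) (by linarith)) ?_
  obtain ⟨u, v, rfl⟩ := exists_frame_decomposition hE t
  have hdh : holDeriv d x (u • tangentVec d x + v • realGrad d x) = v * (1 / 2) := by
    rw [holDeriv_lincomb, holDeriv_tangentVec, holDeriv_realGrad hE, mul_zero, zero_add]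
  rw [hdh, leviForm_lincomb _ _ _ _ _ _ hd2, leviForm_lincomb _ _ _ _ _ _ hψ2, holDeriv_lincomb]
  set s := -d x with hs
  have hs0 : 0 < s := neg_pos.2 hdx
  have hds : d x = -s := by rw [hs, neg_neg]
  have hAx := hAx hxΩ
  have key : ‖u‖ ^ 2 * (leviFn d x + d x * (complexHessian ψ x (tangentVec d x)
        + τ * ‖holDeriv ψ x (tangentVec d x)‖ ^ 2))
      + 2 * (u * conj v * b x).re + ‖v‖ ^ 2 * (c x + (1 - τ) / (4 * s))
      = ‖u‖ ^ 2 * complexHessian d x (tangentVec d x) + ‖v‖ ^ 2 * complexHessian d x (realGrad d x)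
        + 2 * (u * conj v * leviForm d x (tangentVec d x) (realGrad d x)).re
        + d x * (‖u‖ ^ 2 * complexHessian ψ x (tangentVec d x)
          + ‖v‖ ^ 2 * complexHessian ψ x (realGrad d x)
          + 2 * (u * conj v * leviForm ψ x (tangentVec d x) (realGrad d x)).re)
        + d x * τ * ‖u * holDeriv ψ x (tangentVec d x) + v * holDeriv ψ x (realGrad d x)‖ ^ 2
        + 2 * τ * (conj (v * (1 / 2))
          * (u * holDeriv ψ x (tangentVec d x) + v * holDeriv ψ x (realGrad d x))).re
        - (1 - τ) / d x * ‖v * (1 / 2)‖ ^ 2 := by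
    have e1 : ‖v * (1 / 2)‖ ^ 2 = ‖v‖ ^ 2 / 4 := by
      rw [norm_mul, mul_pow]; norm_num; ring
    have e2 : (1 - τ) / d x * ‖v * (1 / 2)‖ ^ 2 = -(‖v‖ ^ 2 * ((1 - τ) / (4 * s))) := by
      rw [e1, hds]; field_simp
    have e3 : ((1 / 2 : ℂ)) = ((1 / 2 : ℝ) : ℂ) := by push_cast; ring
    have e4 : (τ / 2 : ℂ) = ((τ / 2 : ℝ) : ℂ) := by push_cast; ring
    rw [e2, e3]
    simp only [hb, hc, leviFn, e4]
    generalize holDeriv ψ x (tangentVec d x) = P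
    generalize holDeriv ψ x (realGrad d x) = R
    generalize leviForm d x (tangentVec d x) (realGrad d x) = S
    generalize leviForm ψ x (tangentVec d x) (realGrad d x) = T
    simp only [← normSq_eq_norm_sq, normSq_apply, add_re, add_im, mul_re, mul_im, ofReal_re,
      ofReal_im, conj_re, conj_im]
    ring
  rw [← key]
  have hre : -(‖u‖ * ‖v‖ * ‖b x‖) ≤ (u * conj v * b x).re := by
    have := abs_re_le_norm (u * conj v * b x)
    rw [norm_mul, norm_mul, norm_conj] at this
    exact (abs_le.1 this).1
  -- The factor s in the tangential coefficient cancels the 1/s in the normal one, so the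
  -- discriminant condition survives in the limit at the boundary.
  have hq := quadratic_form_nonneg (A := s * A₀) (E := c x + (1 - τ) / (4 * s)) (β := ‖b x‖)
    (X := ‖u‖) (Y := ‖v‖) (by positivity) (by
      have : c x + (1 - τ) / (4 * s) = ((1 - τ) / 4 - d x * c x) / s := by
        rw [hds]; field_simp; ring
      rw [this]
      exact (div_pos h2x hs0).le) (by
      have : s * A₀ * (c x + (1 - τ) / (4 * s)) = A₀ * ((1 - τ) / 4 - d x * c x) := by
        rw [hds]; field_simp; ring
      rw [this]; exact h1x.le)
  have h3 := mul_le_mul_of_nonneg_left hAx (sq_nonneg ‖u‖)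
  nlinarith

/-- At a weakly pseudoconvex point a pointwise inequality on `ψ` suffices. -/
theorem eventually_complexHessian_nonneg_of_weak {Ω : Set C2} (hb : Bornology.IsBounded Ω)
    {d ψ : C2 → ℝ} (hd : IsBoundaryDistance Ω d) (hpsc : IsLeviPseudoconvex Ω)
    (hψ : ContDiff ℝ ∞ ψ) {τ : ℝ} (hτ0 : 0 < τ) (hτ1 : τ < 1) {p : C2} (hp : p ∈ frontier Ω)
    {μ : ℝ} (hμ : fderiv ℝ (leviFn d) p = -μ • fderiv ℝ d p)
    (hβ : ‖leviForm d p (tangentVec d p) (realGrad d p)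
      + τ / 2 * holDeriv ψ p (tangentVec d p)‖ ^ 2 < (1 - τ) / 4 *
        (μ - complexHessian ψ p (tangentVec d p) - τ * ‖holDeriv ψ p (tangentVec d p)‖ ^ 2)) :
    ∀ᶠ x in 𝓝 p, x ∈ Ω → ∀ t,
      0 ≤ complexHessian (fun y => -((-(d y * Real.exp (ψ y))) ^ τ)) x t := by
  have hdc : ContDiff ℝ ∞ d := hd.defining.1
  have hL := contDiff_tangentVec hdc
  set h : C2 → ℝ := fun x => complexHessian ψ x (tangentVec d x)
    + τ * ‖holDeriv ψ x (tangentVec d x)‖ ^ 2 with hh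
  have hhc : Continuous h := (contDiff_complexHessian hψ hL).continuous.add
    (continuous_const.mul ((contDiff_holDeriv hψ hL).continuous.norm.pow 2))
  set N := ‖leviForm d p (tangentVec d p) (realGrad d p)
      + τ / 2 * holDeriv ψ p (tangentVec d p)‖ ^ 2 with hN
  have hβ' : N < (1 - τ) / 4 * (μ - h p) := by
    have : μ - h p = μ - complexHessian ψ p (tangentVec d p)
      - τ * ‖holDeriv ψ p (tangentVec d p)‖ ^ 2 := by rw [hh]; ring
    rw [this]; exact hβ
  have hτ' : 0 < (1 - τ) / 4 := by linarith
  have hN0 : 0 ≤ N := sq_nonneg _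
  -- A third of the slack each: for the first-order bound on the Levi function, for the continuity
  -- of h, and for keeping the cross-term inequality strict.
  set ε := (μ - h p - N / ((1 - τ) / 4)) / 3 with hε
  have hε0 : 0 < ε := by
    have : N / ((1 - τ) / 4) < μ - h p := by rw [div_lt_iff₀ hτ']; linarith
    rw [hε]; linarith
  refine eventually_complexHessian_nonneg hd hψ hτ0 hτ1 hp (A₀ := μ - h p - 2 * ε) ?_ ?_ ?_
  · have : 0 ≤ N / ((1 - τ) / 4) := div_nonneg hN0 hτ'.le
    have e : μ - h p - 2 * ε = N / ((1 - τ) / 4) + ε := by rw [hε]; ring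
    rw [e]; linarith
  · filter_upwards [eventually_ge_of_fderiv_eq hb hd hp (contDiff_leviFn hdc)
      (fun q hq => leviFn_nonneg hd hpsc hq) hμ hε0,
      hhc.continuousAt.eventually_lt continuousAt_const (by linarith : h p < h p + ε)]
      with x hx1 hx2 hxΩ
    have hdx : d x < 0 := by have := hd.defining.2.1 ▸ hxΩ; exact this
    have h3 := hx1 hxΩ
    have h4 : -d x * h x ≤ -d x * (h p + ε) :=
      mul_le_mul_of_nonneg_left hx2.le (by linarith)
    change _ ≤ leviFn d x + d x * h x
    nlinarith
  · have e : μ - h p - 2 * ε = N / ((1 - τ) / 4) + ε := by rw [hε]; ring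
    rw [e, add_mul, div_mul_cancel₀ _ hτ'.ne']
    linarith [mul_pos hε0 hτ']

/-- The Levi function stays positive while d tends to 0, so it dominates |d|·A₀ for any fixed A₀; no
condition on ψ is needed. -/
theorem eventually_complexHessian_nonneg_of_strict {Ω : Set C2}
    {d ψ : C2 → ℝ} (hd : IsBoundaryDistance Ω d)
    (hψ : ContDiff ℝ ∞ ψ) {τ : ℝ} (hτ0 : 0 < τ) (hτ1 : τ < 1) {p : C2} (hp : p ∈ frontier Ω)
    (hpos : 0 < leviFn d p) :
    ∀ᶠ x in 𝓝 p, x ∈ Ω → ∀ t,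
      0 ≤ complexHessian (fun y => -((-(d y * Real.exp (ψ y))) ^ τ)) x t := by
  have hdc : ContDiff ℝ ∞ d := hd.defining.1
  have hL := contDiff_tangentVec hdc
  set h : C2 → ℝ := fun x => complexHessian ψ x (tangentVec d x)
    + τ * ‖holDeriv ψ x (tangentVec d x)‖ ^ 2 with hh
  have hhc : Continuous h := (contDiff_complexHessian hψ hL).continuous.add
    (continuous_const.mul ((contDiff_holDeriv hψ hL).continuous.norm.pow 2))
  set N := ‖leviForm d p (tangentVec d p) (realGrad d p)
      + τ / 2 * holDeriv ψ p (tangentVec d p)‖ ^ 2 with hN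
  have hτ' : 0 < (1 - τ) / 4 := by linarith
  have hN0 : 0 ≤ N := sq_nonneg _
  have hd0 : d p = 0 := hd.defining.eq_zero hp
  refine eventually_complexHessian_nonneg hd hψ hτ0 hτ1 hp (A₀ := (N + 1) / ((1 - τ) / 4))
    (by positivity) ?_ ?_
  · have h1 : ∀ᶠ x in 𝓝 p, -d x * ((N + 1) / ((1 - τ) / 4)) < leviFn d x + d x * h x := by
      refine (hdc.continuous.neg.mul continuous_const).continuousAt.eventually_lt
        ((contDiff_leviFn hdc).continuous.add (hdc.continuous.mul hhc)).continuousAt ?_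
      simpa [hd0] using hpos
    filter_upwards [h1] with x hx _ using hx.le
  · rw [div_mul_cancel₀ _ hτ'.ne']; linarith

end Criterion

/-! ### Differentiated eikonal and rotation identities. -/

section JetIdentities

open Filter Topology

variable {D : C2 → ℂ} {p : C2}

theorem wirtBar_wirtBar_comm {f : C2 → ℂ} {p : C2} (hf : ContDiffAt ℝ 2 f p) (j k : Fin 2) :
    wirtBar j (wirtBar k f) p = wirtBar k (wirtBar j f) p := by
  have hg : ContDiffAt ℝ 2 (fun x => conj (f x)) p := conjCLE.contDiff.contDiffAt.comp p hf
  have h := congrArg conj (wirt_wirt_comm hg j k)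
  simp only [← wirtBar_conj] at h
  simpa using h

theorem conj_wirt_of_real (hr : ∀ x, conj (D x) = D x) (j : Fin 2) (x : C2) :
    conj (wirt j D x) = wirtBar j D x := by
  rw [← wirtBar_conj]; simp only [hr]

theorem conj_wirtBar_of_real (hr : ∀ x, conj (D x) = D x) (j : Fin 2) (x : C2) :
    conj (wirtBar j D x) = wirt j D x := by
  rw [← wirt_conj]; simp only [hr]

theorem conj_wirt_wirtBar_of_real (hD : ContDiff ℝ ∞ D) (hr : ∀ x, conj (D x) = D x)
    (j k : Fin 2) (x : C2) :
    conj (wirt j (wirtBar k D) x) = wirt k (wirtBar j D) x := by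
  rw [← wirtBar_conj, wirt_wirtBar_comm (hD.contDiffAt.of_le ENat.LEInfty.out)]
  simp only [conj_wirtBar_of_real hr]

theorem conj_wirt_wirt_of_real (hr : ∀ x, conj (D x) = D x) (j k : Fin 2) (x : C2) :
    conj (wirt j (wirt k D) x) = wirtBar j (wirtBar k D) x := by
  rw [← wirtBar_conj]; simp only [conj_wirt_of_real hr]

theorem wirtBar_wirt_eq (hD : ContDiff ℝ ∞ D) (j k : Fin 2) :
    wirtBar j (wirt k D) = wirt k (wirtBar j D) :=
  funext fun _ => (wirt_wirtBar_comm (hD.contDiffAt.of_le ENat.LEInfty.out) k j).symm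

theorem wirt_wirt_eq (hD : ContDiff ℝ ∞ D) : wirt 1 (wirt 0 D) = wirt 0 (wirt 1 D) :=
  funext fun _ => wirt_wirt_comm (hD.contDiffAt.of_le ENat.LEInfty.out) 1 0

theorem wirtBar_wirtBar_eq (hD : ContDiff ℝ ∞ D) :
    wirtBar 0 (wirtBar 1 D) = wirtBar 1 (wirtBar 0 D) :=
  funext fun _ => wirtBar_wirtBar_comm (hD.contDiffAt.of_le ENat.LEInfty.out) 0 1

theorem wirt_conj_coord (j i : Fin 2) (p : C2) : wirt j (fun x : C2 => conj (x i)) p = 0 := by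
  rw [wirt_conj, wirtBar_coord, map_zero]

theorem wirtBar_conj_coord (j i : Fin 2) (p : C2) :
    wirtBar j (fun x : C2 => conj (x i)) p = if i = j then 1 else 0 := by
  rw [wirtBar_conj, wirt_coord]; split_ifs <;> simp

theorem differentiable_coord (i : Fin 2) : Differentiable ℝ (fun x : C2 => x i) :=
  (contDiff_coord (n := 1) i).differentiable (by norm_num)

theorem differentiable_conj_coord (i : Fin 2) : Differentiable ℝ (fun x : C2 => conj (x i)) :=
  (conjCLE.contDiff.comp (contDiff_coord (n := 1) i)).differentiable (by norm_num)

theorem ContDiff.diffble {f : C2 → ℂ} (hf : ContDiff ℝ ∞ f) : Differentiable ℝ f :=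
  hf.differentiable (by simp)

theorem wirt_eikonal (hD : ContDiff ℝ ∞ D)
    (hE : ∀ᶠ x in 𝓝 p, wirt 0 D x * wirtBar 0 D x + wirt 1 D x * wirtBar 1 D x = 1 / 4)
    (j : Fin 2) : wirt 0 D p * wirt j (wirtBar 0 D) p + wirt j (wirt 0 D) p * wirtBar 0 D p
      + (wirt 1 D p * wirt j (wirtBar 1 D) p + wirt j (wirt 1 D) p * wirtBar 1 D p) = 0 := by
  have h := Filter.EventuallyEq.wirt_eq (j := j) hE
  have h0 := (hD.wirt 0).diffble
  have h1 := (hD.wirt 1).diffble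
  have h2 := (hD.wirtBar 0).diffble
  have h3 := (hD.wirtBar 1).diffble
  rw [wirt_add j ((h0 p).fun_mul (h2 p)) ((h1 p).fun_mul (h3 p)), wirt_mul j (h0 p) (h2 p),
    wirt_mul j (h1 p) (h3 p), wirt_const] at h
  exact h

theorem wirtBar_eikonal (hD : ContDiff ℝ ∞ D)
    (hE : ∀ᶠ x in 𝓝 p, wirt 0 D x * wirtBar 0 D x + wirt 1 D x * wirtBar 1 D x = 1 / 4)
    (j : Fin 2) : wirt 0 D p * wirtBar j (wirtBar 0 D) p + wirtBar j (wirt 0 D) p * wirtBar 0 D p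
      + (wirt 1 D p * wirtBar j (wirtBar 1 D) p + wirtBar j (wirt 1 D) p * wirtBar 1 D p) = 0 := by
  have h := Filter.EventuallyEq.wirtBar_eq (j := j) hE
  have h0 := (hD.wirt 0).diffble
  have h1 := (hD.wirt 1).diffble
  have h2 := (hD.wirtBar 0).diffble
  have h3 := (hD.wirtBar 1).diffble
  rw [wirtBar_add j ((h0 p).fun_mul (h2 p)) ((h1 p).fun_mul (h3 p)), wirtBar_mul j (h0 p) (h2 p),
    wirtBar_mul j (h1 p) (h3 p), wirtBar_const] at h
  exact h

/-- Apply ∂_z∂_z̄ to the eikonal equation. Flatness removes every term except squares of second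
derivatives and the w-derivatives of D_zz̄, which makes these third derivatives accessible. -/
theorem wirt_wirtBar_eikonal (hD : ContDiff ℝ ∞ D)
    (hE : ∀ᶠ x in 𝓝 p, wirt 0 D x * wirtBar 0 D x + wirt 1 D x * wirtBar 1 D x = 1 / 4)
    (h0 : wirt 0 D p = 0) (h0' : wirtBar 0 D p = 0) (h00 : wirt 0 (wirtBar 0 D) p = 0) :
    wirt 0 (wirt 0 D) p * wirtBar 0 (wirtBar 0 D) p
      + wirt 0 (wirt 1 D) p * wirtBar 0 (wirtBar 1 D) p
      + wirt 1 (wirtBar 0 D) p * wirt 0 (wirtBar 1 D) p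
      + wirt 1 D p * wirtBar 1 (wirt 0 (wirtBar 0 D)) p
      + wirt 1 (wirt 0 (wirtBar 0 D)) p * wirtBar 1 D p = 0 := by
  have hev : (fun x => wirt 0 D x * wirtBar 0 (wirtBar 0 D) x
      + wirtBar 0 (wirt 0 D) x * wirtBar 0 D x
      + (wirt 1 D x * wirtBar 0 (wirtBar 1 D) x + wirtBar 0 (wirt 1 D) x * wirtBar 1 D x))
      =ᶠ[𝓝 p] fun _ => 0 :=
    hE.eventually_nhds.mono fun x hx => wirtBar_eikonal hD hx 0
  have h := hev.wirt_eq (j := 0)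
  have a0 := (hD.wirt 0).diffble p
  have a1 := (hD.wirt 1).diffble p
  have b0 := (hD.wirtBar 0).diffble p
  have b1 := (hD.wirtBar 1).diffble p
  have c0 := ((hD.wirtBar 0).wirtBar 0).diffble p
  have c1 := ((hD.wirtBar 1).wirtBar 0).diffble p
  have e0 := ((hD.wirt 0).wirtBar 0).diffble p
  have e1 := ((hD.wirt 1).wirtBar 0).diffble p
  rw [wirt_add 0 ((a0.fun_mul c0).fun_add (e0.fun_mul b0))
      ((a1.fun_mul c1).fun_add (e1.fun_mul b1)),
    wirt_add 0 (a0.fun_mul c0) (e0.fun_mul b0), wirt_add 0 (a1.fun_mul c1) (e1.fun_mul b1),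
    wirt_mul 0 a0 c0, wirt_mul 0 e0 b0, wirt_mul 0 a1 c1, wirt_mul 0 e1 b1, wirt_const, h0, h0',
    wirtBar_wirt_eq hD 0 0, wirtBar_wirt_eq hD 0 1, h00] at h
  have k1 : wirt 0 (wirtBar 0 (wirtBar 1 D)) p = wirtBar 1 (wirt 0 (wirtBar 0 D)) p := by
    rw [wirtBar_wirtBar_eq hD, ← wirtBar_wirt_eq (hD.wirtBar 0)]
  have k2 : wirt 0 (wirt 1 (wirtBar 0 D)) p = wirt 1 (wirt 0 (wirtBar 0 D)) p := by
    rw [wirt_wirt_eq (hD.wirtBar 0)]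
  rw [k1, k2] at h
  linear_combination h

theorem rotation_wirt_one (hD : ContDiff ℝ ∞ D)
    (hR : ∀ᶠ x in 𝓝 p, x 0 * wirt 0 D x = conj (x 0) * wirtBar 0 D x) :
    p 0 * wirt 0 (wirt 1 D) p = conj (p 0) * wirt 1 (wirtBar 0 D) p := by
  have h := Filter.EventuallyEq.wirt_eq (j := 1) hR
  rw [wirt_mul 1 (differentiable_coord 0 p) ((hD.wirt 0).diffble p),
    wirt_mul 1 (differentiable_conj_coord 0 p) ((hD.wirtBar 0).diffble p), wirt_coord,
    wirt_conj_coord, wirt_wirt_eq hD] at h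
  simpa using h

theorem rotation_wirt_zero (hD : ContDiff ℝ ∞ D)
    (hR : ∀ᶠ x in 𝓝 p, x 0 * wirt 0 D x = conj (x 0) * wirtBar 0 D x) :
    wirt 0 D p + p 0 * wirt 0 (wirt 0 D) p = conj (p 0) * wirt 0 (wirtBar 0 D) p := by
  have h := Filter.EventuallyEq.wirt_eq (j := 0) hR
  rw [wirt_mul 0 (differentiable_coord 0 p) ((hD.wirt 0).diffble p),
    wirt_mul 0 (differentiable_conj_coord 0 p) ((hD.wirtBar 0).diffble p), wirt_coord,
    wirt_conj_coord] at h
  simp only [if_true, one_mul, zero_mul, add_zero] at h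
  linear_combination h

/-- At z = 0 the rotation identity itself is trivial, but its z̄-derivative isolates D_z̄. -/
theorem wirtBar_zero_eq_zero_of_coord (hD : ContDiff ℝ ∞ D)
    (hR : ∀ᶠ x in 𝓝 p, x 0 * wirt 0 D x = conj (x 0) * wirtBar 0 D x) (hz : p 0 = 0) :
    wirtBar 0 D p = 0 := by
  have h := Filter.EventuallyEq.wirtBar_eq (j := 0) hR
  rw [wirtBar_mul 0 (differentiable_coord 0 p) ((hD.wirt 0).diffble p),
    wirtBar_mul 0 (differentiable_conj_coord 0 p) ((hD.wirtBar 0).diffble p), wirtBar_coord,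
    wirtBar_conj_coord, hz] at h
  simpa using h.symm

theorem rotation_mixed_eq_zero_of_coord (hD : ContDiff ℝ ∞ D)
    (hR : ∀ᶠ x in 𝓝 p, x 0 * wirt 0 D x = conj (x 0) * wirtBar 0 D x) (hz : p 0 = 0) :
    wirt 1 (wirtBar 0 D) p = 0 := by
  have hev : (fun x : C2 => x 0 * wirt 0 (wirt 1 D) x)
      =ᶠ[𝓝 p] fun x => conj (x 0) * wirt 1 (wirtBar 0 D) x :=
    hR.eventually_nhds.mono fun x hx => rotation_wirt_one hD hx
  have h := hev.wirtBar_eq (j := 0)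
  rw [wirtBar_mul 0 (differentiable_coord 0 p) (((hD.wirt 1).wirt 0).diffble p),
    wirtBar_mul 0 (differentiable_conj_coord 0 p) (((hD.wirtBar 0).wirt 1).diffble p),
    wirtBar_coord, wirtBar_conj_coord, hz] at h
  simpa using h.symm

theorem rotation_wirt_one_zero (hD : ContDiff ℝ ∞ D)
    (hR : ∀ᶠ x in 𝓝 p, x 0 * wirt 0 D x = conj (x 0) * wirtBar 0 D x) :
    wirt 0 (wirt 1 D) p + p 0 * wirt 0 (wirt 0 (wirt 1 D)) p
      = conj (p 0) * wirt 1 (wirt 0 (wirtBar 0 D)) p := by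
  have hev : (fun x : C2 => x 0 * wirt 0 (wirt 1 D) x)
      =ᶠ[𝓝 p] fun x => conj (x 0) * wirt 1 (wirtBar 0 D) x :=
    hR.eventually_nhds.mono fun x hx => rotation_wirt_one hD hx
  have h := hev.wirt_eq (j := 0)
  rw [wirt_mul 0 (differentiable_coord 0 p) (((hD.wirt 1).wirt 0).diffble p),
    wirt_mul 0 (differentiable_conj_coord 0 p) (((hD.wirtBar 0).wirt 1).diffble p),
    wirt_coord, wirt_conj_coord, ← wirt_wirt_eq (hD.wirtBar 0)] at h
  simp only [if_true, one_mul, zero_mul, add_zero] at h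
  linear_combination h

/-- The Levi determinant `∑ j k, D_{jk̄} L_j L̄_k` with `L = (D_w, -D_z)`, as a complex function. -/
noncomputable def leviDet (D : C2 → ℂ) (x : C2) : ℂ :=
  (wirt 0 (wirtBar 0 D) x * (wirt 1 D x * wirtBar 1 D x)
    - wirt 0 (wirtBar 1 D) x * (wirt 1 D x * wirtBar 0 D x))
  - (wirt 1 (wirtBar 0 D) x * (wirt 0 D x * wirtBar 1 D x)
    - wirt 1 (wirtBar 1 D) x * (wirt 0 D x * wirtBar 0 D x))

theorem wirt_leviDet (hD : ContDiff ℝ ∞ D) (j : Fin 2) (p : C2) :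
    wirt j (leviDet D) p =
      (wirt j (wirt 0 (wirtBar 0 D)) p * (wirt 1 D p * wirtBar 1 D p)
        - wirt j (wirt 0 (wirtBar 1 D)) p * (wirt 1 D p * wirtBar 0 D p)
        - wirt j (wirt 1 (wirtBar 0 D)) p * (wirt 0 D p * wirtBar 1 D p)
        + wirt j (wirt 1 (wirtBar 1 D)) p * (wirt 0 D p * wirtBar 0 D p))
      + wirt 0 (wirtBar 0 D) p *
        (wirt j (wirt 1 D) p * wirtBar 1 D p + wirt 1 D p * wirt j (wirtBar 1 D) p)
      - wirt 0 (wirtBar 1 D) p *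
        (wirt j (wirt 1 D) p * wirtBar 0 D p + wirt 1 D p * wirt j (wirtBar 0 D) p)
      - wirt 1 (wirtBar 0 D) p *
        (wirt j (wirt 0 D) p * wirtBar 1 D p + wirt 0 D p * wirt j (wirtBar 1 D) p)
      + wirt 1 (wirtBar 1 D) p *
        (wirt j (wirt 0 D) p * wirtBar 0 D p + wirt 0 D p * wirt j (wirtBar 0 D) p) := by
  have a0 := (hD.wirt 0).diffble p
  have a1 := (hD.wirt 1).diffble p
  have b0 := (hD.wirtBar 0).diffble p
  have b1 := (hD.wirtBar 1).diffble p
  have h00 := ((hD.wirtBar 0).wirt 0).diffble p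
  have h01 := ((hD.wirtBar 1).wirt 0).diffble p
  have h10 := ((hD.wirtBar 0).wirt 1).diffble p
  have h11 := ((hD.wirtBar 1).wirt 1).diffble p
  unfold leviDet
  rw [wirt_sub j ((h00.fun_mul (a1.fun_mul b1)).fun_sub (h01.fun_mul (a1.fun_mul b0)))
      ((h10.fun_mul (a0.fun_mul b1)).fun_sub (h11.fun_mul (a0.fun_mul b0))),
    wirt_sub j (h00.fun_mul (a1.fun_mul b1)) (h01.fun_mul (a1.fun_mul b0)),
    wirt_sub j (h10.fun_mul (a0.fun_mul b1)) (h11.fun_mul (a0.fun_mul b0)),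
    wirt_mul j h00 (a1.fun_mul b1), wirt_mul j h01 (a1.fun_mul b0),
    wirt_mul j h10 (a0.fun_mul b1), wirt_mul j h11 (a0.fun_mul b0),
    wirt_mul j a1 b1, wirt_mul j a1 b0, wirt_mul j a0 b1, wirt_mul j a0 b0]
  ring

end JetIdentities

/-! ### The Levi function as a determinant in the derivatives of d. -/

section LeviFn

open Filter Topology

theorem leviForm_tangentVec_eq (d : C2 → ℝ) (x : C2) :
    leviForm d x (tangentVec d x) (tangentVec d x) = leviDet (fun x => (d x : ℂ)) x := by
  simp only [leviForm, tangentVec, leviDet, Fin.sum_univ_two]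
  simp [conj_wirt_ofReal]
  ring

theorem ofReal_leviFn {d : C2 → ℝ} (hd : ContDiff ℝ ∞ d) :
    (fun x => (leviFn d x : ℂ)) = leviDet (fun x => (d x : ℂ)) := by
  funext x
  rw [← leviForm_tangentVec_eq, leviFn, complexHessian_eq_re_leviForm]
  exact conj_eq_iff_re.1 (leviForm_conj (hd.contDiffAt.of_le ENat.LEInfty.out) _ _)

theorem wirt_leviDet_of_fderiv {d : C2 → ℝ} (hd : ContDiff ℝ ∞ d) {p : C2} {μ : ℝ}
    (hμ : fderiv ℝ (leviFn d) p = -μ • fderiv ℝ d p) (j : Fin 2) :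
    wirt j (leviDet (fun x => (d x : ℂ))) p = -μ * wirt j (fun x => (d x : ℂ)) p := by
  rw [← ofReal_leviFn hd]
  have h1 : DifferentiableAt ℝ (leviFn d) p := (contDiff_leviFn hd).differentiable (by simp) p
  have h2 : DifferentiableAt ℝ d p := hd.differentiable (by simp) p
  simp only [wirt, fderiv_complexOfReal h1, fderiv_complexOfReal h2, hμ, smul_apply,
    smul_eq_mul]
  push_cast
  ring

end LeviFn

/-! ### Points with d_z = d_zz̄ = 0. -/

section FlatPoints

open Filter Topology

variable {D : C2 → ℂ} {p : C2}

theorem flat_eikonal (hD : ContDiff ℝ ∞ D) (hr : ∀ x, conj (D x) = D x)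
    (hE : ∀ᶠ x in 𝓝 p, wirt 0 D x * wirtBar 0 D x + wirt 1 D x * wirtBar 1 D x = 1 / 4)
    (h0 : wirt 0 D p = 0) :
    wirt 1 D p * wirt 0 (wirtBar 1 D) p + wirt 0 (wirt 1 D) p * wirtBar 1 D p = 0 := by
  have h := wirt_eikonal hD hE 0
  have h0' : wirtBar 0 D p = 0 := by rw [← conj_wirt_of_real hr, h0, map_zero]
  rw [h0, h0'] at h
  linear_combination h

theorem flat_wirt_one (hr : ∀ x, conj (D x) = D x)
    (hE : ∀ᶠ x in 𝓝 p, wirt 0 D x * wirtBar 0 D x + wirt 1 D x * wirtBar 1 D x = 1 / 4)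
    (h0 : wirt 0 D p = 0) : wirt 1 D p * wirtBar 1 D p = 1 / 4 ∧ ‖wirt 1 D p‖ = 1 / 2 := by
  have h1 := hE.self_of_nhds
  rw [h0, zero_mul, zero_add] at h1
  refine ⟨h1, ?_⟩
  rw [← conj_wirt_of_real hr, mul_conj, normSq_eq_norm_sq] at h1
  have h2 : ‖wirt 1 D p‖ ^ 2 = 1 / 4 := by
    apply ofReal_injective
    rw [h1]; push_cast; ring
  have h3 := norm_nonneg (wirt 1 D p)
  nlinarith

theorem flat_norm_eq (hD : ContDiff ℝ ∞ D) (hr : ∀ x, conj (D x) = D x)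
    (hE : ∀ᶠ x in 𝓝 p, wirt 0 D x * wirtBar 0 D x + wirt 1 D x * wirtBar 1 D x = 1 / 4)
    (h0 : wirt 0 D p = 0) : ‖wirt 0 (wirt 1 D) p‖ = ‖wirt 0 (wirtBar 1 D) p‖ := by
  have h := flat_eikonal hD hr hE h0
  obtain ⟨-, hn⟩ := flat_wirt_one hr hE h0
  have h1 := congrArg norm (eq_neg_of_add_eq_zero_left h)
  rw [norm_neg, norm_mul, norm_mul, ← conj_wirt_of_real hr, norm_conj, hn] at h1
  linarith

/-- In the w-derivative of the Levi determinant only D_zz̄w |D_w|² and D_wz̄ times the left side of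
`flat_eikonal` survive at a flat point; the latter is zero and |D_w|² = 1/4. -/
theorem flat_levi_deriv (hD : ContDiff ℝ ∞ D) (hr : ∀ x, conj (D x) = D x)
    (hE : ∀ᶠ x in 𝓝 p, wirt 0 D x * wirtBar 0 D x + wirt 1 D x * wirtBar 1 D x = 1 / 4)
    (h0 : wirt 0 D p = 0) (h00 : wirt 0 (wirtBar 0 D) p = 0) {μ : ℝ}
    (hμ : wirt 1 (leviDet D) p = -μ * wirt 1 D p) :
    wirt 1 (wirt 0 (wirtBar 0 D)) p = -4 * μ * wirt 1 D p := by
  have h := flat_eikonal hD hr hE h0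
  obtain ⟨h1, -⟩ := flat_wirt_one hr hE h0
  have h0' : wirtBar 0 D p = 0 := by rw [← conj_wirt_of_real hr, h0, map_zero]
  rw [wirt_leviDet hD, h0, h0', h00, wirt_wirt_eq hD] at hμ
  linear_combination 4 * hμ + 4 * wirt 1 (wirtBar 0 D) p * h
    - 4 * wirt 1 (wirt 0 (wirtBar 0 D)) p * h1

/-- Insert `flat_levi_deriv` into the twice differentiated eikonal equation. The consequence μ ≥
|D_zw̄|² is what pays for the mixed Levi term. -/
theorem flat_levi_normal_deriv (hD : ContDiff ℝ ∞ D) (hr : ∀ x, conj (D x) = D x)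
    (hE : ∀ᶠ x in 𝓝 p, wirt 0 D x * wirtBar 0 D x + wirt 1 D x * wirtBar 1 D x = 1 / 4)
    (h0 : wirt 0 D p = 0) (h00 : wirt 0 (wirtBar 0 D) p = 0) {μ : ℝ}
    (hμ : wirt 1 (leviDet D) p = -μ * wirt 1 D p) :
    2 * μ = ‖wirt 0 (wirt 0 D) p‖ ^ 2 + 2 * ‖wirt 0 (wirtBar 1 D) p‖ ^ 2 := by
  have h0' : wirtBar 0 D p = 0 := by rw [← conj_wirt_of_real hr, h0, map_zero]
  have h := wirt_wirtBar_eikonal hD hE h0 h0' h00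
  obtain ⟨h1, -⟩ := flat_wirt_one hr hE h0
  have hB := flat_levi_deriv hD hr hE h0 h00 hμ
  have hB' : wirtBar 1 (wirt 0 (wirtBar 0 D)) p = -4 * μ * wirtBar 1 D p := by
    rw [← conj_wirt_of_real (fun x => conj_wirt_wirtBar_of_real hD hr 0 0 x), hB]
    simp [conj_wirt_of_real hr, map_ofNat]
  rw [hB, hB', ← conj_wirt_wirt_of_real hr 0 0, ← conj_wirt_wirt_of_real hr 0 1,
    ← conj_wirt_wirtBar_of_real hD hr 0 1, mul_conj, mul_conj, mul_comm (conj _), mul_conj,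
    normSq_eq_norm_sq, normSq_eq_norm_sq, normSq_eq_norm_sq, flat_norm_eq hD hr hE h0] at h
  have h2 : ((2 * μ : ℝ) : ℂ) = ((‖wirt 0 (wirt 0 D) p‖ ^ 2
      + 2 * ‖wirt 0 (wirtBar 1 D) p‖ ^ 2 : ℝ) : ℂ) := by
    push_cast at h ⊢
    linear_combination -h - 8 * μ * h1
  exact_mod_cast h2

/-- The differentiated rotation identity trades z D_zw for z̄ D_wz̄ in `flat_eikonal`, leaving a
number plus its conjugate. It makes the cross term vanish for weights depending on |z|. -/
theorem flat_rotation_re_eq_zero (hD : ContDiff ℝ ∞ D) (hr : ∀ x, conj (D x) = D x)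
    (hE : ∀ᶠ x in 𝓝 p, wirt 0 D x * wirtBar 0 D x + wirt 1 D x * wirtBar 1 D x = 1 / 4)
    (hR : ∀ᶠ x in 𝓝 p, x 0 * wirt 0 D x = conj (x 0) * wirtBar 0 D x)
    (h0 : wirt 0 D p = 0) :
    (p 0 * (wirt 1 D p * wirt 0 (wirtBar 1 D) p)).re = 0 := by
  have h := flat_eikonal hD hr hE h0
  have h1 := rotation_wirt_one hD hR
  have h2 : p 0 * (wirt 1 D p * wirt 0 (wirtBar 1 D) p)
      + conj (p 0 * (wirt 1 D p * wirt 0 (wirtBar 1 D) p)) = 0 := by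
    rw [map_mul, map_mul, conj_wirt_of_real hr, conj_wirt_wirtBar_of_real hD hr]
    linear_combination p 0 * h - wirtBar 1 D p * h1
  rw [add_conj] at h2
  have h3 := ofReal_eq_zero.1 h2
  linarith

/-- The function `z D_{zw} D_{w̄}` is critical in the `z`-direction at flat boundary points. -/
theorem flat_fderiv_eq_zero (hD : ContDiff ℝ ∞ D) (hr : ∀ x, conj (D x) = D x)
    (hE : ∀ᶠ x in 𝓝 p, wirt 0 D x * wirtBar 0 D x + wirt 1 D x * wirtBar 1 D x = 1 / 4)
    (hR : ∀ᶠ x in 𝓝 p, x 0 * wirt 0 D x = conj (x 0) * wirtBar 0 D x)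
    (h0 : wirt 0 D p = 0) (h00 : wirt 0 (wirtBar 0 D) p = 0) {μ : ℝ}
    (hμ : wirt 1 (leviDet D) p = -μ * wirt 1 D p) (c : ℂ) :
    fderiv ℝ (fun x : C2 => x 0 * (wirt 0 (wirt 1 D) x * wirtBar 1 D x)) p
      (EuclideanSpace.single 0 c) = 0 := by
  have hz := differentiable_coord 0 p
  have hA := ((hD.wirt 1).wirt 0).diffble p
  have hb := (hD.wirtBar 1).diffble p
  obtain ⟨h1, -⟩ := flat_wirt_one hr hE h0
  have hk := flat_eikonal hD hr hE h0
  have hB := flat_levi_deriv hD hr hE h0 h00 hμ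
  have hC := flat_levi_normal_deriv hD hr hE h0 h00 hμ
  have hN := flat_norm_eq hD hr hE h0
  have hR1 := rotation_wirt_one hD hR
  have hR0 := rotation_wirt_zero hD hR
  have hR2 := rotation_wirt_one_zero hD hR
  rw [h0, h00, zero_add, mul_zero] at hR0
  -- At a flat point the rotation identity reduces to z D_zz = 0. Away from z = 0 this gives D_zz =
  -- 0, hence μ = |D_zw̄|² exactly, and the third-derivative terms cancel the squared ones.
  have hbar : p 0 * (wirt 0 (wirt 1 D) p * wirtBar 0 (wirtBar 1 D) p
      + wirtBar 0 (wirt 0 (wirt 1 D)) p * wirtBar 1 D p) = 0 := by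
    rcases mul_eq_zero.1 hR0 with hz0 | h000
    · rw [hz0, zero_mul]
    · rw [h000, norm_zero] at hC
      have h3 : wirt 0 (wirt 1 D) p * wirtBar 0 (wirtBar 1 D) p = μ := by
        rw [← conj_wirt_wirt_of_real hr, mul_conj, normSq_eq_norm_sq, hN]
        congr 1; linarith
      have h4 : wirtBar 0 (wirt 0 (wirt 1 D)) p = wirt 1 (wirt 0 (wirtBar 0 D)) p := by
        rw [wirtBar_wirt_eq (hD.wirt 1), wirtBar_wirt_eq hD, ← wirt_wirt_eq (hD.wirtBar 0)]
      rw [h3, h4, hB]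
      linear_combination -4 * μ * p 0 * h1
  have hhol : wirt 0 (wirt 1 D) p * wirtBar 1 D p + p 0 * (wirt 0 (wirt 1 D) p *
      wirt 0 (wirtBar 1 D) p + wirt 0 (wirt 0 (wirt 1 D)) p * wirtBar 1 D p) = 0 := by
    rcases mul_eq_zero.1 hR0 with hz0 | h000
    · have h5 := rotation_mixed_eq_zero_of_coord hD hR hz0
      have h6 : wirt 0 (wirtBar 1 D) p = 0 := by
        rw [← conj_wirt_wirtBar_of_real hD hr 1 0, h5, map_zero]
      rw [h6, mul_zero, zero_add] at hk
      rw [hk, hz0]; ring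
    · rw [h000, norm_zero] at hC
      have h3 : wirt 1 (wirtBar 0 D) p * wirt 0 (wirtBar 1 D) p = μ := by
        rw [← conj_wirt_wirtBar_of_real hD hr 0 1, mul_comm, mul_conj, normSq_eq_norm_sq]
        congr 1; linarith
      linear_combination wirtBar 1 D p * hR2 + wirt 0 (wirtBar 1 D) p * hR1 + conj (p 0) * h3
        + conj (p 0) * wirtBar 1 D p * hB - 4 * μ * conj (p 0) * h1
  rw [fderiv_eq_wirt, wirt_mul 0 hz (hA.fun_mul hb), wirtBar_mul 0 hz (hA.fun_mul hb),
    wirt_mul 0 hA hb, wirtBar_mul 0 hA hb, wirt_coord, wirtBar_coord]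
  simp only [if_true, one_mul, zero_mul, add_zero, PiLp.single_apply, one_ne_zero, if_false,
    map_zero]
  rw [add_comm (p 0 * _), hhol, hbar]
  ring

end FlatPoints

/-! ### The flat set and its disk-like components. -/

section DiskLike

open Filter Topology Set

theorem criticalSet_iff {Ω : Set C2} {d : C2 → ℝ} (hd : IsBoundaryDistance Ω d) {p : C2}
    (hp : p ∈ frontier Ω) : p ∈ criticalSet Ω ↔ wirt 0 (fun x => (d x : ℂ)) p = 0 ∧
      wirt 0 (wirtBar 0 (fun x => (d x : ℂ))) p = 0 := by
  have h : (fun x => (d x : ℂ)) =ᶠ[𝓝 p] signedBdryDistC Ω :=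
    (hd.eq_dist p hp).mono fun x hx => by simp only [hx, signedBdryDistC]
  rw [h.wirt_eq, h.wirtBar.wirt_eq]
  exact ⟨fun h => h.2, fun h => ⟨hp, h⟩⟩

theorem wirt_wirtBar_signedBdryDistC {Ω : Set C2} {d : C2 → ℝ} (hd : IsBoundaryDistance Ω d)
    {p : C2} (hp : p ∈ frontier Ω) (j k : Fin 2) :
    wirt j (wirtBar k (signedBdryDistC Ω)) p = wirt j (wirtBar k (fun x => (d x : ℂ))) p := by
  have h : (fun x => (d x : ℂ)) =ᶠ[𝓝 p] signedBdryDistC Ω :=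
    (hd.eq_dist p hp).mono fun x hx => by simp only [hx, signedBdryDistC]
  exact h.wirtBar.wirt_eq.symm

theorem leviFn_of_wirt_eq_zero {d : C2 → ℝ} {p : C2} (h0 : wirt 0 (fun x => (d x : ℂ)) p = 0)
    (h1 : wirt 1 (fun x => (d x : ℂ)) p * wirtBar 1 (fun x => (d x : ℂ)) p = 1 / 4) :
    leviFn d p = (1 / 4) * (wirt 0 (wirtBar 0 (fun x => (d x : ℂ))) p).re := by
  have h0' : wirtBar 0 (fun x => (d x : ℂ)) p = 0 := by rw [← conj_wirt_ofReal, h0, map_zero]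
  rw [leviFn, complexHessian_eq_re_leviForm, leviForm_tangentVec_eq, leviDet, h0, h0', h1]
  simp; ring

theorem leviFn_eq_zero_of_mem_criticalSet {Ω : Set C2} {d : C2 → ℝ}
    (hd : IsBoundaryDistance Ω d) {p : C2} (hp : p ∈ criticalSet Ω) : leviFn d p = 0 := by
  obtain ⟨h0, h00⟩ := (criticalSet_iff hd hp.1).1 hp
  rw [leviFn_of_wirt_eq_zero h0 (flat_wirt_one (fun x => conj_ofReal _) (hd.eikonal p hp.1) h0).1,
    h00]
  simp

/-- When d_z = 0 the field L points in the z-direction with |d_w|² = 1/4, so the Levi function is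
d_zz̄/4. The regularity hypothesis and the bounds on components thus concern the same set. -/
theorem weakSet₁_eq_criticalSet {Ω : Set C2} {d : C2 → ℝ} (hd : IsBoundaryDistance Ω d)
    (hpsc : IsLeviPseudoconvex Ω) : weakSet₁ Ω = criticalSet Ω := by
  ext p
  constructor
  · rintro ⟨hw, h0⟩
    have hp := hw.1
    have h : (fun x => (d x : ℂ)) =ᶠ[𝓝 p] signedBdryDistC Ω :=
      (hd.eq_dist p hp).mono fun x hx => by simp only [hx, signedBdryDistC]
    rw [← h.wirt_eq] at h0
    refine (criticalSet_iff hd hp).2 ⟨h0, ?_⟩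
    rw [mem_weaklyPseudoconvexPoints_iff hd hpsc hp, leviFn_of_wirt_eq_zero h0
      (flat_wirt_one (fun x => conj_ofReal _) (hd.eikonal p hp) h0).1] at hw
    have hre : (wirt 0 (wirtBar 0 (fun x => (d x : ℂ))) p).re = 0 := by linarith
    have him := conj_eq_iff_re.1
      (conj_wirt_wirtBar_of_real hd.defining.1.complexOfReal (fun x => conj_ofReal _) 0 0 p)
    rw [← him, hre, ofReal_zero]
  · intro hp
    exact ⟨(mem_weaklyPseudoconvexPoints_iff hd hpsc hp.1).2
      (leviFn_eq_zero_of_mem_criticalSet hd hp), hp.2.1⟩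

/-- The D'Angelo form vanishes on disk-like families of flat points. -/
theorem mixed_eq_zero_of_ray {Ω : Set C2} {d : C2 → ℝ} (hd : IsBoundaryDistance Ω d)
    (hpsc : IsLeviPseudoconvex Ω) (hH : IsHartogs Ω) {p : C2}
    (hray : ∀ s : ℝ, 0 ≤ s → s ≤ 1 → (!₂[(s : ℂ) * p 0, p 1] : C2) ∈ criticalSet Ω) :
    wirt 0 (wirtBar 1 (fun x => (d x : ℂ))) p = 0 := by
  set D : C2 → ℂ := fun x => (d x : ℂ) with hDdef
  have hD : ContDiff ℝ ∞ D := hd.defining.1.complexOfReal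
  have hr : ∀ x, conj (D x) = D x := fun x => conj_ofReal _
  set F : C2 → ℂ := fun x => x 0 * (wirt 0 (wirt 1 D) x * wirtBar 1 D x) with hF
  have hFd : Differentiable ℝ F :=
    (differentiable_coord 0).fun_mul
      (((hD.wirt 1).wirt 0).diffble.fun_mul (hD.wirtBar 1).diffble)
  set γ : ℝ → C2 := fun s => (s • (EuclideanSpace.single 0 (p 0) : C2))
    + EuclideanSpace.single 1 (p 1) with hγ
  have hγe : ∀ s, γ s = !₂[(s : ℂ) * p 0, p 1] := by
    intro s
    ext i
    fin_cases i <;> simp [hγ]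
  have hγd : ∀ s, HasDerivAt γ (EuclideanSpace.single 0 (p 0) : C2) s := by
    intro s
    refine (((hasDerivAt_id s).smul_const (EuclideanSpace.single 0 (p 0) : C2)).add_const
      (EuclideanSpace.single 1 (p 1) : C2)).congr_deriv ?_
    simp
  have hder : ∀ s ∈ Icc (0 : ℝ) 1, HasDerivAt (fun s => F (γ s)) 0 s := by
    intro s hs
    have hq := hray s hs.1 hs.2
    rw [← hγe] at hq
    obtain ⟨h0, h00⟩ := (criticalSet_iff hd hq.1).1 hq
    obtain ⟨μ, hμ⟩ := exists_fderiv_leviFn_eq hd hpsc hq.1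
      (leviFn_eq_zero_of_mem_criticalSet hd hq)
    have h := flat_fderiv_eq_zero hD hr (hd.eikonal _ hq.1) (hd.rotation hH hq.1) h0 h00
      (wirt_leviDet_of_fderiv hd.defining.1 hμ 1) (p 0)
    have h2 := HasFDerivAt.comp_hasDerivAt (l := F) s (hFd (γ s)).hasFDerivAt (hγd s)
    rw [h] at h2
    exact h2
  have hconst := constant_of_has_deriv_right_zero (f := fun s => F (γ s)) (a := 0) (b := 1)
    (fun s hs => (hder s hs).continuousAt.continuousWithinAt)
    (fun s hs => (hder s ⟨hs.1, hs.2.le⟩).hasDerivWithinAt) 1 (by simp)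
  have hγ1 : γ 1 = p := by
    ext i
    fin_cases i <;> simp [hγ]
  have hp : p ∈ criticalSet Ω := by
    have := hray 1 zero_le_one le_rfl
    rwa [← hγe, hγ1] at this
  obtain ⟨h0, h00⟩ := (criticalSet_iff hd hp.1).1 hp
  have hF0 : F (γ 0) = 0 := by simp [hF, hγ]
  rw [hF0, hγ1] at hconst
  -- Constancy along the ray says nothing when z = 0; there the mixed derivative vanishes by
  -- rotation alone.
  by_cases hz : p 0 = 0
  · rw [← conj_wirt_wirtBar_of_real hD hr 1 0,
      rotation_mixed_eq_zero_of_coord hD (hd.rotation hH hp.1) hz, map_zero]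
  · have hk := flat_eikonal hD hr (hd.eikonal p hp.1) h0
    have h1 := (mul_eq_zero.1 hconst).resolve_left hz
    rw [h1, add_zero] at hk
    refine (mul_eq_zero.1 hk).resolve_left fun h2 => ?_
    have h3 := (flat_wirt_one hr (hd.eikonal p hp.1) h0).1
    rw [h2] at h3
    norm_num at h3

end DiskLike

/-! ### Admissible weights at flat points. -/

section Weights

open Filter Topology Set

/-- The pointwise inequality which makes `-(-d e^ψ)^τ` plurisubharmonic near a weakly
pseudoconvex point. -/
def IsAdmissibleWeight (d ψ : C2 → ℝ) (τ : ℝ) (p : C2) : Prop :=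
  ∃ μ : ℝ, fderiv ℝ (leviFn d) p = -μ • fderiv ℝ d p ∧
    ‖leviForm d p (tangentVec d p) (realGrad d p)
      + τ / 2 * holDeriv ψ p (tangentVec d p)‖ ^ 2 < (1 - τ) / 4 *
        (μ - complexHessian ψ p (tangentVec d p) - τ * ‖holDeriv ψ p (tangentVec d p)‖ ^ 2)

theorem IsAdmissibleWeight.congr {d ψ φ : C2 → ℝ} {τ : ℝ} {p : C2}
    (h : IsAdmissibleWeight d ψ τ p) (he : φ =ᶠ[𝓝 p] ψ) : IsAdmissibleWeight d φ τ p := by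
  obtain ⟨μ, h1, h2⟩ := h
  exact ⟨μ, h1, by rwa [he.holDeriv_eq, he.complexHessian_eq]⟩

/-- Here L = (d_w, 0) with |d_w| = 1/2, so only z-derivatives of ψ enter. The condition `hcross`
makes the square on the left split, and μ ≥ |d_zw̄|² reduces the rest to `hlt`. -/
theorem isAdmissibleWeight_of_flat {Ω : Set C2} {d ψ : C2 → ℝ} (hd : IsBoundaryDistance Ω d)
    (hpsc : IsLeviPseudoconvex Ω) {τ : ℝ} (hτ1 : τ < 1) {p : C2}
    (hp : p ∈ criticalSet Ω)
    (hcross : (conj (wirt 0 (fun x => (ψ x : ℂ)) p) * (wirt 1 (fun x => (d x : ℂ)) p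
      * wirt 0 (wirtBar 1 (fun x => (d x : ℂ))) p)).re = 0)
    (hlt : τ * (4 * ‖wirt 0 (wirtBar 1 (fun x => (d x : ℂ))) p‖ ^ 2
      + ‖wirt 0 (fun x => (ψ x : ℂ)) p‖ ^ 2)
      < -(1 - τ) * (wirt 0 (wirtBar 0 (fun x => (ψ x : ℂ))) p).re) :
    IsAdmissibleWeight d ψ τ p := by
  obtain ⟨h0, h00⟩ := (criticalSet_iff hd hp.1).1 hp
  have hD : ContDiff ℝ ∞ (fun x => (d x : ℂ)) := hd.defining.1.complexOfReal
  have hr : ∀ x, conj ((d x : ℂ)) = (d x : ℂ) := fun x => conj_ofReal _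
  have hE := hd.eikonal p hp.1
  obtain ⟨μ, hμ⟩ := exists_fderiv_leviFn_eq hd hpsc hp.1 (leviFn_eq_zero_of_mem_criticalSet hd hp)
  refine ⟨μ, hμ, ?_⟩
  have hC := flat_levi_normal_deriv hD hr hE h0 h00
    (wirt_leviDet_of_fderiv hd.defining.1 hμ 1)
  obtain ⟨h1, hn⟩ := flat_wirt_one hr hE h0
  have e1 : leviForm d p (tangentVec d p) (realGrad d p)
      = 2 * wirt 1 (fun x => (d x : ℂ)) p *
        (wirt 1 (fun x => (d x : ℂ)) p * wirt 0 (wirtBar 1 (fun x => (d x : ℂ))) p) := by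
    simp only [leviForm, tangentVec, realGrad, Fin.sum_univ_two]
    simp [conj_wirtBar_ofReal, h0, h00, map_ofNat]
    ring
  have e2 : holDeriv ψ p (tangentVec d p)
      = wirt 1 (fun x => (d x : ℂ)) p * wirt 0 (fun x => (ψ x : ℂ)) p := by
    simp [holDeriv, tangentVec, Fin.sum_univ_two, h0]
  have e3 : complexHessian ψ p (tangentVec d p)
      = (wirt 0 (wirtBar 0 (fun x => (ψ x : ℂ))) p).re / 4 := by
    rw [complexHessian_eq_re_leviForm]
    simp only [leviForm, tangentVec, Fin.sum_univ_two]
    simp only [h0, neg_zero, Matrix.cons_val_zero, Matrix.cons_val_one, map_zero,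
      mul_zero, add_zero, zero_mul, conj_wirt_ofReal]
    rw [mul_assoc, h1, show (1 / 4 : ℂ) = ((1 / 4 : ℝ) : ℂ) by push_cast; ring, re_mul_ofReal]
    ring
  rw [e1, e2, e3]
  generalize wirt 0 (wirtBar 0 (fun x => (ψ x : ℂ))) p = Q at *
  generalize wirt 0 (fun x => (ψ x : ℂ)) p = P at *
  generalize wirt 0 (wirtBar 1 (fun x => (d x : ℂ))) p = S at *
  generalize wirt 1 (fun x => (d x : ℂ)) p = a at *
  have e4 : ‖2 * a * (a * S) + τ / 2 * (a * P)‖ ^ 2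
      = ‖a‖ ^ 2 * (4 * ‖a‖ ^ 2 * ‖S‖ ^ 2 + τ ^ 2 / 4 * ‖P‖ ^ 2
        + 2 * τ * (conj P * (a * S)).re) := by
    have e5 : (2 : ℂ) * a * (a * S) + τ / 2 * (a * P) = a * ((2 : ℝ) * (a * S) + (τ / 2 : ℝ) * P)
      := by push_cast; ring
    rw [e5, norm_mul, mul_pow]
    congr 1
    simp only [← normSq_eq_norm_sq, normSq_apply, add_re, add_im, mul_re, mul_im, ofReal_re,
      ofReal_im, conj_re, conj_im]
    ring
  rw [e4, hcross, norm_mul, mul_pow, hn]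
  have hμ' : ‖S‖ ^ 2 ≤ μ := by nlinarith [sq_nonneg ‖wirt 0 (wirt 0 (fun x => (d x : ℂ))) p‖]
  nlinarith [mul_le_mul_of_nonneg_left hμ' (sub_nonneg.2 hτ1.le)]

theorem complexOfReal_norm_sq (ε : ℝ) : (fun x : C2 => ((-(ε * ‖x‖ ^ 2) : ℝ) : ℂ))
    = fun x => (-ε : ℂ) * (x 0 * conj (x 0) + x 1 * conj (x 1)) := by
  funext x
  rw [EuclideanSpace.norm_sq_eq, Fin.sum_univ_two, mul_conj, mul_conj, normSq_eq_norm_sq,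
    normSq_eq_norm_sq]
  push_cast; ring

theorem contDiff_neg_norm_sq (ε : ℝ) : ContDiff ℝ ∞ (fun x : C2 => -(ε * ‖x‖ ^ 2)) :=
  (contDiff_const.mul (contDiff_id.norm_sq ℝ)).neg

theorem wirt_neg_norm_sq (ε : ℝ) (j : Fin 2) (p : C2) :
    wirt j (fun x : C2 => ((-(ε * ‖x‖ ^ 2) : ℝ) : ℂ)) p = -ε * conj (p j) := by
  have c0 := differentiable_coord 0 p
  have c1 := differentiable_coord 1 p
  have k0 := differentiable_conj_coord 0 p
  have k1 := differentiable_conj_coord 1 p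
  rw [complexOfReal_norm_sq, wirt_mul j (differentiableAt_const _)
    ((c0.fun_mul k0).fun_add (c1.fun_mul k1)), wirt_add j (c0.fun_mul k0) (c1.fun_mul k1),
    wirt_mul j c0 k0, wirt_mul j c1 k1, wirt_const, wirt_coord, wirt_coord, wirt_conj_coord,
    wirt_conj_coord]
  fin_cases j <;> simp

theorem wirtBar_neg_norm_sq (ε : ℝ) (j : Fin 2) (p : C2) :
    wirtBar j (fun x : C2 => ((-(ε * ‖x‖ ^ 2) : ℝ) : ℂ)) p = -ε * p j := by
  rw [← conj_wirt_ofReal, wirt_neg_norm_sq]; simp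

theorem wirt_wirtBar_neg_norm_sq (ε : ℝ) (j k : Fin 2) (p : C2) :
    wirt j (wirtBar k (fun x : C2 => ((-(ε * ‖x‖ ^ 2) : ℝ) : ℂ))) p
      = if k = j then (-ε : ℂ) else 0 := by
  rw [show wirtBar k (fun x : C2 => ((-(ε * ‖x‖ ^ 2) : ℝ) : ℂ)) = fun x : C2 => (-ε : ℂ) * x k from
    funext fun x => wirtBar_neg_norm_sq ε k x, wirt_mul j (differentiableAt_const _)
    (differentiable_coord k p), wirt_const, wirt_coord]
  split_ifs <;> simp

/-- With d_zw̄ = 0 the condition is only τ|ψ_z|² < -(1-τ)ψ_zz̄, which holds for small ε because the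
left side is quadratic in ε and the right side linear. -/
theorem isAdmissibleWeight_of_disk {Ω : Set C2} {d : C2 → ℝ} (hd : IsBoundaryDistance Ω d)
    (hpsc : IsLeviPseudoconvex Ω) {τ : ℝ} (hτ1 : τ < 1) {p : C2}
    (hp : p ∈ criticalSet Ω) (h01 : wirt 0 (wirtBar 1 (fun x => (d x : ℂ))) p = 0)
    {ε : ℝ} (hε : 0 < ε) (hlt : τ * ε * ‖p‖ ^ 2 < 1 - τ) (hτ0 : 0 < τ) :
    IsAdmissibleWeight d (fun x => -(ε * ‖x‖ ^ 2)) τ p := by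
  apply isAdmissibleWeight_of_flat hd hpsc hτ1 hp
  · rw [h01, mul_zero, mul_zero, zero_re]
  · rw [h01, wirt_neg_norm_sq, wirt_wirtBar_neg_norm_sq, if_pos rfl, norm_zero, norm_mul, norm_neg,
      norm_conj, norm_real, Real.norm_of_nonneg hε.le, neg_re, ofReal_re]
    have h1 : ‖p 0‖ ^ 2 ≤ ‖p‖ ^ 2 := by
      rw [EuclideanSpace.norm_sq_eq, Fin.sum_univ_two]
      linarith [sq_nonneg ‖p 1‖]
    have h2 : τ * ε * ‖p 0‖ ^ 2 < 1 - τ :=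
      (mul_le_mul_of_nonneg_left h1 (by positivity)).trans_lt hlt
    nlinarith

theorem complexOfReal_norm_coord_sq : (fun x : C2 => ((‖x 0‖ ^ 2 : ℝ) : ℂ))
    = fun x => x 0 * conj (x 0) := by
  funext x
  rw [mul_conj, normSq_eq_norm_sq]

theorem wirt_norm_coord_sq (p : C2) :
    wirt 0 (fun x : C2 => ((‖x 0‖ ^ 2 : ℝ) : ℂ)) p = conj (p 0) := by
  rw [complexOfReal_norm_coord_sq, wirt_mul 0 (differentiable_coord 0 p)
    (differentiable_conj_coord 0 p), wirt_coord, wirt_conj_coord]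
  simp

theorem wirtBar_norm_coord_sq (p : C2) :
    wirtBar 0 (fun x : C2 => ((‖x 0‖ ^ 2 : ℝ) : ℂ)) p = p 0 := by
  rw [← conj_wirt_ofReal, wirt_norm_coord_sq, conj_conj]

theorem contDiff_norm_coord_sq : ContDiff ℝ ∞ (fun x : C2 => ‖x 0‖ ^ 2) :=
  (contDiff_coord 0).norm_sq ℝ

/-- The radial weight `(1/k) log cos (2kC(log y - x₀))`, with `y = |z|²`. -/
noncomputable def radialWeight (k C x₀ y : ℝ) : ℝ :=
  (1 / k) * Real.log (Real.cos (2 * k * C * (Real.log y - x₀)))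

theorem contDiffAt_radialWeight {k C x₀ y : ℝ} (hy : 0 < y)
    (hcos : 0 < Real.cos (2 * k * C * (Real.log y - x₀))) {n : WithTop ℕ∞} :
    ContDiffAt ℝ n (radialWeight k C x₀) y := by
  have h1 : ContDiffAt ℝ n (fun y => 2 * k * C * (Real.log y - x₀)) y :=
    contDiffAt_const.mul ((contDiffAt_id.log hy.ne').sub contDiffAt_const)
  exact contDiffAt_const.mul (h1.cos.log hcos.ne')

theorem hasDerivAt_radialWeight {k C x₀ y : ℝ} (hk : k ≠ 0) (hy : 0 < y)
    (hcos : 0 < Real.cos (2 * k * C * (Real.log y - x₀))) :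
    HasDerivAt (radialWeight k C x₀)
      (-(2 * C) * Real.tan (2 * k * C * (Real.log y - x₀)) / y) y := by
  have h1 : HasDerivAt (fun y => 2 * k * C * (Real.log y - x₀)) (2 * k * C * y⁻¹) y :=
    ((Real.hasDerivAt_log hy.ne').sub_const x₀).const_mul _
  have h2 := ((h1.cos.log hcos.ne').const_mul (1 / k))
  refine h2.congr_deriv ?_
  rw [Real.tan_eq_sin_div_cos]
  field_simp

theorem deriv_deriv_radialWeight {k C x₀ y : ℝ} (hk : k ≠ 0) (hy : 0 < y)
    (hcos : 0 < Real.cos (2 * k * C * (Real.log y - x₀))) :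
    deriv (deriv (radialWeight k C x₀)) y =
      -(4 * k * C ^ 2) * (1 + Real.tan (2 * k * C * (Real.log y - x₀)) ^ 2) / y ^ 2
        + (2 * C) * Real.tan (2 * k * C * (Real.log y - x₀)) / y ^ 2 := by
  have hc : ContinuousAt (fun y => Real.cos (2 * k * C * (Real.log y - x₀))) y :=
    Real.continuous_cos.continuousAt.comp (continuousAt_const.mul
      ((Real.continuousAt_log hy.ne').sub continuousAt_const))
  have hev : deriv (radialWeight k C x₀) =ᶠ[𝓝 y]
      fun y => -(2 * C) * Real.tan (2 * k * C * (Real.log y - x₀)) / y := by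
    filter_upwards [lt_mem_nhds hy, hc.eventually (lt_mem_nhds hcos)] with s hs1 hs2
    exact (hasDerivAt_radialWeight hk hs1 hs2).deriv
  rw [hev.deriv_eq]
  have h1 : HasDerivAt (fun y => 2 * k * C * (Real.log y - x₀)) (2 * k * C * y⁻¹) y :=
    ((Real.hasDerivAt_log hy.ne').sub_const x₀).const_mul _
  have h2 := (Real.hasDerivAt_tan hcos.ne').comp y h1
  have h3 := (h2.const_mul (-(2 * C))).fun_div (hasDerivAt_id y) hy.ne'
  have h4 := h3.deriv
  simp only [Function.comp_def, id] at h4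
  rw [h4]
  have h5 : 1 / Real.cos (2 * k * C * (Real.log y - x₀)) ^ 2
      = 1 + Real.tan (2 * k * C * (Real.log y - x₀)) ^ 2 := by
    rw [Real.tan_eq_sin_div_cos, div_pow]
    field_simp
    rw [Real.cos_sq_add_sin_sq]
  rw [h5]
  field_simp
  ring

/-- The weight is a function of |z|², so ψ_z is a real multiple of z̄ and `flat_rotation_re_eq_zero`
supplies the cross condition. The positive cosine keeps the Riccati solution finite. -/
theorem isAdmissibleWeight_of_annulus {Ω : Set C2} {d : C2 → ℝ} (hd : IsBoundaryDistance Ω d)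
    (hpsc : IsLeviPseudoconvex Ω) (hH : IsHartogs Ω) {τ : ℝ} (hτ0 : 0 < τ) (hτ1 : τ < 1) {p : C2}
    (hp : p ∈ criticalSet Ω) {C x₀ : ℝ} (hz : 0 < ‖p 0‖) (hC0 : 0 < C)
    (hC : ‖wirt 0 (wirtBar 1 (fun x => (d x : ℂ))) p‖ < C / ‖p 0‖)
    (hcos : 0 < Real.cos (2 * (τ / (1 - τ)) * C * (Real.log (‖p 0‖ ^ 2) - x₀))) :
    IsAdmissibleWeight d (fun x => radialWeight (τ / (1 - τ)) C x₀ (‖x 0‖ ^ 2)) τ p := by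
  have hτ' : 0 < 1 - τ := by linarith
  set k := τ / (1 - τ) with hk
  have hk0 : 0 < k := div_pos hτ0 hτ'
  have hy : 0 < ‖p 0‖ ^ 2 := by positivity
  have hN := contDiff_norm_coord_sq.contDiffAt (x := p)
  have hχ := contDiffAt_radialWeight (n := 2) hy hcos
  have h1 := hasDerivAt_radialWeight hk0.ne' hy hcos
  have h2 := deriv_deriv_radialWeight hk0.ne' hy hcos
  have e1 := wirt_comp (hχ.differentiableAt (by norm_num))
    (hN.differentiableAt (by simp)) 0
  have e2 := wirt_wirtBar_comp (φ := fun x : C2 => ‖x 0‖ ^ 2) hχ (hN.of_le ENat.LEInfty.out) 0 0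
  have e3 : wirt 0 (wirtBar 0 (fun x : C2 => ((‖x 0‖ ^ 2 : ℝ) : ℂ))) p = 1 := by
    rw [show wirtBar 0 (fun x : C2 => ((‖x 0‖ ^ 2 : ℝ) : ℂ)) = fun x : C2 => x 0 from
      funext wirtBar_norm_coord_sq, wirt_coord]; simp
  rw [wirt_norm_coord_sq, h1.deriv] at e1
  rw [wirt_norm_coord_sq, wirtBar_norm_coord_sq, e3, h1.deriv, h2, mul_assoc (ofReal _),
    mul_comm (conj _), mul_conj, normSq_eq_norm_sq] at e2
  apply isAdmissibleWeight_of_flat hd hpsc hτ1 hp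
  · rw [e1, map_mul, conj_ofReal, conj_conj, mul_assoc, re_ofReal_mul,
      flat_rotation_re_eq_zero hd.defining.1.complexOfReal (fun x => conj_ofReal _)
        (hd.eikonal p hp.1) (hd.rotation hH hp.1) ((criticalSet_iff hd hp.1).1 hp).1, mul_zero]
  · rw [e1, e2, norm_mul, norm_conj, norm_real, mul_pow, Real.norm_eq_abs, sq_abs, add_re,
      re_ofReal_mul, re_ofReal_mul, one_re, ofReal_re]
    generalize Real.tan (2 * k * C * (Real.log (‖p 0‖ ^ 2) - x₀)) = T
    have hS : ‖wirt 0 (wirtBar 1 (fun x => (d x : ℂ))) p‖ ^ 2 < C ^ 2 / ‖p 0‖ ^ 2 := by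
      rw [← div_pow]
      exact pow_lt_pow_left₀ hC (norm_nonneg _) two_ne_zero
    have hkτ : (1 - τ) * k = τ := by rw [hk]; field_simp
    -- The Riccati equation holds with equality; strictness comes only from the strict bound `hS`.
    have e4 : -(1 - τ) * (-(2 * C) * T / ‖p 0‖ ^ 2 * 1 + (-(4 * k * C ^ 2) * (1 + T ^ 2) /
        (‖p 0‖ ^ 2) ^ 2 + 2 * C * T / (‖p 0‖ ^ 2) ^ 2) * ‖p 0‖ ^ 2)
        = τ * (4 * (C ^ 2 / ‖p 0‖ ^ 2) + 4 * C ^ 2 * T ^ 2 / ‖p 0‖ ^ 2) := by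
      have e6 : 4 * (C ^ 2 / ‖p 0‖ ^ 2) + 4 * C ^ 2 * T ^ 2 / ‖p 0‖ ^ 2
          = 4 * C ^ 2 * (1 + T ^ 2) / ‖p 0‖ ^ 2 := by ring
      rw [e6]
      nth_rewrite 2 [← hkτ]
      clear_value k
      field_simp
      ring
    have e5 : (-(2 * C) * T / ‖p 0‖ ^ 2) ^ 2 * ‖p 0‖ ^ 2 = 4 * C ^ 2 * T ^ 2 / ‖p 0‖ ^ 2 := by
      field_simp
      ring
    rw [e4, e5]
    apply mul_lt_mul_of_pos_left _ hτ0
    linarith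

end Weights

/-! ### Admissible weights where d_z ≠ 0. -/

section Transversal

open Filter Topology Set

/-- With ε = 0 both sides equal (1-τ)²|κ|²/4. The perturbation gains (1-τ)ε/16 on the right and
costs only τε²|η|²/4, the terms linear in ε that mix κ and η cancelling. -/
theorem admissible_inequality {τ ε h : ℝ} {κ η : ℂ} (hε : 0 < ε)
    (hη : 4 * (τ * ε * ‖η‖ ^ 2) < 1 - τ) :
    ‖κ / 2 + τ / 2 * (-κ + -(ε : ℂ) * η)‖ ^ 2 < (1 - τ) / 4 *
      (-h + 2 * ‖κ‖ ^ 2 - (-h + ‖κ‖ ^ 2 - ε / 4) - τ * ‖-κ + -(ε : ℂ) * η‖ ^ 2) := by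
  have e1 : κ / 2 + τ / 2 * (-κ + -(ε : ℂ) * η)
      = ((1 - τ) / 2 : ℝ) * κ - (τ * ε / 2 : ℝ) * η := by push_cast; ring
  have e2 : -κ + -(ε : ℂ) * η = -((1 : ℝ) * κ + (ε : ℝ) * η) := by push_cast; ring
  rw [e1, e2, norm_neg]
  have key : ‖((1 - τ) / 2 : ℝ) * κ - (τ * ε / 2 : ℝ) * η‖ ^ 2 + (1 - τ) / 4 * ε / 4
      - τ * ε ^ 2 * ‖η‖ ^ 2 / 4 = (1 - τ) / 4 *
      (-h + 2 * ‖κ‖ ^ 2 - (-h + ‖κ‖ ^ 2 - ε / 4) - τ * ‖(1 : ℝ) * κ + (ε : ℝ) * η‖ ^ 2) := by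
    simp only [← normSq_eq_norm_sq, normSq_apply, add_re, add_im, sub_re, sub_im, mul_re, mul_im,
      ofReal_re, ofReal_im]
    ring
  rw [← key]
  nlinarith

/-- Multiply the z-derivative of the Levi determinant by z and eliminate D_zz and D_zw by the
rotation identities. The bracket on the right is the Levi form of z D_z on L; the last term is a
multiple of the determinant of the complex Hessian. -/
theorem transversal_levi_deriv {D : C2 → ℂ} {p : C2} (hD : ContDiff ℝ ∞ D)
    (hR : ∀ᶠ x in 𝓝 p, x 0 * wirt 0 D x = conj (x 0) * wirtBar 0 D x)
    (hl : leviDet D p = 0) {μ : ℝ} (hμ : wirt 0 (leviDet D) p = -μ * wirt 0 D p) :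
    -μ * (p 0 * wirt 0 D p) =
      (p 0 * (wirt 0 (wirt 0 (wirtBar 0 D)) p * (wirt 1 D p * wirtBar 1 D p)
        - wirt 0 (wirt 0 (wirtBar 1 D)) p * (wirt 1 D p * wirtBar 0 D p)
        - wirt 0 (wirt 1 (wirtBar 0 D)) p * (wirt 0 D p * wirtBar 1 D p)
        + wirt 0 (wirt 1 (wirtBar 1 D)) p * (wirt 0 D p * wirtBar 0 D p))
      + wirt 1 D p * (wirt 0 (wirtBar 0 D) p * wirtBar 1 D p
        - wirt 0 (wirtBar 1 D) p * wirtBar 0 D p))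
      + 2 * (p 0 * wirt 0 D p) * (wirt 0 (wirtBar 0 D) p * wirt 1 (wirtBar 1 D) p
        - wirt 1 (wirtBar 0 D) p * wirt 0 (wirtBar 1 D) p) := by
  have h1 := rotation_wirt_one hD hR
  have h0 := rotation_wirt_zero hD hR
  have h := hR.self_of_nhds
  rw [wirt_leviDet hD] at hμ
  rw [leviDet] at hl
  generalize wirt 0 (wirt 0 (wirtBar 0 D)) p = T00 at *
  generalize wirt 0 (wirt 0 (wirtBar 1 D)) p = T01 at *
  generalize wirt 0 (wirt 1 (wirtBar 0 D)) p = T10 at *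
  generalize wirt 0 (wirt 1 (wirtBar 1 D)) p = T11 at *
  generalize wirt 0 (wirt 0 D) p = A00 at *
  generalize wirt 0 (wirt 1 D) p = A01 at *
  generalize wirt 0 (wirtBar 0 D) p = h00 at *
  generalize wirt 0 (wirtBar 1 D) p = h01 at *
  generalize wirt 1 (wirtBar 0 D) p = h10 at *
  generalize wirt 1 (wirtBar 1 D) p = h11 at *
  generalize wirt 0 D p = a0 at *
  generalize wirt 1 D p = a1 at *
  generalize wirtBar 0 D p = b0 at *
  generalize wirtBar 1 D p = b1 at *
  linear_combination -(p 0) * hμ + (h00 * b1 - h01 * b0) * h1 + (h11 * b0 - h10 * b1) * h0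
    - hl + (h01 * h10 - h11 * h00) * h

/-- A Hermitian 2×2 form that vanishes on L has determinant minus the square of its mixed entry.
Both κ, the logarithmic L-derivative of z D_z, and the mixed Levi term on (L, N) express that entry.
-/
theorem transversal_identities {D : C2 → ℂ} {p : C2}
    (hE : wirt 0 D p * wirtBar 0 D p + wirt 1 D p * wirtBar 1 D p = 1 / 4)
    (hl : leviDet D p = 0) (ha : wirt 0 D p ≠ 0) (hb : wirtBar 0 D p ≠ 0) {κ : ℂ}
    (hκ : κ * wirtBar 0 D p = wirt 1 D p * wirt 0 (wirtBar 0 D) p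
      - wirt 0 D p * wirt 1 (wirtBar 0 D) p) {κ' : ℂ}
    (hκ' : κ' * wirt 0 D p = wirtBar 1 D p * wirt 0 (wirtBar 0 D) p
      - wirtBar 0 D p * wirt 0 (wirtBar 1 D) p) :
    κ * κ' = -(wirt 0 (wirtBar 0 D) p * wirt 1 (wirtBar 1 D) p
        - wirt 1 (wirtBar 0 D) p * wirt 0 (wirtBar 1 D) p) ∧
    2 * ((wirt 0 (wirtBar 0 D) p * wirt 1 D p - wirt 1 (wirtBar 0 D) p * wirt 0 D p) * wirt 0 D p
      + (wirt 0 (wirtBar 1 D) p * wirt 1 D p - wirt 1 (wirtBar 1 D) p * wirt 0 D p) * wirt 1 D p)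
      = κ / 2 := by
  rw [leviDet] at hl
  generalize wirt 0 (wirtBar 0 D) p = h00 at *
  generalize wirt 0 (wirtBar 1 D) p = h01 at *
  generalize wirt 1 (wirtBar 0 D) p = h10 at *
  generalize wirt 1 (wirtBar 1 D) p = h11 at *
  generalize wirt 0 D p = a0 at *
  generalize wirt 1 D p = a1 at *
  generalize wirtBar 0 D p = b0 at *
  generalize wirtBar 1 D p = b1 at *
  constructor
  · apply mul_left_cancel₀ (mul_ne_zero ha hb)
    linear_combination (κ' * a0) * hκ + (a1 * h00 - a0 * h10) * hκ' + h00 * hl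
  · apply mul_left_cancel₀ hb
    have h2 : (h01 * a1 - h11 * a0) * b0 = κ * b0 * b1 := by
      linear_combination -hl - b1 * hκ
    linear_combination 2 * a1 * h2 - 2 * a0 * b0 * hκ + 2 * κ * b0 * hE

/-- Near boundary points at which `∂δ̃/∂z ≠ 0`, the function `z ∂δ̃/∂z` is real and nonzero. -/
noncomputable def radialDeriv (d : C2 → ℝ) (x : C2) : ℝ := (x 0 * wirt 0 (fun y => (d y : ℂ)) x).re

theorem contDiff_radialDeriv {d : C2 → ℝ} (hd : ContDiff ℝ ∞ d) :
    ContDiff ℝ ∞ (radialDeriv d) :=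
  reCLM.contDiff.comp ((contDiff_coord 0).mul (hd.complexOfReal.wirt 0))

theorem ofReal_radialDeriv {d : C2 → ℝ} {x : C2}
    (h : x 0 * wirt 0 (fun y => (d y : ℂ)) x = conj (x 0) * wirtBar 0 (fun y => (d y : ℂ)) x) :
    (radialDeriv d x : ℂ) = x 0 * wirt 0 (fun y => (d y : ℂ)) x := by
  refine conj_eq_iff_re.1 ?_
  rw [map_mul, conj_wirt_ofReal, h]

/-- With φ = z d_z one has ∂φ(L) = κφ and complex Hessian φ(-μ + 2|κ|²) on L, while the mixed Levi
term is κ/2. Hence -log|φ| gives equality, and the small quadratic term decides. `Real.log` is log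
of the absolute value, so the sign of φ is immaterial. -/
theorem isAdmissibleWeight_of_transversal {Ω : Set C2} {d : C2 → ℝ} (hd : IsBoundaryDistance Ω d)
    (hpsc : IsLeviPseudoconvex Ω) (hH : IsHartogs Ω) {τ : ℝ} (hτ0 : 0 < τ) {p : C2}
    (hp : p ∈ frontier Ω) (hl : leviFn d p = 0) (ha : wirt 0 (fun x => (d x : ℂ)) p ≠ 0)
    {ε : ℝ} (hε : 0 < ε) (hlt : τ * ε * ‖p‖ ^ 2 < 1 - τ) :
    radialDeriv d p ≠ 0 ∧
    IsAdmissibleWeight d (fun x => -Real.log (radialDeriv d x) + -(ε * ‖x‖ ^ 2)) τ p := by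
  have hD : ContDiff ℝ ∞ (fun x => (d x : ℂ)) := hd.defining.1.complexOfReal
  have hr : ∀ x, conj ((d x : ℂ)) = (d x : ℂ) := fun x => conj_ofReal _
  have hR := hd.rotation hH hp
  obtain ⟨μ, hμ⟩ := exists_fderiv_leviFn_eq hd hpsc hp hl
  have hldet : leviDet (fun x => (d x : ℂ)) p = 0 := by
    simp only [← ofReal_leviFn hd.defining.1, hl, ofReal_zero]
  have hb : wirtBar 0 (fun x => (d x : ℂ)) p ≠ 0 := by
    rw [← conj_wirt_ofReal]; simpa using ha
  have hz : p 0 ≠ 0 := fun hz => hb (wirtBar_zero_eq_zero_of_coord hD hR hz)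
  have hφ := contDiff_radialDeriv hd.defining.1
  have hφa : (fun x => (radialDeriv d x : ℂ)) =ᶠ[𝓝 p]
      fun x => x 0 * wirt 0 (fun y => (d y : ℂ)) x := hR.mono fun x hx => ofReal_radialDeriv hx
  have hφb : (fun x => (radialDeriv d x : ℂ)) =ᶠ[𝓝 p]
      fun x => conj (x 0) * wirtBar 0 (fun y => (d y : ℂ)) x :=
    hR.mono fun x hx => (ofReal_radialDeriv hx).trans hx
  have hφp : (radialDeriv d p : ℂ) = p 0 * wirt 0 (fun y => (d y : ℂ)) p := hφa.self_of_nhds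
  have hφpb : (radialDeriv d p : ℂ) = conj (p 0) * wirtBar 0 (fun y => (d y : ℂ)) p :=
    hφb.self_of_nhds
  have hφ0 : radialDeriv d p ≠ 0 := by
    intro h
    simp only [h, ofReal_zero] at hφp
    exact mul_ne_zero hz ha hφp.symm
  refine ⟨hφ0, μ, hμ, ?_⟩
  have hw : ∀ j, wirt j (fun x => (radialDeriv d x : ℂ)) p
      = conj (p 0) * wirt j (wirtBar 0 (fun y => (d y : ℂ))) p := by
    intro j
    rw [hφb.wirt_eq, wirt_mul j (differentiable_conj_coord 0 p) ((hD.wirtBar 0).diffble p),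
      wirt_conj_coord, zero_mul, add_zero]
  have hww : ∀ j k, wirt j (wirtBar k (fun x => (radialDeriv d x : ℂ))) p
      = (if 0 = j then 1 else 0) * wirt 0 (wirtBar k (fun y => (d y : ℂ))) p
        + p 0 * wirt j (wirt 0 (wirtBar k (fun y => (d y : ℂ)))) p := by
    intro j k
    have e : wirtBar k (fun x : C2 => x 0 * wirt 0 (fun y => (d y : ℂ)) x)
        = fun x => x 0 * wirt 0 (wirtBar k (fun y => (d y : ℂ))) x := by
      funext x
      rw [wirtBar_mul k (differentiable_coord 0 x) ((hD.wirt 0).diffble x), wirtBar_coord,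
        zero_mul, wirtBar_wirt_eq hD]
      ring
    rw [hφa.wirtBar.wirt_eq, e, wirt_mul j (differentiable_coord 0 p)
      (((hD.wirtBar k).wirt 0).diffble p), wirt_coord]
    ring
  obtain ⟨κ, hκ⟩ : ∃ κ : ℂ, κ * wirtBar 0 (fun x => (d x : ℂ)) p
      = wirt 1 (fun x => (d x : ℂ)) p * wirt 0 (wirtBar 0 (fun x => (d x : ℂ))) p
      - wirt 0 (fun x => (d x : ℂ)) p * wirt 1 (wirtBar 0 (fun x => (d x : ℂ))) p :=
    ⟨_, div_mul_cancel₀ _ hb⟩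
  have hκ' := congrArg conj hκ
  simp only [map_mul, map_sub, conj_wirt_wirtBar_of_real hD hr, conj_wirt_of_real hr,
    conj_wirtBar_of_real hr] at hκ'
  obtain ⟨i1, i2⟩ := transversal_identities (hd.eikonal p hp).self_of_nhds hldet ha hb hκ hκ'
  have i3 := transversal_levi_deriv hD hR hldet (wirt_leviDet_of_fderiv hd.defining.1 hμ 0)
  set L := tangentVec d p with hL
  set η : ℂ := L 0 * conj (p 0) + L 1 * conj (p 1) with hη
  have hLn : ‖L 0‖ ^ 2 + ‖L 1‖ ^ 2 = 1 / 4 := by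
    have h := (hd.eikonal p hp).self_of_nhds
    rw [← conj_wirt_ofReal, ← conj_wirt_ofReal, mul_conj, mul_conj, normSq_eq_norm_sq,
      normSq_eq_norm_sq] at h
    have h2 : L 0 = wirt 1 (fun x => (d x : ℂ)) p ∧ L 1 = -wirt 0 (fun x => (d x : ℂ)) p := by
      simp [hL, tangentVec]
    rw [h2.1, h2.2, norm_neg]
    apply ofReal_injective
    push_cast at h ⊢
    linear_combination h
  have hη2 : 4 * (τ * ε * ‖η‖ ^ 2) < 1 - τ := by
    have h1 : ‖η‖ ≤ ‖L 0‖ * ‖p 0‖ + ‖L 1‖ * ‖p 1‖ := by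
      refine (norm_add_le _ _).trans ?_
      simp
    have h2 : ‖η‖ ^ 2 ≤ (‖L 0‖ * ‖p 0‖ + ‖L 1‖ * ‖p 1‖) ^ 2 :=
      pow_le_pow_left₀ (norm_nonneg _) h1 2
    have h3 : (‖L 0‖ * ‖p 0‖ + ‖L 1‖ * ‖p 1‖) ^ 2
        ≤ (‖L 0‖ ^ 2 + ‖L 1‖ ^ 2) * (‖p 0‖ ^ 2 + ‖p 1‖ ^ 2) := by
      nlinarith [sq_nonneg (‖L 0‖ * ‖p 1‖ - ‖L 1‖ * ‖p 0‖)]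
    have h4 : ‖p‖ ^ 2 = ‖p 0‖ ^ 2 + ‖p 1‖ ^ 2 := by
      rw [EuclideanSpace.norm_sq_eq, Fin.sum_univ_two]
    rw [hLn, ← h4] at h3
    have h5 : τ * ε * (4 * ‖η‖ ^ 2) ≤ τ * ε * ‖p‖ ^ 2 :=
      mul_le_mul_of_nonneg_left (by linarith) (by positivity)
    linarith
  have k1 : leviForm d p L (realGrad d p) = κ / 2 := by
    rw [← i2]
    simp only [leviForm, hL, tangentVec, realGrad, Fin.sum_univ_two]
    simp [conj_wirtBar_ofReal, map_ofNat]
    ring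
  have k2 : holDeriv (radialDeriv d) p L = radialDeriv d p * κ := by
    rw [hφpb, mul_assoc, mul_comm _ κ, hκ]
    simp only [holDeriv, hL, tangentVec, Fin.sum_univ_two, hw]
    simp
    ring
  have k3 : leviForm (radialDeriv d) p L L
      = ((radialDeriv d p * (-μ + 2 * ‖κ‖ ^ 2) : ℝ) : ℂ) := by
    rw [mul_conj, normSq_eq_norm_sq] at i1
    have i4 : ((‖κ‖ ^ 2 : ℝ) : ℂ) = ‖κ‖ ^ 2 := by push_cast; rfl
    rw [ofReal_mul, hφp]
    simp only [leviForm, hL, tangentVec, Fin.sum_univ_two, hww]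
    simp [conj_wirt_ofReal, wirt_wirt_eq (hD.wirtBar _)]
    rw [i4] at i1
    linear_combination -i3 - 2 * (p 0 * wirt 0 (fun x => (d x : ℂ)) p) * i1
  have k4 : complexHessian (radialDeriv d) p L = radialDeriv d p * (-μ + 2 * ‖κ‖ ^ 2) := by
    rw [complexHessian_eq_re_leviForm, k3, ofReal_re]
  have l1 : ContDiffAt ℝ 2 (fun y => -Real.log y) (radialDeriv d p) := (contDiffAt_id.log hφ0).neg
  have l2 : deriv (fun y => -Real.log y) = fun y => -y⁻¹ := by
    funext y; simp
  have l3 : deriv (fun y : ℝ => -y⁻¹) (radialDeriv d p) = (radialDeriv d p ^ 2)⁻¹ := by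
    simp
  have hφ2 : ContDiffAt ℝ 2 (radialDeriv d) p := hφ.contDiffAt.of_le ENat.LEInfty.out
  have hN2 : ContDiffAt ℝ 2 (fun x : C2 => -(ε * ‖x‖ ^ 2)) p :=
    (contDiff_neg_norm_sq ε).contDiffAt.of_le ENat.LEInfty.out
  have hlog : ContDiffAt ℝ 2 (fun x => -Real.log (radialDeriv d x)) p := l1.comp p hφ2
  have hc : (radialDeriv d p : ℂ) ≠ 0 := by exact_mod_cast hφ0
  have k5 : holDeriv (fun x => -Real.log (radialDeriv d x) + -(ε * ‖x‖ ^ 2)) p L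
      = -κ + -(ε : ℂ) * η := by
    have m1 : holDeriv (fun x => -Real.log (radialDeriv d x)) p L = -κ := by
      rw [holDeriv_comp (χ := fun y => -Real.log y) (l1.differentiableAt (by norm_num))
        (hφ2.differentiableAt (by norm_num)), k2, l2]
      push_cast
      field_simp
    rw [holDeriv_add (hlog.differentiableAt (by norm_num)) (hN2.differentiableAt (by norm_num)), m1]
    simp only [holDeriv, Fin.sum_univ_two, wirt_neg_norm_sq, hη]
    ring
  have k6 : complexHessian (fun x => -Real.log (radialDeriv d x) + -(ε * ‖x‖ ^ 2)) p L
      = -(-μ + 2 * ‖κ‖ ^ 2) + ‖κ‖ ^ 2 - ε / 4 := by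
    have m1 : complexHessian (fun x => -Real.log (radialDeriv d x)) p L
        = -(-μ + 2 * ‖κ‖ ^ 2) + ‖κ‖ ^ 2 := by
      rw [complexHessian_comp (χ := fun y => -Real.log y) l1 hφ2, k2, k4, l2, l3, norm_mul,
        norm_real, mul_pow, Real.norm_eq_abs, sq_abs]
      field_simp
    have m2 : complexHessian (fun x : C2 => -(ε * ‖x‖ ^ 2)) p L = -(ε / 4) := by
      rw [complexHessian_eq_re_leviForm]
      simp only [leviForm, Fin.sum_univ_two, wirt_wirtBar_neg_norm_sq]
      have : -(ε : ℂ) * L 0 * conj (L 0) + -(ε : ℂ) * L 1 * conj (L 1)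
          = ((-ε * (‖L 0‖ ^ 2 + ‖L 1‖ ^ 2) : ℝ) : ℂ) := by
        rw [mul_assoc, mul_assoc, mul_conj, mul_conj, normSq_eq_norm_sq, normSq_eq_norm_sq]
        push_cast; ring
      simp only [if_true, one_ne_zero, zero_ne_one, if_false, zero_mul, add_zero, zero_add]
      rw [this, ofReal_re, hLn]
      ring
    rw [complexHessian_eq_re_leviForm, leviForm_add hlog hN2, add_re,
      ← complexHessian_eq_re_leviForm, ← complexHessian_eq_re_leviForm, m1, m2]
    ring
  rw [k1, k5, k6]
  have := admissible_inequality (h := -μ + 2 * ‖κ‖ ^ 2) (κ := κ) hε hη2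
  convert this using 3
  ring

end Transversal

/-! ### Gluing the local weights. -/

section Gluing

open Filter Topology Set

theorem isClosed_connectedComponentIn {S : Set C2} (hS : IsClosed S) (p : C2) :
    IsClosed (connectedComponentIn S p) := by
  by_cases hp : p ∈ S
  · refine isClosed_of_closure_subset ?_
    exact isPreconnected_connectedComponentIn.closure.subset_connectedComponentIn
      (subset_closure (mem_connectedComponentIn hp))
      (closure_minimal (connectedComponentIn_subset S p) hS)
  · rw [connectedComponentIn_eq_empty hp]
    exact isClosed_empty

theorem pairwiseDisjoint_componentsOf (S : Set C2) : (componentsOf S).PairwiseDisjoint id := by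
  rintro K ⟨p, hp, rfl⟩ K' ⟨q, hq, rfl⟩ hne
  refine Set.disjoint_left.2 fun x hx hx' => hne ?_
  rw [connectedComponentIn_eq hx, connectedComponentIn_eq hx']

/-- Local weights along finitely many disjoint closed sets glue to a global one. -/
theorem exists_contDiff_eventuallyEq {𝒮 : Set (Set C2)} (hfin : 𝒮.Finite)
    (hcl : ∀ S ∈ 𝒮, IsClosed S) (hdisj : 𝒮.PairwiseDisjoint id) (ψ : Set C2 → C2 → ℝ)
    (hψ : ∀ S ∈ 𝒮, ∀ p ∈ S, ∀ᶠ x in 𝓝 p, ContDiffAt ℝ ∞ (ψ S) x) :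
    ∃ Ψ : C2 → ℝ, ContDiff ℝ ∞ Ψ ∧ ∀ S ∈ 𝒮, ∀ p ∈ S, Ψ =ᶠ[𝓝 p] ψ S := by
  have h1 : ∀ S ∈ 𝒮, ∃ f : C2 → ℝ, ContDiff ℝ ∞ f ∧ (∀ p ∈ S, f =ᶠ[𝓝 p] ψ S) ∧
      ∀ T ∈ 𝒮, T ≠ S → ∀ p ∈ T, f =ᶠ[𝓝 p] fun _ => 0 := by
    intro S hS
    have hU : IsOpen ({x | ∀ᶠ y in 𝓝 x, ContDiffAt ℝ ∞ (ψ S) y} ∩ (⋃₀ (𝒮 \ {S}))ᶜ) :=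
      isOpen_setOfPred_eventually_nhds.inter
        (by
          rw [sUnion_eq_biUnion]
          exact ((hfin.subset sdiff_subset).isClosed_biUnion fun T hT => hcl T hT.1).isOpen_compl)
    obtain ⟨χ, hχ, hχ1, hχs, -⟩ := exists_contDiff_one_near (hcl S hS) hU (by
      refine fun p hp => ⟨hψ S hS p hp, ?_⟩
      rintro ⟨T, ⟨hT, hTS⟩, hpT⟩
      exact Set.disjoint_left.1 (hdisj hT hS hTS) hpT hp)
    refine ⟨fun x => χ x * ψ S x, contDiff_mul_of_tsupport_subset hχ
      (fun x hx => (hx.1 : ∀ᶠ y in 𝓝 x, ContDiffAt ℝ ∞ (ψ S) y).self_of_nhds) hχs, ?_, ?_⟩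
    · intro p hp
      filter_upwards [hχ1 p hp] with x hx
      rw [hx, one_mul]
    · intro T hT hTS p hp
      have : p ∉ tsupport χ := fun h => (hχs h).2 ⟨T, ⟨hT, hTS⟩, hp⟩
      filter_upwards [notMem_tsupport_iff_eventuallyEq.1 this] with x hx
      rw [hx, Pi.zero_apply, zero_mul]
  choose! f hf1 hf2 hf3 using h1
  refine ⟨fun x => ∑ S ∈ hfin.toFinset, f S x,
    ContDiff.sum fun S hS => hf1 S (hfin.mem_toFinset.1 hS), ?_⟩
  intro S hS p hp
  have h2 : ∀ᶠ x in 𝓝 p, ∀ T ∈ 𝒮, S ≠ T → f T x = 0 :=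
    (hfin.eventually_all).2 fun T hT => by
      by_cases h : S = T
      · exact Eventually.of_forall fun x h' => (h' h).elim
      · exact (hf3 T hT S hS h p hp).mono fun x hx _ => hx
  filter_upwards [h2, hf2 S hS p hp] with x hx1 hx2
  rw [Finset.sum_eq_single S (fun T hT hTS => hx1 T (hfin.mem_toFinset.1 hT) hTS.symm)
    (fun h => (h (hfin.mem_toFinset.2 hS)).elim), hx2]

theorem isClosed_criticalSet {Ω : Set C2} {d : C2 → ℝ} (hd : IsBoundaryDistance Ω d) :
    IsClosed (criticalSet Ω) := by
  have hD : ContDiff ℝ ∞ (fun x => (d x : ℂ)) := hd.defining.1.complexOfReal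
  have h : criticalSet Ω = frontier Ω ∩ ({p | wirt 0 (fun x => (d x : ℂ)) p = 0} ∩
      {p | wirt 0 (wirtBar 0 (fun x => (d x : ℂ))) p = 0}) := by
    ext p
    exact ⟨fun hp => ⟨hp.1, (criticalSet_iff hd hp.1).1 hp⟩,
      fun hp => (criticalSet_iff hd hp.1).2 hp.2⟩
  rw [h]
  exact isClosed_frontier.inter ((isClosed_eq (hD.wirt 0).continuous continuous_const).inter
    (isClosed_eq ((hD.wirtBar 0).wirt 0).continuous continuous_const))

/-- The weakly pseudoconvex set is closed, being the zero set of the Levi function on the boundary,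
so a limit point could only leave by entering `weakSet₁ Ω`, which regularity forbids. -/
theorem isClosed_weakSet₂ {Ω : Set C2} {d : C2 → ℝ} (hd : IsBoundaryDistance Ω d)
    (hpsc : IsLeviPseudoconvex Ω) (h : weakSet₁ Ω ∩ closure (weakSet₂ Ω) = ∅) :
    IsClosed (weakSet₂ Ω) := by
  have hW : IsClosed (weaklyPseudoconvexPoints Ω) := by
    have e : weaklyPseudoconvexPoints Ω = frontier Ω ∩ {p | leviFn d p = 0} := by
      ext p
      exact ⟨fun hp => ⟨hp.1, (mem_weaklyPseudoconvexPoints_iff hd hpsc hp.1).1 hp⟩,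
        fun hp => (mem_weaklyPseudoconvexPoints_iff hd hpsc hp.1).2 hp.2⟩
    rw [e]
    exact isClosed_frontier.inter
      (isClosed_eq (contDiff_leviFn hd.defining.1).continuous continuous_const)
  refine isClosed_of_closure_subset fun p hp => ?_
  have hpW : p ∈ weaklyPseudoconvexPoints Ω := closure_minimal (fun x hx => hx.1) hW hp
  refine ⟨hpW, fun h0 => ?_⟩
  have : p ∈ weakSet₁ Ω ∩ closure (weakSet₂ Ω) := ⟨⟨hpW, h0⟩, hp⟩
  rw [h] at this
  exact this

theorem exists_local_weight_of_annulus {Ω : Set C2} {d : C2 → ℝ} (hd : IsBoundaryDistance Ω d)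
    (hpsc : IsLeviPseudoconvex Ω) (hH : IsHartogs Ω) {τ : ℝ} (hτ0 : 0 < τ) (hτ1 : τ < 1)
    {K : Set C2} (hK : K ⊆ criticalSet Ω) {A B C : ℝ} (hA : 0 < A) (hAB : A ≤ B) (hC : 0 < C)
    (hABC : ∀ p ∈ K, A ≤ ‖p 0‖ ^ 2 ∧ ‖p 0‖ ^ 2 ≤ B ∧
        ‖wirt 1 (wirtBar 0 (signedBdryDistC Ω)) p‖ ≤ C / ‖p 0‖)
    (hτ : τ < Real.pi / (2 * C * Real.log (B / A) + Real.pi)) :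
    ∃ ψ : C2 → ℝ, (∀ p ∈ K, ∀ᶠ x in 𝓝 p, ContDiffAt ℝ ∞ ψ x) ∧
      ∀ p ∈ K, IsAdmissibleWeight d ψ τ p := by
  have hB : 0 < B := hA.trans_le hAB
  have hτ' : 0 < 1 - τ := by linarith
  have hpi := Real.pi_pos
  set k := τ / (1 - τ) with hk
  have hk0 : 0 < k := div_pos hτ0 hτ'
  have hℓ : 0 ≤ Real.log (B / A) := Real.log_nonneg ((one_le_div hA).2 hAB)
  have hℓe : Real.log (B / A) = Real.log B - Real.log A := Real.log_div hB.ne' hA.ne'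
  set ℓ := Real.log (B / A) with hℓd
  have h1 : 2 * k * C * ℓ < Real.pi := by
    rw [lt_div_iff₀ (by positivity)] at hτ
    have e : 2 * k * C * ℓ = 2 * C * ℓ * τ / (1 - τ) := by rw [hk]; ring
    rw [e, div_lt_iff₀ hτ']
    linarith
  -- A slightly larger constant turns the given bound on the mixed derivative into the strict one,
  -- which is possible because τ is strictly below the threshold.
  obtain ⟨C', hCC', hC'⟩ : ∃ C', C < C' ∧ 2 * k * C' * ℓ < Real.pi := by
    have hcont : ContinuousAt (fun c => 2 * k * c * ℓ) C := by fun_prop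
    have h2 : ∀ᶠ c in 𝓝[>] C, 2 * k * c * ℓ < Real.pi :=
      (hcont.eventually_lt continuousAt_const h1).filter_mono nhdsWithin_le_nhds
    obtain ⟨c, hc1, hc2⟩ := (h2.and self_mem_nhdsWithin).exists
    exact ⟨c, hc2, hc1⟩
  -- Centring at the midpoint keeps the argument of the cosine within kC'ℓ < π/2 on both sides.
  set x₀ := (Real.log A + Real.log B) / 2 with hx₀
  have hz : ∀ p ∈ K, 0 < ‖p 0‖ := by
    intro p hp
    have h2 := (hABC p hp).1
    by_contra h3
    have h4 : ‖p 0‖ = 0 := le_antisymm (not_lt.1 h3) (norm_nonneg _)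
    rw [h4] at h2
    norm_num at h2
    linarith
  have hcos : ∀ p ∈ K, 0 < Real.cos (2 * k * C' * (Real.log (‖p 0‖ ^ 2) - x₀)) := by
    intro p hp
    have hzp := hz p hp
    have h2 : Real.log A ≤ Real.log (‖p 0‖ ^ 2) := Real.log_le_log hA (hABC p hp).1
    have h3 : Real.log (‖p 0‖ ^ 2) ≤ Real.log B :=
      Real.log_le_log (by positivity) (hABC p hp).2.1
    have h4 : 0 < 2 * k * C' := by have := hC.trans hCC'; positivity
    apply Real.cos_pos_of_mem_Ioo
    constructor
    · have := mul_le_mul_of_nonneg_left (show -(ℓ / 2) ≤ Real.log (‖p 0‖ ^ 2) - x₀ by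
        rw [hℓe, hx₀]; linarith) h4.le
      linarith
    · have := mul_le_mul_of_nonneg_left (show Real.log (‖p 0‖ ^ 2) - x₀ ≤ ℓ / 2 by
        rw [hℓe, hx₀]; linarith) h4.le
      linarith
  refine ⟨fun x => radialWeight k C' x₀ (‖x 0‖ ^ 2), fun p hp => ?_, fun p hp => ?_⟩
  · have hN := contDiff_norm_coord_sq.continuous.continuousAt (x := p)
    have hy : 0 < ‖p 0‖ ^ 2 := pow_pos (hz p hp) 2
    have hc : ContinuousAt
        (fun x : C2 => Real.cos (2 * k * C' * (Real.log (‖x 0‖ ^ 2) - x₀))) p :=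
      Real.continuous_cos.continuousAt.comp (continuousAt_const.mul
        ((hN.log hy.ne').sub continuousAt_const))
    filter_upwards [hN.eventually (lt_mem_nhds hy), hc.eventually (lt_mem_nhds (hcos p hp))]
      with x hx1 hx2
    exact ContDiffAt.comp (g := radialWeight k C' x₀) x (contDiffAt_radialWeight hx1 hx2)
      contDiff_norm_coord_sq.contDiffAt
  · have hp' := hK hp
    refine isAdmissibleWeight_of_annulus hd hpsc hH hτ0 hτ1 hp' (hz p hp) (hC.trans hCC') ?_
      (hcos p hp)
    have h2 := (hABC p hp).2.2
    rw [wirt_wirtBar_signedBdryDistC hd hp'.1, ← norm_conj,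
      conj_wirt_wirtBar_of_real hd.defining.1.complexOfReal (fun x => conj_ofReal _)] at h2
    exact h2.trans_lt (div_lt_div_of_pos_right hCC' (hz p hp))

theorem exists_pos_mul_norm_sq_lt {Ω : Set C2} (hb : Bornology.IsBounded Ω) {τ : ℝ} (hτ0 : 0 < τ)
    (hτ1 : τ < 1) : ∃ ε > 0, ∀ p ∈ frontier Ω, τ * ε * ‖p‖ ^ 2 < 1 - τ := by
  obtain ⟨M, hM⟩ := hb.closure.exists_norm_le
  refine ⟨(1 - τ) / (τ * (M ^ 2 + 1)), div_pos (by linarith) (by positivity), fun p hp => ?_⟩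
  have h1 : ‖p‖ ^ 2 < M ^ 2 + 1 := by
    have := pow_le_pow_left₀ (norm_nonneg p) (hM p hp.1) 2
    linarith
  have e : τ * ((1 - τ) / (τ * (M ^ 2 + 1))) * ‖p‖ ^ 2 = (1 - τ) * (‖p‖ ^ 2 / (M ^ 2 + 1)) := by
    field_simp
  rw [e]
  have h2 : ‖p‖ ^ 2 / (M ^ 2 + 1) < 1 := (div_lt_one (by positivity)).2 h1
  nlinarith

theorem exists_admissible_weight {Ω : Set C2} (hb : Bornology.IsBounded Ω) {d : C2 → ℝ}
    (hd : IsBoundaryDistance Ω d) (hpsc : IsLeviPseudoconvex Ω) (hH : IsHartogs Ω)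
    (hreg : HasRegularWeaklyPseudoconvexPoints Ω) {A B C : Set C2 → ℝ}
    (hABC : ∀ K ∈ annulusLikeComponents Ω, 0 < A K ∧ A K ≤ B K ∧ 0 < C K ∧
      ∀ p ∈ K, A K ≤ ‖p 0‖ ^ 2 ∧ ‖p 0‖ ^ 2 ≤ B K ∧
        ‖wirt 1 (wirtBar 0 (signedBdryDistC Ω)) p‖ ≤ C K / ‖p 0‖)
    {τ : ℝ} (hτ0 : 0 < τ) (hτ1 : τ < 1)
    (hτ : ∀ K ∈ annulusLikeComponents Ω,
      τ < Real.pi / (2 * C K * Real.log (B K / A K) + Real.pi)) :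
    ∃ Ψ : C2 → ℝ, ContDiff ℝ ∞ Ψ ∧
      ∀ p ∈ frontier Ω, leviFn d p = 0 → IsAdmissibleWeight d Ψ τ p := by
  obtain ⟨hr1, hr2, hr3⟩ := hreg
  have h2cl := isClosed_weakSet₂ hd hpsc hr1
  rw [weakSet₁_eq_criticalSet hd hpsc] at hr1 hr2 hr3
  obtain ⟨ε, hε, hεp⟩ := exists_pos_mul_norm_sq_lt hb hτ0 hτ1
  -- These sets are closed, pairwise disjoint, finite in number, and cover the weakly pseudoconvex
  -- points; each carries a single weight formula.
  set 𝒮 : Set (Set C2) := insert (weakSet₂ Ω) (componentsOf (criticalSet Ω)) with h𝒮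
  have hsub : ∀ K ∈ componentsOf (criticalSet Ω), K ⊆ criticalSet Ω := by
    rintro K ⟨p, -, rfl⟩
    exact connectedComponentIn_subset _ _
  have hcl : ∀ S ∈ 𝒮, IsClosed S := by
    rintro S (rfl | ⟨p, -, rfl⟩)
    · exact h2cl
    · exact isClosed_connectedComponentIn (isClosed_criticalSet hd) p
  have hdisj : 𝒮.PairwiseDisjoint id := by
    refine (pairwiseDisjoint_componentsOf _).insert fun K hK _ => ?_
    exact Set.disjoint_left.2 fun x hx hx' => hx.2 (hsub K hK hx').2.1
  have hloc : ∀ S ∈ 𝒮, ∃ ψ : C2 → ℝ, (∀ p ∈ S, ∀ᶠ x in 𝓝 p, ContDiffAt ℝ ∞ ψ x) ∧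
      ∀ p ∈ S, IsAdmissibleWeight d ψ τ p := by
    rintro S (rfl | hS)
    · have key : ∀ p ∈ weakSet₂ Ω, radialDeriv d p ≠ 0 ∧ IsAdmissibleWeight d
          (fun x => -Real.log (radialDeriv d x) + -(ε * ‖x‖ ^ 2)) τ p := by
        rintro p ⟨hw, h0⟩
        have h : (fun x => (d x : ℂ)) =ᶠ[𝓝 p] signedBdryDistC Ω :=
          (hd.eq_dist p hw.1).mono fun x hx => by simp only [hx, signedBdryDistC]
        rw [← h.wirt_eq] at h0
        exact isAdmissibleWeight_of_transversal hd hpsc hH hτ0 hw.1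
          ((mem_weaklyPseudoconvexPoints_iff hd hpsc hw.1).1 hw) h0 hε (hεp p hw.1)
      refine ⟨_, fun p hp => ?_, fun p hp => (key p hp).2⟩
      have hφ := contDiff_radialDeriv hd.defining.1
      filter_upwards [hφ.continuous.continuousAt.eventually_ne (key p hp).1] with x hx
      exact (hφ.contDiffAt.log hx).neg.add (contDiff_neg_norm_sq ε).contDiffAt
    · rcases hr3 S hS with hdl | hal
      · refine ⟨fun x => -(ε * ‖x‖ ^ 2),
          fun p _ => Eventually.of_forall fun x => (contDiff_neg_norm_sq ε).contDiffAt,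
          fun p hp => ?_⟩
        have hp' := hsub S hS hp
        exact isAdmissibleWeight_of_disk hd hpsc hτ1 hp'
          (mixed_eq_zero_of_ray hd hpsc hH fun s hs0 hs1 => hsub S hS (hdl p hp s hs0 hs1)) hε
          (hεp p hp'.1) hτ0
      · obtain ⟨hA, hAB, hC, hK⟩ := hABC S ⟨hS, hal⟩
        exact exists_local_weight_of_annulus hd hpsc hH hτ0 hτ1 (hsub S hS) hA hAB hC hK
          (hτ S ⟨hS, hal⟩)
  choose! ψ hψ1 hψ2 using hloc
  obtain ⟨Ψ, hΨ, hΨe⟩ := exists_contDiff_eventuallyEq (hr2.insert _) hcl hdisj ψ hψ1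
  refine ⟨Ψ, hΨ, fun p hp hl => ?_⟩
  have hw := (mem_weaklyPseudoconvexPoints_iff hd hpsc hp).2 hl
  have hS : ∃ S ∈ 𝒮, p ∈ S := by
    by_cases h0 : wirt 0 (signedBdryDistC Ω) p = 0
    · have hc : p ∈ criticalSet Ω := by
        rw [← weakSet₁_eq_criticalSet hd hpsc]; exact ⟨hw, h0⟩
      exact ⟨_, Or.inr ⟨p, hc, rfl⟩, mem_connectedComponentIn hc⟩
    · exact ⟨_, Or.inl rfl, hw, h0⟩
  obtain ⟨S, hS, hpS⟩ := hS
  exact (hψ2 S hS p hpS).congr (hΨe S hS p hpS)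

end Gluing

/-! ### From a neighbourhood of the boundary to the whole domain. -/

section GlobalExtension

open Filter Topology Set

/-- A smooth convex increasing function which is constant on `(-∞, -b]` and the identity on
`[-b/2, ∞)`. -/
theorem exists_convex_cutoff {b : ℝ} (hb : 0 < b) : ∃ χ : ℝ → ℝ, ContDiff ℝ ∞ χ ∧
    (∀ t, -(b / 2) ≤ t → χ t = t) ∧ (∀ t, t < 0 → χ t < 0) ∧ (∀ t, 0 ≤ deriv χ t) ∧
    (∀ t, 0 ≤ deriv (deriv χ) t) ∧ ∀ t, t ≤ -b → deriv χ t = 0 ∧ deriv (deriv χ) t = 0 := by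
  set f : ℝ → ℝ := fun s => Real.smoothTransition (2 * (s + b) / b) with hf
  have hfc : ContDiff ℝ ∞ f :=
    Real.smoothTransition.contDiff.comp (by fun_prop)
  have hf0 : ∀ s, 0 ≤ f s := fun s => Real.smoothTransition.nonneg _
  have hfm : Monotone f := fun s t hst => Real.smoothTransition.monotone (by gcongr)
  set χ : ℝ → ℝ := fun t => -(b / 2) + ∫ s in (-(b / 2))..t, f s with hχ
  have hder : ∀ t, HasDerivAt χ (f t) t := fun t =>
    (intervalIntegral.integral_hasDerivAt_right (hfc.continuous.intervalIntegrable _ _)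
      (hfc.continuous.stronglyMeasurableAtFilter _ _) hfc.continuous.continuousAt).const_add _
  have hd : deriv χ = f := funext fun t => (hder t).deriv
  have hid : ∀ t, -(b / 2) ≤ t → χ t = t := by
    intro t ht
    have h1 : ∫ s in (-(b / 2))..t, f s = ∫ s in (-(b / 2))..t, (1 : ℝ) := by
      refine intervalIntegral.integral_congr fun s hs => ?_
      rw [uIcc_of_le ht] at hs
      refine Real.smoothTransition.one_of_one_le ?_
      rw [le_div_iff₀ hb]
      linarith [hs.1]
    simp only [hχ, h1, intervalIntegral.integral_const, smul_eq_mul]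
    ring
  have hmono : Monotone χ := monotone_of_deriv_nonneg (fun t => (hder t).differentiableAt)
    fun t => by rw [hd]; exact hf0 t
  refine ⟨χ, ?_, hid, ?_, ?_, ?_, ?_⟩
  · rw [contDiff_infty_iff_deriv, hd]
    exact ⟨fun t => (hder t).differentiableAt, hfc⟩
  · intro t ht
    rcases le_total (-(b / 2)) t with h | h
    · rwa [hid t h]
    · have := hmono h
      rw [hid _ le_rfl] at this
      linarith
  · rw [hd]; exact hf0
  · intro t
    rw [hd]
    exact hfm.deriv_nonneg
  · intro t ht
    have hz : ∀ s, s ≤ -b → f s = 0 := by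
      intro s hs
      refine Real.smoothTransition.zero_of_nonpos ?_
      exact div_nonpos_of_nonpos_of_nonneg (by linarith) hb.le
    rw [hd]
    refine ⟨hz t ht, ?_⟩
    have h1 : IsLocalMin f t := Eventually.of_forall fun s => by rw [hz t ht]; exact hf0 s
    exact h1.deriv_eq_zero

theorem rpow_neg_rpow_inv {τ u : ℝ} (hτ : τ ≠ 0) (hu : 0 < u) : -((-(-(u ^ τ⁻¹))) ^ τ) = -u := by
  rw [neg_neg, ← Real.rpow_mul hu.le, inv_mul_cancel₀ hτ, Real.rpow_one]

/-- Modifying a defining function away from the boundary through a convex cutoff. -/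
theorem exists_smooth_reparametrization {τ b : ℝ} (hτ0 : 0 < τ) (hb : 0 < b) {χ : ℝ → ℝ}
    (hχ : ContDiff ℝ ∞ χ) (hid : ∀ t, -(b / 2) ≤ t → χ t = t) (hneg : ∀ t, t < 0 → χ t < 0) :
    ∃ G : ℝ → ℝ, ContDiff ℝ ∞ G ∧ (∀ y, G y < 0 ↔ y < 0) ∧ G =ᶠ[𝓝 0] id ∧
      ∀ y < 0, -((-G y) ^ τ) = χ (-((-y) ^ τ)) := by
  -- G is χ conjugated by y ↦ -(-y)^τ. That map is not smooth at 0, but χ is the identity near 0, so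
  -- G is too.
  set G : ℝ → ℝ := fun y => if y < 0 then -((-χ (-((-y) ^ τ))) ^ τ⁻¹) else y with hG
  set η := (b / 2) ^ τ⁻¹ with hη
  have hη0 : 0 < η := by positivity
  have hnear : ∀ y, -η < y → G y = y := by
    intro y hy
    by_cases h : y < 0
    · simp only [hG, if_pos h]
      have h1 : (-y) ^ τ ≤ b / 2 := by
        have h2 : (-y) ^ τ ≤ η ^ τ := Real.rpow_le_rpow (by linarith) (by linarith) hτ0.le
        rwa [hη, ← Real.rpow_mul (by positivity), inv_mul_cancel₀ hτ0.ne', Real.rpow_one] at h2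
      rw [hid _ (by linarith), neg_neg, ← Real.rpow_mul (by linarith), mul_inv_cancel₀ hτ0.ne',
        Real.rpow_one, neg_neg]
    · simp only [hG, if_neg h]
  have harg : ∀ y < 0, 0 < -χ (-((-y) ^ τ)) := fun y hy => by
    have : 0 < (-y) ^ τ := Real.rpow_pos_of_pos (by linarith) _
    linarith [hneg (-((-y) ^ τ)) (by linarith)]
  refine ⟨G, ?_, ?_, ?_, ?_⟩
  · rw [contDiff_iff_contDiffAt]
    intro y
    by_cases h : y < 0
    · have hev : G =ᶠ[𝓝 y] fun y => -((-χ (-((-y) ^ τ))) ^ τ⁻¹) := by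
        filter_upwards [gt_mem_nhds h] with s hs
        simp only [hG, if_pos hs]
      refine ContDiffAt.congr_of_eventuallyEq ?_ hev
      have h1 : ContDiffAt ℝ ∞ (fun y : ℝ => -((-y) ^ τ)) y :=
        (contDiffAt_id.neg.rpow_const_of_ne (by simpa using h.ne)).neg
      have h2 : ContDiffAt ℝ ∞ (fun y : ℝ => -χ (-((-y) ^ τ))) y :=
        (hχ.contDiffAt.comp y h1).neg
      exact (h2.rpow_const_of_ne (harg y h).ne').neg
    · have hev : G =ᶠ[𝓝 y] fun y => y := by
        filter_upwards [lt_mem_nhds (show -η < y by linarith)] with s hs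
        exact hnear s hs
      exact contDiffAt_id.congr_of_eventuallyEq hev
  · intro y
    by_cases h : y < 0
    · simp only [hG, if_pos h, h, iff_true]
      have := Real.rpow_pos_of_pos (harg y h) τ⁻¹
      linarith
    · simp only [hG, if_neg h]
  · filter_upwards [lt_mem_nhds (show -η < 0 by linarith)] with s hs
    exact hnear s hs
  · intro y hy
    simp only [hG, if_pos hy]
    rw [rpow_neg_rpow_inv hτ0.ne' (harg y hy), neg_neg]

/-- If `-(-ρ)^τ` is plurisubharmonic near the boundary, then `τ` is a Diederich-Fornæss
exponent. -/
theorem isDFExponent_of_eventually {Ω : Set C2} (hb : Bornology.IsBounded Ω) {τ : ℝ}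
    (hτ0 : 0 < τ) (hτ1 : τ < 1) {ρ : C2 → ℝ} (hρ : IsDefiningFunction ⊤ Ω ρ)
    (hpsh : ∀ p ∈ frontier Ω, ∀ᶠ x in 𝓝 p, x ∈ Ω → ∀ t,
      0 ≤ complexHessian (fun y => -((-ρ y) ^ τ)) x t) : IsDFExponent Ω τ := by
  have hΩ : IsOpen Ω := hρ.2.1 ▸ isOpen_lt hρ.1.continuous continuous_const
  have hmem : ∀ x, x ∈ Ω ↔ ρ x < 0 := fun x => by
    conv_lhs => rw [hρ.2.1]
    rfl
  set φ : C2 → ℝ := fun y => -((-ρ y) ^ τ) with hφ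
  have hφ0 : ∀ x ∈ Ω, φ x < 0 := fun x hx => by
    have := Real.rpow_pos_of_pos (neg_pos.2 ((hmem x).1 hx)) τ
    simp only [hφ]; linarith
  have hφs : ∀ x ∈ Ω, ContDiffAt ℝ ∞ φ x := fun x hx =>
    (hρ.1.contDiffAt.neg.rpow_const_of_ne (by have := (hmem x).1 hx; linarith)).neg
  set V : Set C2 := {p | ∀ᶠ x in 𝓝 p, x ∈ Ω → ∀ t, 0 ≤ complexHessian φ x t} with hV
  have hVo : IsOpen V := isOpen_setOfPred_eventually_nhds
  have hcomp : IsCompact (closure Ω \ V) := hb.isCompact_closure.diff hVo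
  have hsub : closure Ω \ V ⊆ Ω := by
    rintro x ⟨hx, hxV⟩
    by_contra h
    exact hxV (hpsh x ⟨hx, by rwa [hΩ.interior_eq]⟩)
  -- The points where plurisubharmonicity is not known form a compact subset of Ω, so φ has a
  -- negative maximum there; χ is flat below that level.
  obtain ⟨b, hb0, hbx⟩ : ∃ b > 0, ∀ x ∈ closure Ω \ V, φ x ≤ -b := by
    rcases (closure Ω \ V).eq_empty_or_nonempty with he | hne
    · exact ⟨1, one_pos, fun x hx => by rw [he] at hx; exact hx.elim⟩
    · obtain ⟨x₀, hx₀, hmax⟩ := hcomp.exists_isMaxOn hne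
        (fun x hx => (hφs x (hsub hx)).continuousAt.continuousWithinAt)
      exact ⟨-φ x₀, neg_pos.2 (hφ0 x₀ (hsub hx₀)), fun x hx => by rw [neg_neg]; exact hmax hx⟩
  obtain ⟨χ, hχ, hid, hneg, hd1, hd2, hflat⟩ := exists_convex_cutoff hb0
  obtain ⟨G, hG, hG0, hGid, hGχ⟩ := exists_smooth_reparametrization hτ0 hb0 hχ hid hneg
  have hfront : ∀ p ∈ frontier Ω, (fun x => G (ρ x)) =ᶠ[𝓝 p] ρ := by
    intro p hp
    have h1 : Tendsto ρ (𝓝 p) (𝓝 0) := by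
      have := hρ.1.continuous.continuousAt (x := p)
      rwa [ContinuousAt, hρ.eq_zero hp] at this
    exact h1.eventually hGid
  have hcongr : ∀ x ∈ Ω, (fun y => -((-G (ρ y)) ^ τ)) =ᶠ[𝓝 x] fun y => χ (φ y) := by
    intro x hx
    filter_upwards [hΩ.mem_nhds hx] with y hy
    exact hGχ (ρ y) ((hmem y).1 hy)
  refine ⟨hτ0, hτ1, fun x => G (ρ x), ⟨hG.comp hρ.1, ?_, fun p hp => ?_⟩, ?_, ?_⟩
  · ext x
    rw [hmem]
    exact (hG0 _).symm
  · rw [(hfront p hp).fderiv_eq]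
    exact hρ.2.2 p hp
  · intro x hx
    refine ContDiffAt.contDiffWithinAt ?_
    refine ContDiffAt.congr_of_eventuallyEq ?_ (hcongr x hx)
    exact (hχ.contDiffAt.comp x (hφs x hx)).of_le ENat.LEInfty.out
  · intro x hx t
    rw [(hcongr x hx).complexHessian_eq, complexHessian_comp
      (hχ.contDiffAt.of_le ENat.LEInfty.out) ((hφs x hx).of_le ENat.LEInfty.out)]
    by_cases hxV : x ∈ V
    · have h1 : 0 ≤ complexHessian φ x t :=
        (show ∀ᶠ x in 𝓝 x, x ∈ Ω → ∀ t, 0 ≤ complexHessian φ x t from hxV).self_of_nhds hx t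
      exact add_nonneg (mul_nonneg (hd1 _) h1) (mul_nonneg (hd2 _) (sq_nonneg _))
    · obtain ⟨h1, h2⟩ := hflat (φ x) (hbx x ⟨subset_closure hx, hxV⟩)
      rw [h1, h2]
      simp

/-- The Levi function is nonnegative on the boundary: where it is positive the strict criterion
applies, where it is zero the weight decides. -/
theorem isDFExponent_of_admissible_weight {Ω : Set C2} (hb : Bornology.IsBounded Ω) {d : C2 → ℝ}
    (hd : IsBoundaryDistance Ω d) (hpsc : IsLeviPseudoconvex Ω) {τ : ℝ} (hτ0 : 0 < τ)
    (hτ1 : τ < 1) {Ψ : C2 → ℝ} (hΨ : ContDiff ℝ ∞ Ψ)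
    (hadm : ∀ p ∈ frontier Ω, leviFn d p = 0 → IsAdmissibleWeight d Ψ τ p) :
    IsDFExponent Ω τ := by
  have hdef : IsDefiningFunction ⊤ Ω (fun x => d x * Real.exp (Ψ x)) := by
    refine ⟨hd.defining.1.mul hΨ.exp, ?_, fun p hp => ?_⟩
    · ext x
      conv_lhs => rw [hd.defining.2.1]
      exact ⟨fun h => mul_neg_of_neg_of_pos h (Real.exp_pos _),
        fun h => neg_of_mul_neg_left h (Real.exp_pos _).le⟩
    · have h1 : DifferentiableAt ℝ d p := hd.defining.1.differentiable (by simp) p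
      have h2 : DifferentiableAt ℝ (fun x => Real.exp (Ψ x)) p :=
        hΨ.exp.differentiable (by simp) p
      rw [fderiv_fun_mul h1 h2, hd.defining.eq_zero hp, zero_smul, zero_add]
      exact smul_ne_zero (Real.exp_pos _).ne' (hd.defining.2.2 p hp)
  refine isDFExponent_of_eventually hb hτ0 hτ1 hdef fun p hp => ?_
  rcases (leviFn_nonneg hd hpsc hp).eq_or_lt with h | h
  · obtain ⟨μ, hμ, hβ⟩ := hadm p hp h.symm
    exact eventually_complexHessian_nonneg_of_weak hb hd hpsc hΨ hτ0 hτ1 hp hμ hβ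
  · exact eventually_complexHessian_nonneg_of_strict hd hΨ hτ0 hτ1 hp h

end GlobalExtension

/-! ### The lower bound for the index. -/

theorem mainTheorem2 (Ω : Set C2)
    (hopen : IsOpen Ω) (hconn : IsConnected Ω) (hbdd : Bornology.IsBounded Ω)
    (hsmooth : HasSmoothBoundary Ω) (hpsc : IsLeviPseudoconvex Ω)
    (hHartogs : IsHartogs Ω) (hreg : HasRegularWeaklyPseudoconvexPoints Ω)
    (A B C : Set C2 → ℝ)
    (hABC : ∀ K ∈ annulusLikeComponents Ω,
      0 < A K ∧ A K ≤ B K ∧ 0 < C K ∧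
      ∀ p ∈ K, A K ≤ ‖p 0‖ ^ 2 ∧ ‖p 0‖ ^ 2 ≤ B K ∧
        ‖wirt 1 (wirtBar 0 (signedBdryDistC Ω)) p‖ ≤ C K / ‖p 0‖) :
    sInf (insert 1 {q : ℝ | ∃ K ∈ annulusLikeComponents Ω,
      q = Real.pi / (2 * C K * Real.log (B K / A K) + Real.pi)}) ≤ dfIndex Ω := by
  obtain ⟨d, hd⟩ := exists_isBoundaryDistance hopen hbdd hsmooth
  have hbelow : BddBelow (insert 1 {q : ℝ | ∃ K ∈ annulusLikeComponents Ω,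
      q = Real.pi / (2 * C K * Real.log (B K / A K) + Real.pi)}) := by
    refine ⟨0, ?_⟩
    rintro q (rfl | ⟨K, hK, rfl⟩)
    · exact zero_le_one
    · obtain ⟨hA, hAB, hC, -⟩ := hABC K hK
      have := Real.log_nonneg ((one_le_div hA).2 hAB)
      positivity
  refine le_of_forall_lt fun τ hτ => ?_
  have key : ∀ σ, 0 < σ → σ < sInf (insert 1 {q : ℝ | ∃ K ∈ annulusLikeComponents Ω,
      q = Real.pi / (2 * C K * Real.log (B K / A K) + Real.pi)}) → σ ≤ dfIndex Ω := by
    intro σ hσ0 hσ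
    have hσ1 : σ < 1 := hσ.trans_le (csInf_le hbelow (Set.mem_insert _ _))
    obtain ⟨Ψ, hΨ, hadm⟩ := exists_admissible_weight hbdd hd hpsc hHartogs hreg hABC hσ0 hσ1
      fun K hK => hσ.trans_le (csInf_le hbelow (Set.mem_insert_of_mem _ ⟨K, hK, rfl⟩))
    exact le_csSup ⟨1, fun _ h => h.2.1.le⟩
      (isDFExponent_of_admissible_weight hbdd hd hpsc hσ0 hσ1 hΨ hadm)
  -- An intermediate σ is needed, since τ itself may be 0 and `key` only yields a non-strict
  -- inequality. Negative τ is settled by the nonnegativity of the index.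
  rcases le_or_gt 0 τ with h | h
  · obtain ⟨σ, h1, h2⟩ := exists_between hτ
    exact h1.trans_le (key σ (h.trans_lt h1) h2)
  · exact h.trans_le (Real.sSup_nonneg fun _ h => h.1.le)
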